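/- Ground ring and conventions. Let $\mathbb{C}[s,s^{-1}][[t]]$ be the ground ring, with integral form $\mathbb{C}[s][[t]]$. All algebras are $t$-adically complete (topologically generated by the listed generators with the listed relations), and tensor products are completed. Let $q\in\mathbb{C}[s][[t]]$ satisfy $q\equiv 1+s^2t \bmod s^3t$; put $q^x=\exp(x\log q)$ and $\exp_Q(x)=\sum_{n\ge0}x^n/(n)_Q!$ with $(n)_Q=(Q^n-1)/(Q-1)$. For $F,F'\in U\otimes U$, "$F\equiv F'\bmod st$" means that $F-F'$ is $st$ times an element of the closed $\mathbb{C}[s][[t]]$-subalgebra (the integral form) generated by the generators of the two tensor factors. A *twist* of a Hopf algebra $U$ is an invertible $F\in U\otimes U$ with $F_{12}(\Delta\otimes\mathrm{id})(F)=F_{23}(\mathrm{id}\otimes\Delta)(F)$ and $(\varepsilon\otimes\mathrm{id})(F)=(\mathrm{id}\otimes\varepsilon)(F)=1$. Write $\mathcal F(\xi,\mu)=\exp\bigl(\xi(E_{12}+\mu E_{23})\otimes E_{13}\bigr)\in (U(\mathfrak{sl}_3)\otimes U(\mathfrak{sl}_3))[[t]]$. That an element $F$ has a given limit as $s\to0$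 means that $F$ lies in the integral form and that its specialization at $s=0$, with the generators replaced by their stated classical values in $U(\mathfrak{sl}_3)$, is the given element. 1. *The case $\mathfrak h^{(0,1)}$.* Let $U_q(\mathfrak{sl}_3)$ be generated by $h_{12},h_{23},e_{12},e_{23},e_{21},e_{32}$ with $[h_{12},h_{23}]=0$, $[h_{ij},e_{kl}]=(\delta_{ik}+\delta_{jl}-\delta_{il}-\delta_{jk})e_{kl}$, $[e_{12},e_{32}]=[e_{21},e_{23}]=0$, $[e_{i,i+1},e_{i+1,i}]=\frac{q^{h_{i,i+1}}-q^{-h_{i,i+1}}}{q-q^{-1}}$, $e_{13}e_{12}=q^{-1}e_{12}e_{13}$, $e_{13}e_{23}=qe_{23}e_{13}$, $e_{21}e_{31}=qe_{31}e_{21}$, $e_{32}e_{31}=q^{-1}e_{31}e_{32}$, where $e_{13}=e_{12}e_{23}-q^{-1}e_{23}e_{12}$, $e_{31}=e_{32}e_{21}-qe_{21}e_{32}$, $h_{13}=h_{12}+h_{23}$. The coproduct is given by $\Delta(h)=h\otimes1+1\otimes h$ for $h=h_{12},h_{23}$, $\Delta(e_{i,i+1})=q^{-h_{i,i+1}}\otimes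 e_{i,i+1}+e_{i,i+1}\otimes1$, $\Delta(e_{i+1,i})=e_{i+1,i}\otimes q^{h_{i,i+1}}+1\otimes e_{i+1,i}$. Let $R_1=\exp_{q^2}(-(q-q^{-1})e_{21}\otimes e_{12})$. Then $R_1$ is a twist, with $$R_1\Delta(e_{12})R_1^{-1}=q^{h_{12}}\otimes e_{12}+e_{12}\otimes1,\qquad R_1\Delta(e_{13})R_1^{-1}=q^{-h_{13}}\otimes e_{13}+e_{13}\otimes 1 .$$ For $c\in\mathbb{C}$ let $W_c=\exp_{q^2}(c\,s^{-1}t\,q^{-h_{12}}e_{12})\exp_{q^2}(s^{-1}t\,e_{13})$. Then $F_{q,c}=(W_c\otimes W_c)R_1\Delta(W_c^{-1})$ is a twist and $$F_{q,c}\equiv\exp(-c\,t^3e_{12}\otimes e_{13})\bmod st .$$ Its limit as $s\to0$ (with $e_{ij}\mapsto E_{ij}$, $h_{ij}\mapsto H_{ij}=E_{ii}-E_{jj}$) is $\mathcal F(-c\,t^3,0)$. In particular, for $W=W_1$ one gets $\exp(-t^3e_{12}\otimes e_{13})$, and for $W_{-1}$ one gets $\exp(t^3e_{12}\otimes e_{13})$.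 2. *The case $\mathfrak h^{(1,1)}$.* Let $U_q(A_2^{(2)})$ be the Drinfeld–Jimbo algebra at level zero, generated by $h_\alpha,e_{\pm\alpha},e_{\pm(\delta-2\alpha)}$ with $[h_\alpha,e_{\pm\alpha}]=\pm2e_{\pm\alpha}$, $[h_\alpha,e_{\pm(\delta-2\alpha)}]=\mp4e_{\pm(\delta-2\alpha)}$, $[e_{\delta-2\alpha},e_{-\delta+2\alpha}]=\frac{q^{-h_\alpha}-q^{h_\alpha}}{q-q^{-1}}$, $[e_\alpha,e_{-\alpha}]=\frac{q^{h_\alpha/2}-q^{-h_\alpha/2}}{q-q^{-1}}$, $[e_\alpha,e_{-\delta+2\alpha}]=[e_{\delta-2\alpha},e_{-\alpha}]=0$, and the $q$-Serre relations $[[e_{\pm\alpha},e_{\pm(\delta-2\alpha)}]_q,e_{\pm(\delta-2\alpha)}]_q=0$ and $[e_{\pm\alpha},[e_{\pm\alpha},[e_{\pm\alpha},[e_{\pm\alpha},[e_{\pm\alpha},e_{\pm(\delta-2\alpha)}]_q]_q]_q]_q]_q=0$, where $[x,y]_q=xy-q^{(\beta,\gamma)}yx$ for $x,y$ of weights $\beta,\gamma$,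 with $(\alpha,\alpha)=1$, $(\alpha,\delta-2\alpha)=-2$, $(\delta-2\alpha,\delta-2\alpha)=4$. The coproduct is given by $\Delta(h_\alpha)=h_\alpha\otimes1+1\otimes h_\alpha$, $\Delta(e_\alpha)=q^{-h_\alpha/2}\otimes e_\alpha+e_\alpha\otimes1$, $\Delta(e_{-\alpha})=e_{-\alpha}\otimes q^{h_\alpha/2}+1\otimes e_{-\alpha}$, $\Delta(e_{\delta-2\alpha})=q^{h_\alpha}\otimes e_{\delta-2\alpha}+e_{\delta-2\alpha}\otimes1$, $\Delta(e_{-\delta+2\alpha})=e_{-\delta+2\alpha}\otimes q^{-h_\alpha}+1\otimes e_{-\delta+2\alpha}$. Let $W=\exp_q(s^{-1}t\,e_\alpha)\exp_{q^4}(s^{-1}t\,e_{-\delta+2\alpha})$ and $W'=\exp(-2t^3e_\alpha e_{-\delta+2\alpha})W$. Then $F_q=(W\otimes W)\Delta(W^{-1})$ and $F_q'=(W'\otimes W')\Delta(W'^{-1})$ are (coboundary) twists and $$F_q\equiv\exp(-2t^3e_{-\delta+2\alpha}\otimes e_\alpha),\qquad F_q'\equiv\exp(2t^3e_\alpha\otimes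 e_{-\delta+2\alpha})\pmod{st}.$$ For every $u\in\mathbb{C}\setminus\{0\}$, under the evaluation $h_\alpha\mapsto2H_{13}$, $e_\alpha\mapsto E_{12}+E_{23}$, $e_{-\alpha}\mapsto E_{21}+E_{32}$, $e_{\delta-2\alpha}\mapsto\sqrt2\,u\,E_{31}$, $e_{-\delta+2\alpha}\mapsto\sqrt2\,u^{-1}E_{13}$, the limit of $F_q'$ as $s\to0$ is $\mathcal F(2\sqrt2\,u^{-1}t^3,1)$. So both cases $\mu=0$ and $\mu=1$ of $\mathcal F(\xi,\mu)$ are recovered. -/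

import Mathlib

open scoped TensorProduct Polynomial LaurentPolynomial

noncomputable section

namespace QTwist

/-! ### Formal scalars and formal sums

The ground ring is `ℂ[s,s⁻¹]⟦t⟧`; its integral form is `ℂ[s]⟦t⟧`.
The variable of every `PowerSeries` below is `t`. -/

/-- The ring `ℂ[s,s⁻¹]`. -/
abbrev Laur : Type := ℂ[T;T⁻¹]

/-- `s` as an element of `ℂ[s,s⁻¹]⟦t⟧`. -/
def sVar : PowerSeries Laur := PowerSeries.C (LaurentPolynomial.T 1)

/-- `s⁻¹` as an element of `ℂ[s,s⁻¹]⟦t⟧`. -/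
def sInv : PowerSeries Laur := PowerSeries.C (LaurentPolynomial.T (-1))

/-- `t` as an element of `ℂ[s,s⁻¹]⟦t⟧`. -/
def tVar : PowerSeries Laur := PowerSeries.X

/-- `q ∈ ℂ[s]⟦t⟧` and `q ≡ 1 + s² t mod s³ t`. -/
def IsDeformationParameter (q : PowerSeries Laur) : Prop :=
  ∃ g : PowerSeries ℂ[X],
    q = 1 + sVar ^ 2 * tVar + sVar ^ 3 * tVar * PowerSeries.map Polynomial.toLaurent g

/-- The `t`-adic sum `∑ₖ f k` of a family with `tᵏ ∣ f k`. -/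
def formalSum {R : Type*} [Semiring R] (f : ℕ → PowerSeries R) : PowerSeries R :=
  PowerSeries.mk fun n => ∑ k ∈ Finset.range (n + 1), PowerSeries.coeff n (f k)

/-- `exp x = ∑ₖ xᵏ / k!`, for `x` without constant term in `t`. -/
def texp {R : Type*} [Ring R] [Algebra ℂ R] (x : PowerSeries R) : PowerSeries R :=
  formalSum fun k => ((k.factorial : ℂ)⁻¹) • x ^ k

/-- The structure map `ℂ[s,s⁻¹]⟦t⟧ → R⟦t⟧` of a `ℂ[s,s⁻¹]`-algebra `R`. -/
def scal {R : Type*} [Ring R] [Algebra Laur R] : PowerSeries Laur →+* PowerSeries R :=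
  PowerSeries.map (algebraMap Laur R)

/-- The Gaussian number `(n)_Q = 1 + Q + ⋯ + Q^(n-1)`. -/
def qInt (Q : PowerSeries Laur) (n : ℕ) : PowerSeries Laur := ∑ i ∈ Finset.range n, Q ^ i

/-- `(n)_Q! = (1)_Q (2)_Q ⋯ (n)_Q`. -/
def qFactorial (Q : PowerSeries Laur) (n : ℕ) : PowerSeries Laur :=
  ∏ i ∈ Finset.range n, qInt Q (i + 1)

section

variable {R : Type*} [Ring R] [Algebra ℂ R] [Algebra Laur R]

/-- The `q`-exponential `exp_Q x = ∑ₙ xⁿ / (n)_Q!`, for `Q ≡ 1 mod t` and `x` without constant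
term in `t`. The `q`-factorials are then invertible power series. -/
def qExp (Q : PowerSeries Laur) (x : PowerSeries R) : PowerSeries R :=
  formalSum fun n => scal (Ring.inverse (qFactorial Q n)) * x ^ n

/-- `q^x = exp (x log q)`, for `q ≡ 1 mod t`. -/
def qPow (q : PowerSeries Laur) (x : PowerSeries R) : PowerSeries R :=
  texp (scal (PowerSeries.logOf q) * x)

/-- `sinh (l x) / l = ∑ₖ l²ᵏ x²ᵏ⁺¹ / (2k+1)!`, for `l` without constant term in `t`. -/
def sinhDiv (l : PowerSeries Laur) (x : PowerSeries R) : PowerSeries R :=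
  formalSum fun k =>
    (((2 * k + 1).factorial : ℂ)⁻¹) • (scal (l ^ (2 * k)) * x ^ (2 * k + 1))

/-- The quantum number `(q^x - q^(-x)) / (q - q⁻¹)`, that is
`sinh (x log q) / sinh (log q)`, as an element of the `ℂ[s]⟦t⟧`-form. -/
def qNumber (q : PowerSeries Laur) (x : PowerSeries R) : PowerSeries R :=
  scal (Ring.inverse (sinhDiv (PowerSeries.logOf q) (1 : PowerSeries Laur))) *
    sinhDiv (PowerSeries.logOf q) x

end

/-! ### Topologically free algebras, their homomorphisms and their quotients -/

/-- The topologically free `ℂ[s,s⁻¹]⟦t⟧`-algebra on `G`. -/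
abbrev FreeTop (G : Type) : Type := PowerSeries (FreeAlgebra Laur G)

/-- The topologically free `ℂ[s]⟦t⟧`-algebra on `G`. -/
abbrev FreeInt (G : Type) : Type := PowerSeries (FreeAlgebra ℂ[X] G)

/-- A generator. -/
def gen {G : Type} (x : G) : FreeTop G := PowerSeries.C (FreeAlgebra.ι Laur x)

/-- The inclusion of the `ℂ[s]⟦t⟧`-form. -/
def inclInt (G : Type) : FreeInt G →+* FreeTop G :=
  PowerSeries.map (FreeAlgebra.lift ℂ[X] (FreeAlgebra.ι Laur) :
    FreeAlgebra ℂ[X] G →ₐ[ℂ[X]] FreeAlgebra Laur G).toRingHom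

/-- The `t`-linear, `t`-adically continuous extension `R⟦t⟧ → S⟦t⟧` of a ring homomorphism
`R → S⟦t⟧`. -/
def extendT {R S : Type*} [Ring R] [Ring S] (φ : R →+* PowerSeries S) :
    PowerSeries R →+* PowerSeries S where
  toFun f := PowerSeries.mk fun n =>
    ∑ p ∈ Finset.HasAntidiagonal.antidiagonal n, PowerSeries.coeff p.2 (φ (PowerSeries.coeff p.1 f))
  map_one' := by
    ext n
    rw [PowerSeries.coeff_mk, Finset.sum_eq_single (0, n)]
    · simp
    · rintro ⟨a, b⟩ h hne
      have ha : a ≠ 0 := by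
        rintro rfl
        simp at h
        exact hne (by simp [h])
      simp [PowerSeries.coeff_one, ha]
    · simp
  map_zero' := by ext n; simp
  map_add' f g := by ext n; simp [Finset.sum_add_distrib]
  map_mul' f g := by
    ext n
    simp only [PowerSeries.coeff_mk, PowerSeries.coeff_mul, map_sum, map_mul,
      Finset.sum_mul_sum]
    simp only [Finset.sum_sigma']
    let σ : (Σ _ : ℕ × ℕ, Σ _ : ℕ × ℕ, ℕ × ℕ) → (Σ _ : ℕ × ℕ, Σ _ : ℕ × ℕ, ℕ × ℕ) := fun x =>
      ⟨(x.2.1.1 + x.2.2.1, x.2.1.2 + x.2.2.2), ⟨(x.2.1.1, x.2.2.1), (x.2.1.2, x.2.2.2)⟩⟩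
    have h₁ : ∀ x ∈ (Finset.HasAntidiagonal.antidiagonal n).sigma fun a =>
        (Finset.HasAntidiagonal.antidiagonal a.1).sigma fun _ =>
          Finset.HasAntidiagonal.antidiagonal a.2,
        σ x ∈ (Finset.HasAntidiagonal.antidiagonal n).sigma fun a =>
          (Finset.HasAntidiagonal.antidiagonal a.1).sigma fun _ =>
            Finset.HasAntidiagonal.antidiagonal a.2 := by
      rintro ⟨⟨_, _⟩, ⟨_, _⟩, ⟨_, _⟩⟩ h
      simp only [σ, Finset.mem_sigma, Finset.HasAntidiagonal.mem_antidiagonal] at h ⊢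
      exact ⟨by omega, by trivial, by trivial⟩
    have h₂ : ∀ x ∈ (Finset.HasAntidiagonal.antidiagonal n).sigma fun a =>
        (Finset.HasAntidiagonal.antidiagonal a.1).sigma fun _ =>
          Finset.HasAntidiagonal.antidiagonal a.2, σ (σ x) = x := by
      rintro ⟨⟨_, _⟩, ⟨_, _⟩, ⟨_, _⟩⟩ h
      simp only [Finset.mem_sigma, Finset.HasAntidiagonal.mem_antidiagonal] at h
      obtain ⟨-, rfl, rfl⟩ := h
      rfl
    exact Finset.sum_nbij' σ σ h₁ h₁ h₂ h₂ fun _ _ => rfl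

/-- The continuous homomorphism of topologically free algebras with prescribed values on the
generators. -/
def homOfGen {G H : Type} (v : G → FreeTop H) : FreeTop G →+* FreeTop H :=
  extendT (FreeAlgebra.lift Laur v).toRingHom

/-- The `t`-adically closed two-sided ideal generated by `S`: the closure `⋂_N (I + t^N)` of the
two-sided ideal `I` generated by `S`. -/
def closedIdeal {G : Type} (S : Set (FreeTop G)) : TwoSidedIdeal (FreeTop G) :=
  ⨅ N : ℕ, TwoSidedIdeal.span (S ∪ {(PowerSeries.X : FreeTop G) ^ N})

/-- The algebra topologically generated by `G` with relations `r = 0` for `r ∈ S`. -/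
abbrev Presented {G : Type} (S : Set (FreeTop G)) : Type := (closedIdeal S).ringCon.Quotient

/-- The class of an element. -/
def cls {G : Type} (S : Set (FreeTop G)) : FreeTop G →+* Presented S :=
  (closedIdeal S).ringCon.mk'

/-! ### Completed tensor powers, coproducts, twists -/

/-- Generators and relations of a topological algebra, with the values of a coproduct on the
generators. The counit is zero on all generators. The generator `(k, x)` of a completed tensor
power stands for `1 ⊗ ⋯ ⊗ x ⊗ ⋯ ⊗ 1`, with `x` in the tensor factor `k`. -/
structure HopfPresentation (G : Type) where
  /-- the relations -/
  rel : Set (FreeTop G)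
  /-- the coproduct of the generators -/
  comul : G → FreeTop (Fin 2 × G)

/-- `x ↦ 1 ⊗ ⋯ ⊗ x ⊗ ⋯ ⊗ 1`, with `x` in the tensor factor `k`. -/
def leg {G : Type} {n : ℕ} (k : Fin n) : FreeTop G →+* FreeTop (Fin n × G) :=
  homOfGen fun x => gen (k, x)

/-- The simple tensor `x ⊗ y`. -/
def tmul {G : Type} (x y : FreeTop G) : FreeTop (Fin 2 × G) := leg 0 x * leg 1 y

/-- The homomorphism that sends the factors `0, 1` of a tensor square to the factors `i, j`. -/
def leg₂ {G : Type} (i j : Fin 3) : FreeTop (Fin 2 × G) →+* FreeTop (Fin 3 × G) :=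
  homOfGen fun p => gen (![i, j] p.1, p.2)

namespace HopfPresentation

variable {G : Type} (U : HopfPresentation G)

/-- The relations of the `n`-th completed tensor power: those of `U` in every tensor factor,
and the commutation of different tensor factors. -/
def tensorRel (n : ℕ) : Set (FreeTop (Fin n × G)) :=
  {r | ∃ k : Fin n, ∃ r₀ ∈ U.rel, r = leg k r₀} ∪
  {r | ∃ k l : Fin n, k ≠ l ∧ ∃ x y : G,
    r = gen (k, x) * gen (l, y) - gen (l, y) * gen (k, x)}

/-- The coproduct `Δ`. -/
def Δ : FreeTop G →+* FreeTop (Fin 2 × G) := homOfGen U.comul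

/-- `Δ ⊗ id`. -/
def Δid : FreeTop (Fin 2 × G) →+* FreeTop (Fin 3 × G) :=
  homOfGen fun p => if p.1 = 0 then leg₂ 0 1 (U.comul p.2) else gen (2, p.2)

/-- `id ⊗ Δ`. -/
def idΔ : FreeTop (Fin 2 × G) →+* FreeTop (Fin 3 × G) :=
  homOfGen fun p => if p.1 = 0 then gen (0, p.2) else leg₂ 1 2 (U.comul p.2)

end HopfPresentation

/-- `ε ⊗ id`. -/
def counitId (G : Type) : FreeTop (Fin 2 × G) →+* FreeTop G :=
  homOfGen fun p => if p.1 = 0 then 0 else gen p.2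

/-- `id ⊗ ε`. -/
def idCounit (G : Type) : FreeTop (Fin 2 × G) →+* FreeTop G :=
  homOfGen fun p => if p.1 = 0 then gen p.2 else 0

namespace HopfPresentation

variable {G : Type} (U : HopfPresentation G)

/-- Equality of (the classes of) two elements of the completed tensor square `U ⊗ U`. -/
def Eq₂ (F F' : FreeTop (Fin 2 × G)) : Prop :=
  cls (U.tensorRel 2) F = cls (U.tensorRel 2) F'

/-- `F` is a twist: it is invertible in `U ⊗ U`, it satisfies
`F₁₂ (Δ ⊗ id)(F) = F₂₃ (id ⊗ Δ)(F)` in `U ⊗ U ⊗ U` and `(ε ⊗ id)(F) = (id ⊗ ε)(F) = 1`. -/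
def IsTwist (F : FreeTop (Fin 2 × G)) : Prop :=
  IsUnit (cls (U.tensorRel 2) F) ∧
  cls (U.tensorRel 3) (leg₂ 0 1 F * U.Δid F) = cls (U.tensorRel 3) (leg₂ 1 2 F * U.idΔ F) ∧
  cls U.rel (counitId G F) = 1 ∧ cls U.rel (idCounit G F) = 1

/-- `F ≡ F' mod s t`: in `U ⊗ U` the difference of `F` and `F'` is `s t` times an element of the
`ℂ[s]⟦t⟧`-form, the closed `ℂ[s]⟦t⟧`-subalgebra generated by the generators. -/
def CongrModST (F F' : FreeTop (Fin 2 × G)) : Prop :=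
  ∃ Z : FreeInt (Fin 2 × G),
    cls (U.tensorRel 2) (F - F') = cls (U.tensorRel 2) (scal (sVar * tVar) * inclInt _ Z)

end HopfPresentation

/-! ### Classical limits in `U(sl₃)` -/

/-- The Lie algebra `sl₃(ℂ)`. -/
abbrev SL3 : Type := LieAlgebra.SpecialLinear.sl (Fin 3) ℂ

/-- The universal enveloping algebra of `sl₃(ℂ)`. -/
abbrev USL3 : Type := UniversalEnvelopingAlgebra ℂ SL3

/-- The matrix unit `E_{i+1,j+1}` as an element of `U(sl₃)`. -/
def cE (i j : Fin 3) (h : i ≠ j) : USL3 :=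
  UniversalEnvelopingAlgebra.ι ℂ (LieAlgebra.SpecialLinear.single i j h (1 : ℂ))

/-- `H_{i+1,j+1} = E_{i+1,i+1} - E_{j+1,j+1}` as an element of `U(sl₃)`. -/
def cH (i j : Fin 3) : USL3 :=
  UniversalEnvelopingAlgebra.ι ℂ (LieAlgebra.SpecialLinear.singleSubSingle i j (1 : ℂ))

/-- The specialization at `s = 0` of the `ℂ[s]⟦t⟧`-form of a tensor square, followed by `ev ⊗ ev`
for an assignment `ev` of elements of `U(sl₃)` to the generators. -/
def specialize {G : Type} (ev : G → USL3) :
    FreeInt (Fin 2 × G) →+* PowerSeries (USL3 ⊗[ℂ] USL3) :=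
  letI : Algebra ℂ[X] (USL3 ⊗[ℂ] USL3) :=
    Algebra.compHom _ (Polynomial.constantCoeff : ℂ[X] →+* ℂ)
  PowerSeries.map (FreeAlgebra.lift ℂ[X] (fun p : Fin 2 × G =>
    if p.1 = 0 then ev p.2 ⊗ₜ[ℂ] (1 : USL3) else (1 : USL3) ⊗ₜ[ℂ] ev p.2)).toRingHom

/-- `F ∈ U ⊗ U` lies in the `ℂ[s]⟦t⟧`-form and its limit as `s → 0`, mapped to
`(U(sl₃) ⊗ U(sl₃))⟦t⟧` by `ev ⊗ ev`, is `Φ`. -/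
def HopfPresentation.HasLimit {G : Type} (U : HopfPresentation G) (ev : G → USL3)
    (F : FreeTop (Fin 2 × G)) (Φ : PowerSeries (USL3 ⊗[ℂ] USL3)) : Prop :=
  ∃ Z : FreeInt (Fin 2 × G), U.Eq₂ F (inclInt _ Z) ∧ specialize ev Z = Φ

/-- The twist `exp (ξ (E₁₂ + μ E₂₃) ⊗ E₁₃)`, with `ξ ∈ ℂ⟦t⟧` without constant term. -/
def abelianTwist (ξ : PowerSeries ℂ) (μ : ℂ) : PowerSeries (USL3 ⊗[ℂ] USL3) :=
  texp (PowerSeries.map (algebraMap ℂ (USL3 ⊗[ℂ] USL3)) ξ *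
    PowerSeries.C ((cE 0 1 (by decide) + μ • cE 1 2 (by decide)) ⊗ₜ[ℂ] cE 0 2 (by decide)))

/-! ### The quantum algebra `U_q(sl₃)` -/

/-- Chevalley generators of `U_q(sl₃)`. -/
inductive GenA : Type
  | h12 | h23 | e12 | e23 | e21 | e32

namespace GenA

/-- The generator `h₁₂`. -/
def H12 : FreeTop GenA := gen h12
/-- The generator `h₂₃`. -/
def H23 : FreeTop GenA := gen h23
/-- The element `h₁₃ = h₁₂ + h₂₃`. -/
def H13 : FreeTop GenA := H12 + H23
/-- The generator `e₁₂`. -/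
def E12 : FreeTop GenA := gen e12
/-- The generator `e₂₃`. -/
def E23 : FreeTop GenA := gen e23
/-- The generator `e₂₁`. -/
def E21 : FreeTop GenA := gen e21
/-- The generator `e₃₂`. -/
def E32 : FreeTop GenA := gen e32
/-- The composite root vector `e₁₃ = e₁₂ e₂₃ - q⁻¹ e₂₃ e₁₂`. -/
def E13 (q : PowerSeries Laur) : FreeTop GenA := E12 * E23 - scal (Ring.inverse q) * (E23 * E12)
/-- The composite root vector `e₃₁ = e₃₂ e₂₁ - q e₂₁ e₃₂`. -/
def E31 (q : PowerSeries Laur) : FreeTop GenA := E32 * E21 - scal q * (E21 * E32)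

/-- The defining relations of `U_q(sl₃)`. -/
def rels (q : PowerSeries Laur) : Set (FreeTop GenA) :=
  { ⁅H12, H23⁆,
    ⁅H12, E12⁆ - 2 * E12, ⁅H12, E23⁆ + E23, ⁅H12, E21⁆ + 2 * E21, ⁅H12, E32⁆ - E32,
    ⁅H23, E12⁆ + E12, ⁅H23, E23⁆ - 2 * E23, ⁅H23, E21⁆ - E21, ⁅H23, E32⁆ + 2 * E32,
    ⁅E12, E32⁆, ⁅E21, E23⁆,
    ⁅E12, E21⁆ - qNumber q H12, ⁅E23, E32⁆ - qNumber q H23,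
    E13 q * E12 - scal (Ring.inverse q) * (E12 * E13 q), E13 q * E23 - scal q * (E23 * E13 q),
    E21 * E31 q - scal q * (E31 q * E21), E32 * E31 q - scal (Ring.inverse q) * (E31 q * E32) }

/-- The coproduct of the generators: `Δ(h) = h ⊗ 1 + 1 ⊗ h`,
`Δ(e_{i,i+1}) = q^{-h_{i,i+1}} ⊗ e_{i,i+1} + e_{i,i+1} ⊗ 1`,
`Δ(e_{i+1,i}) = e_{i+1,i} ⊗ q^{h_{i,i+1}} + 1 ⊗ e_{i+1,i}`. -/
def comul (q : PowerSeries Laur) : GenA → FreeTop (Fin 2 × GenA)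
  | h12 => tmul H12 1 + tmul 1 H12
  | h23 => tmul H23 1 + tmul 1 H23
  | e12 => tmul (qPow q (-H12)) E12 + tmul E12 1
  | e23 => tmul (qPow q (-H23)) E23 + tmul E23 1
  | e21 => tmul E21 (qPow q H12) + tmul 1 E21
  | e32 => tmul E32 (qPow q H23) + tmul 1 E32

/-- The classical values of the generators in `U(sl₃)`. -/
def classical : GenA → USL3
  | h12 => cH 0 1
  | h23 => cH 1 2
  | e12 => cE 0 1 (by decide)
  | e23 => cE 1 2 (by decide)
  | e21 => cE 1 0 (by decide)
  | e32 => cE 2 1 (by decide)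

end GenA

/-- The quantum algebra `U_q(sl₃)`. -/
def UqSL3 (q : PowerSeries Laur) : HopfPresentation GenA := ⟨GenA.rels q, GenA.comul q⟩

section

open GenA

/-- The `R`-matrix factor `R₁ = exp_{q²}(-(q - q⁻¹) e₂₁ ⊗ e₁₂)`. -/
def R₁ (q : PowerSeries Laur) : FreeTop (Fin 2 × GenA) :=
  qExp (q ^ 2) (-(scal (q - Ring.inverse q) * tmul E21 E12))

/-- `W_c = exp_{q²}(c s⁻¹ t q^{-h₁₂} e₁₂) exp_{q²}(s⁻¹ t e₁₃)`, with `c ∈ ℂ`. -/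
def W01 (q : PowerSeries Laur) (c : ℂ) : FreeTop GenA :=
  qExp (q ^ 2) (c • (scal (sInv * tVar) * (qPow q (-H12) * E12))) *
    qExp (q ^ 2) (scal (sInv * tVar) * E13 q)

/-- `(W ⊗ W) R₁ Δ(W⁻¹)` for `W = W01 q c`. -/
def F01 (q : PowerSeries Laur) (c : ℂ) : FreeTop (Fin 2 × GenA) :=
  tmul (W01 q c) (W01 q c) * R₁ q * (UqSL3 q).Δ (Ring.inverse (W01 q c))

end

/-! ### The twisted affine quantum algebra `U_q(A₂⁽²⁾)` -/

/-- Chevalley generators of `U_q(A₂⁽²⁾)` at level zero: `h = h_α`, `e = e_α`, `f = e_{-α}`,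
`e₀ = e_{δ-2α}`, `f₀ = e_{-δ+2α}`. -/
inductive GenB : Type
  | h | e | f | e₀ | f₀

namespace GenB

/-- The generator `h_α`. -/
def Hα : FreeTop GenB := gen h
/-- The generator `e_α`. -/
def Eα : FreeTop GenB := gen e
/-- The generator `e_{-α}`. -/
def Fα : FreeTop GenB := gen f
/-- The generator `e_{δ-2α}`. -/
def Eδ : FreeTop GenB := gen e₀
/-- The generator `e_{-δ+2α}`. -/
def Fδ : FreeTop GenB := gen f₀

/-- `h_α / 2`. -/
def halfH : FreeTop GenB := (1 / 2 : ℂ) • Hα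

/-- `x y - Q y x`. -/
def qBr (Q : PowerSeries Laur) (x y : FreeTop GenB) : FreeTop GenB := x * y - scal Q * (y * x)

/-- `[[x, y]_q, y]_q` for root vectors `x, y` of weights `±α, ±(δ - 2α)`. The `q`-bracket of root
vectors of weights `β, γ` is `x y - q^{(β,γ)} y x`, where
`(α, α) = 1`, `(α, δ-2α) = -2`, `(δ-2α, δ-2α) = 4`. -/
def serre₂ (q : PowerSeries Laur) (x y : FreeTop GenB) : FreeTop GenB :=
  qBr (q ^ 2) (qBr (Ring.inverse q ^ 2) x y) y

/-- `[x, [x, [x, [x, [x, y]_q]_q]_q]_q]_q` for root vectors `x, y` as in `serre₂`. -/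
def serre₅ (q : PowerSeries Laur) (x y : FreeTop GenB) : FreeTop GenB :=
  qBr (q ^ 2) x (qBr q x (qBr 1 x (qBr (Ring.inverse q) x (qBr (Ring.inverse q ^ 2) x y))))

/-- The defining relations of `U_q(A₂⁽²⁾)`. -/
def rels (q : PowerSeries Laur) : Set (FreeTop GenB) :=
  { ⁅Hα, Eα⁆ - 2 * Eα, ⁅Hα, Fα⁆ + 2 * Fα, ⁅Hα, Eδ⁆ + 4 * Eδ, ⁅Hα, Fδ⁆ - 4 * Fδ,
    ⁅Eδ, Fδ⁆ - qNumber q (-Hα), ⁅Eα, Fα⁆ - qNumber q halfH,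
    ⁅Eα, Fδ⁆, ⁅Eδ, Fα⁆,
    serre₂ q Eα Eδ, serre₅ q Eα Eδ, serre₂ q Fα Fδ, serre₅ q Fα Fδ }

/-- The coproduct of the generators. -/
def comul (q : PowerSeries Laur) : GenB → FreeTop (Fin 2 × GenB)
  | h => tmul Hα 1 + tmul 1 Hα
  | e => tmul (qPow q (-halfH)) Eα + tmul Eα 1
  | f => tmul Fα (qPow q halfH) + tmul 1 Fα
  | e₀ => tmul (qPow q Hα) Eδ + tmul Eδ 1
  | f₀ => tmul Fδ (qPow q (-Hα)) + tmul 1 Fδ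

/-- The evaluation at `u` of the generators in `U(sl₃)`. -/
def evaluation (u : ℂ) : GenB → USL3
  | h => (2 : ℂ) • cH 0 2
  | e => cE 0 1 (by decide) + cE 1 2 (by decide)
  | f => cE 1 0 (by decide) + cE 2 1 (by decide)
  | e₀ => ((Real.sqrt 2 : ℂ) * u) • cE 2 0 (by decide)
  | f₀ => ((Real.sqrt 2 : ℂ) * u⁻¹) • cE 0 2 (by decide)

end GenB

/-- The twisted affine quantum algebra `U_q(A₂⁽²⁾)` at level zero. -/
def UqA22 (q : PowerSeries Laur) : HopfPresentation GenB := ⟨GenB.rels q, GenB.comul q⟩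

section

open GenB

/-- `W = exp_q(s⁻¹ t e_α) exp_{q⁴}(s⁻¹ t e_{-δ+2α})`. -/
def W11 (q : PowerSeries Laur) : FreeTop GenB :=
  qExp q (scal (sInv * tVar) * Eα) * qExp (q ^ 4) (scal (sInv * tVar) * Fδ)

/-- `W' = exp(-2 t³ e_α e_{-δ+2α}) W`. -/
def W11' (q : PowerSeries Laur) : FreeTop GenB :=
  texp (-2 * (scal (tVar ^ 3) * (Eα * Fδ))) * W11 q

/-- The coboundary twist `(W ⊗ W) Δ(W⁻¹)`. -/
def coboundary (q : PowerSeries Laur) (W : FreeTop GenB) : FreeTop (Fin 2 × GenB) :=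
  tmul W W * (UqA22 q).Δ (Ring.inverse W)

end

end QTwist

end

open QTwist

/-!
Every twist here is a gauge transform `(W ⊗ W) R Δ(W⁻¹)` of a known twist `R` (`R₁` or `1`), hence
is a twist because `Δ` is coassociative (`HopfPresentation.IsTwist.gauge`). What has to be shown is
that `R₁` is a twist, and that the gauge transforms lie in the integral form although `W` has
exponents `s⁻¹ t x`.

Both rest on the calculus of `q`-exponentials in the algebras presented by generators and
relations, where an equation is an equality of classes `cls S f = cls S g`. The `q`-binomial theorem
`cls_qExp_add` splits `exp_Q (x + y)` when `y x = Q x y`, and `cls_qExp_mul_add` says that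
conjugation by `exp_Q a` maps `b + u` to `b + v` when `[a, b] = v - u` and `u`, `v` have suitable
`Q`-commutation with `a`. The second gives the conjugates of `Δ(e₁₂)` and `Δ(e₁₃)` by `R₁`, and, in
three tensor factors, the cocycle equation for `R₁` (`GenA.R₁_isTwist`).

For the gauge transforms the decisive fact is Cauchy's `q`-binomial theorem
`cls_qExp_eq_qRatio_mul`: for commuting `M` and `z`,
`exp_Q z = (∑ₙ (1 - M) (1 - M Q) ⋯ (1 - M Q^(n-1)) zⁿ / (n)_Q!) · exp_Q (M z)`.
If `W = exp_Q (s⁻¹ t x) · exp_P (s⁻¹ t y)`, then `R Δ(W) R⁻¹` is a product of exponentials of these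
exponents in the two tensor factors, two of which are multiplied by grouplike elements `k` and `m`.
Removing `k` and `m` by means of Cauchy's theorem leaves a product of two `q`-Pochhammer series
(`cls_qRatio_mul_qExp`); multiplied by `R`, it represents the gauged twist (`GenA.cls_F01`,
`GenB.cls_coboundary_W11`).

In this form the poles in `s` disappear. Since `q ≡ 1` modulo `s² t`, both `1 - k` and `1 - m` are
divisible by `s²`, and conjugating `m` by `exp_Q (s⁻¹ t x)` turns it into an element `m'` with
`1 - m' ≡ -(w - 1) s⁻¹ t x` modulo `s²`, where `w` is a power of `q`. So the product
`(1 - m') ⋯ (1 - m' P^(n-1))` is divisible by `sⁿ`, which compensates the pole of `(s⁻¹ t y)ⁿ`.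
Modulo `s` the series in `k` becomes `1`, and the series in `m'` becomes the ordinary exponential of
`-(w - 1) s⁻² t² x y ≡ -r t³ x y`, where `w = q ^ r` (`lead_qRatio_mul_qRatio`). The bookkeeping is
done by the predicates `IsInt m f` (`f` lies in `sᵐ` times the integral form) and `Lead m f f'`
(moreover `f ≡ f'` modulo `s^(m+1)`); as both sides are `1` modulo `t`, a congruence modulo `s` is
one modulo `s t` (`IsInt.exists_scal_mul_inclInt`).

The twist of `W'` differs by the gauge transformation with `exp (-2 t³ e_α e_{-δ+2α})`, which is
integral; modulo `s` all exponents commute and add up to `2 t³ e_α ⊗ e_{-δ+2α}`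
(`GenB.cls_limit11'`). The limits follow, because the specialization at `s = 0` kills multiples of
`s` (`HopfPresentation.CongrModST.hasLimit`).
-/

namespace QTwist

/-! ### `t`-adic sums -/

section FormalSum

variable {R S : Type*} [Ring R] [Ring S]

theorem X_pow_dvd_mul {f g : PowerSeries R} {m n : ℕ} (hf : PowerSeries.X ^ m ∣ f)
    (hg : PowerSeries.X ^ n ∣ g) : PowerSeries.X ^ (m + n) ∣ f * g := by
  obtain ⟨a, rfl⟩ := hf
  obtain ⟨b, rfl⟩ := hg
  refine ⟨a * b, ?_⟩
  rw [pow_add, mul_assoc, mul_assoc, ← mul_assoc a, (PowerSeries.commute_X_pow a n).eq]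
  simp only [mul_assoc]

theorem X_pow_dvd_mul_left {f : PowerSeries R} {m : ℕ} (g : PowerSeries R)
    (hf : PowerSeries.X ^ m ∣ f) : PowerSeries.X ^ m ∣ g * f := by
  simpa using X_pow_dvd_mul (m := 0) (by simp : PowerSeries.X ^ 0 ∣ g) hf

theorem X_dvd_mul_left {f : PowerSeries R} (g : PowerSeries R)
    (hf : PowerSeries.X ∣ f) : PowerSeries.X ∣ g * f := by
  simpa using X_pow_dvd_mul_left (m := 1) g (by simpa using hf)

theorem X_pow_dvd_pow {f : PowerSeries R} (hf : PowerSeries.X ∣ f) (n : ℕ) :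
    PowerSeries.X ^ n ∣ f ^ n := by
  induction n with
  | zero => simp
  | succ n ih => rw [pow_succ f]; exact X_pow_dvd_mul ih (by rwa [pow_one])

theorem eq_of_X_pow_dvd_sub {f g : PowerSeries R}
    (h : ∀ N, PowerSeries.X ^ N ∣ f - g) : f = g := by
  ext n
  have := PowerSeries.X_pow_dvd_iff.1 (h (n + 1)) n (Nat.lt_succ_self n)
  rwa [map_sub, sub_eq_zero] at this

theorem X_pow_dvd_formalSum_sub {f : ℕ → PowerSeries R}
    (hf : ∀ k, PowerSeries.X ^ k ∣ f k) (N : ℕ) :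
    PowerSeries.X ^ N ∣ formalSum f - ∑ k ∈ Finset.range N, f k := by
  rw [PowerSeries.X_pow_dvd_iff]
  intro n hn
  rw [map_sub, formalSum, PowerSeries.coeff_mk, map_sum, sub_eq_zero]
  refine Finset.sum_subset (by simpa using hn) fun k _ hk => ?_
  exact PowerSeries.X_pow_dvd_iff.1 (hf k) n (by simpa using hk)

/-- A `t`-adic sum is determined by its partial sums modulo powers of `t`. -/
theorem eq_formalSum {f : ℕ → PowerSeries R} (hf : ∀ k, PowerSeries.X ^ k ∣ f k)
    {F : PowerSeries R} (h : ∀ N, PowerSeries.X ^ N ∣ F - ∑ k ∈ Finset.range N, f k) :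
    F = formalSum f := by
  refine eq_of_X_pow_dvd_sub fun N => ?_
  have := dvd_sub (h N) (X_pow_dvd_formalSum_sub hf N)
  simpa using this

theorem formalSum_sub (f g : ℕ → PowerSeries R) :
    formalSum (fun k => f k - g k) = formalSum f - formalSum g := by
  ext n; simp [formalSum, Finset.sum_sub_distrib]

theorem mul_formalSum (b : PowerSeries R) {f : ℕ → PowerSeries R}
    (hf : ∀ k, PowerSeries.X ^ k ∣ f k) :
    b * formalSum f = formalSum fun k => b * f k := by
  refine eq_formalSum (fun k => X_pow_dvd_mul_left b (hf k)) fun N => ?_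
  rw [← Finset.mul_sum, ← mul_sub]
  exact X_pow_dvd_mul_left b (X_pow_dvd_formalSum_sub hf N)

theorem formalSum_mul (b : PowerSeries R) {f : ℕ → PowerSeries R}
    (hf : ∀ k, PowerSeries.X ^ k ∣ f k) :
    formalSum f * b = formalSum fun k => f k * b := by
  refine eq_formalSum (fun k => (hf k).mul_right b) fun N => ?_
  rw [← Finset.sum_mul, ← sub_mul]
  exact (X_pow_dvd_formalSum_sub hf N).mul_right b

theorem formalSum_eq_zero_add {f : ℕ → PowerSeries R} (hf : ∀ k, PowerSeries.X ^ k ∣ f k) :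
    formalSum f = f 0 + formalSum fun k => f (k + 1) := by
  ext n
  rw [formalSum, map_add, formalSum, PowerSeries.coeff_mk, PowerSeries.coeff_mk,
    Finset.sum_range_succ', add_comm, Finset.sum_range_succ _ n,
    PowerSeries.X_pow_dvd_iff.1 (hf (n + 1)) n (Nat.lt_succ_self n), add_zero]

theorem formalSum_mul_formalSum {f g : ℕ → PowerSeries R}
    (hf : ∀ k, PowerSeries.X ^ k ∣ f k) (hg : ∀ k, PowerSeries.X ^ k ∣ g k) :
    formalSum f * formalSum g =
      formalSum fun n => ∑ p ∈ Finset.HasAntidiagonal.antidiagonal n, f p.1 * g p.2 := by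
  have hfg : ∀ p : ℕ × ℕ, PowerSeries.X ^ (p.1 + p.2) ∣ f p.1 * g p.2 := fun p =>
    X_pow_dvd_mul (hf _) (hg _)
  refine eq_formalSum (fun k => Finset.dvd_sum fun p hp => ?_) fun N => ?_
  · rw [← Finset.HasAntidiagonal.mem_antidiagonal.1 hp]; exact hfg p
  · have h₁ : PowerSeries.X ^ N ∣ formalSum f * formalSum g -
        (∑ k ∈ Finset.range N, f k) * ∑ k ∈ Finset.range N, g k := by
      have := dvd_add ((X_pow_dvd_formalSum_sub hf N).mul_right (formalSum g))
        (X_pow_dvd_mul_left (∑ k ∈ Finset.range N, f k) (X_pow_dvd_formalSum_sub hg N))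
      rwa [sub_mul, mul_sub, sub_add_sub_cancel] at this
    -- The square `[0, N)²` contains the triangle `i + j < N`; the remaining terms have `i + j ≥ N`.
    have h₂ : PowerSeries.X ^ N ∣ (∑ k ∈ Finset.range N, f k) * (∑ k ∈ Finset.range N, g k) -
        ∑ n ∈ Finset.range N, ∑ p ∈ Finset.HasAntidiagonal.antidiagonal n, f p.1 * g p.2 := by
      have hsub : ((Finset.range N).sigma fun n => Finset.HasAntidiagonal.antidiagonal n).image
          (fun x : Σ _ : ℕ, ℕ × ℕ => x.2) ⊆ Finset.range N ×ˢ Finset.range N := by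
        intro p hp
        simp only [Finset.mem_image, Finset.mem_sigma, Finset.mem_range,
          Finset.HasAntidiagonal.mem_antidiagonal] at hp
        obtain ⟨⟨n, q⟩, ⟨h1, h2⟩, rfl⟩ := hp
        simp only [Finset.mem_product, Finset.mem_range] at h1 h2 ⊢
        omega
      have hinj : Set.InjOn (fun x : Σ _ : ℕ, ℕ × ℕ => x.2)
          ((Finset.range N).sigma (fun n => Finset.HasAntidiagonal.antidiagonal n)) := by
        rintro ⟨n, q⟩ h ⟨m, r⟩ h' (rfl : q = r)
        simp only [Finset.coe_sigma, Set.mem_sigma_iff, Finset.mem_coe,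
          Finset.HasAntidiagonal.mem_antidiagonal] at h h'
        obtain rfl : n = m := h.2.symm.trans h'.2
        rfl
      rw [Finset.sum_sigma', ← Finset.sum_image (f := fun p : ℕ × ℕ => f p.1 * g p.2) hinj,
        Finset.sum_mul_sum, ← Finset.sum_product', ← Finset.sum_sdiff hsub, add_sub_cancel_right]
      refine Finset.dvd_sum fun p hp => (pow_dvd_pow _ ?_).trans (hfg p)
      by_contra hlt
      simp only [Finset.mem_sdiff, Finset.mem_image, Finset.mem_sigma, Finset.mem_range,
        Finset.HasAntidiagonal.mem_antidiagonal, not_exists, not_and] at hp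
      exact hp.2 ⟨p.1 + p.2, p⟩ ⟨by simpa using hlt, rfl⟩ rfl
    have := dvd_add h₁ h₂
    rwa [sub_add_sub_cancel] at this

theorem map_X_pow_dvd (φ : PowerSeries R →+* PowerSeries S) (hφ : φ PowerSeries.X = PowerSeries.X)
    {f : PowerSeries R} {n : ℕ} (h : PowerSeries.X ^ n ∣ f) : PowerSeries.X ^ n ∣ φ f := by
  simpa [hφ] using map_dvd φ h

/-- Ring homomorphisms that fix `t` are `t`-adically continuous. -/
theorem map_formalSum (φ : PowerSeries R →+* PowerSeries S) (hφ : φ PowerSeries.X = PowerSeries.X)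
    {f : ℕ → PowerSeries R} (hf : ∀ k, PowerSeries.X ^ k ∣ f k) :
    φ (formalSum f) = formalSum fun k => φ (f k) := by
  refine eq_formalSum (fun k => map_X_pow_dvd φ hφ (hf k)) fun N => ?_
  rw [← map_sum, ← map_sub]
  exact map_X_pow_dvd φ hφ (X_pow_dvd_formalSum_sub hf N)

end FormalSum

/-! ### Scalars -/

/-- A scalar acts by multiplication with its image under `scal`; the presented algebras inherit this
action. -/
noncomputable instance instAlgebraFreeTop (G : Type) : Algebra (PowerSeries Laur) (FreeTop G) :=
  RingHom.toAlgebra' (scal (R := FreeAlgebra Laur G)) fun c x => by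
    ext n
    simp only [scal, PowerSeries.coeff_mul, PowerSeries.coeff_map]
    rw [← Finset.Nat.sum_antidiagonal_swap]
    refine Finset.sum_congr rfl fun p _ => ?_
    simpa using Algebra.commutes _ _

theorem scal_mul {G : Type} (c : PowerSeries Laur) (x : FreeTop G) : scal c * x = c • x := rfl

theorem scal_eq_smul_one {G : Type} (c : PowerSeries Laur) : (scal c : FreeTop G) = c • 1 := by
  rw [← scal_mul, mul_one]

theorem scal_X {G : Type} : (scal PowerSeries.X : FreeTop G) = PowerSeries.X := by
  simp [scal]

theorem X_dvd_smul {G : Type} (c : PowerSeries Laur) {x : FreeTop G} (h : PowerSeries.X ∣ x) :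
    PowerSeries.X ∣ c • x := by
  rw [← scal_mul]; exact X_dvd_mul_left _ h

theorem X_pow_dvd_smul {G : Type} (c : PowerSeries Laur) {x : FreeTop G} {n : ℕ}
    (h : PowerSeries.X ^ n ∣ x) : PowerSeries.X ^ n ∣ c • x := by
  rw [← scal_mul]; exact X_pow_dvd_mul_left _ h

theorem X_dvd_smul' {G : Type} {c : PowerSeries Laur} (h : PowerSeries.X ∣ c) (x : FreeTop G) :
    PowerSeries.X ∣ c • x := by
  obtain ⟨d, rfl⟩ := h
  exact ⟨d • x, by rw [← scal_X, scal_mul, mul_smul]⟩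

/-- The image of a complex number in the ground ring. -/
noncomputable def cscal (c : ℂ) : PowerSeries Laur := PowerSeries.C (algebraMap ℂ Laur c)

theorem csmul_eq {G : Type} (c : ℂ) (x : FreeTop G) : c • x = cscal c • x := by
  ext n
  rw [← scal_mul, cscal, scal, PowerSeries.map_C, PowerSeries.coeff_C_mul, PowerSeries.coeff_smul,
    ← IsScalarTower.algebraMap_apply, Algebra.smul_def]

/-! ### Congruences modulo a closed ideal -/

section Cls

variable {G : Type} {S : Set (FreeTop G)}

theorem mem_closedIdeal {f : FreeTop G} :
    f ∈ closedIdeal S ↔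
      ∀ N : ℕ, f ∈ TwoSidedIdeal.span (S ∪ {(PowerSeries.X : FreeTop G) ^ N}) := by
  rw [closedIdeal, TwoSidedIdeal.mem_iInf]

theorem cls_eq_iff {f g : FreeTop G} : cls S f = cls S g ↔ f - g ∈ closedIdeal S := by
  rw [← TwoSidedIdeal.rel_iff]
  exact RingCon.eq _

theorem cls_eq_zero_of_mem {f : FreeTop G} (h : f ∈ S) : cls S f = 0 := by
  rw [← map_zero (cls S), cls_eq_iff, sub_zero, mem_closedIdeal]
  exact fun N => TwoSidedIdeal.subset_span (Or.inl h)

/-- The topology of a presented algebra is separated. -/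
theorem cls_eq_of_forall {f g : FreeTop G}
    (h : ∀ N : ℕ, ∃ r, cls S (f - g) = cls S (PowerSeries.X ^ N * r)) : cls S f = cls S g := by
  rw [cls_eq_iff, mem_closedIdeal]
  intro N
  obtain ⟨r, hr⟩ := h N
  have h₁ := mem_closedIdeal.1 (cls_eq_iff.1 hr) N
  have h₂ := TwoSidedIdeal.mul_mem_right _ _ r
    (TwoSidedIdeal.subset_span (s := S ∪ {(PowerSeries.X : FreeTop G) ^ N}) (Or.inr rfl))
  simpa using TwoSidedIdeal.add_mem _ h₁ h₂

theorem cls_smul (c : PowerSeries Laur) (x : FreeTop G) : cls S (c • x) = c • cls S x := rfl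

theorem cls_scal (c : PowerSeries Laur) : cls S (scal c) = c • 1 := by
  rw [scal_eq_smul_one, cls_smul, map_one]

theorem cls_formalSum_congr {f g : ℕ → FreeTop G} (hf : ∀ k, PowerSeries.X ^ k ∣ f k)
    (hg : ∀ k, PowerSeries.X ^ k ∣ g k) (h : ∀ k, cls S (f k) = cls S (g k)) :
    cls S (formalSum f) = cls S (formalSum g) := by
  refine cls_eq_of_forall fun N => ?_
  obtain ⟨a, ha⟩ := X_pow_dvd_formalSum_sub hf N
  obtain ⟨b, hb⟩ := X_pow_dvd_formalSum_sub hg N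
  refine ⟨a - b, ?_⟩
  rw [mul_sub, ← ha, ← hb]
  simp only [map_sub, map_sum, h]
  abel

/-- A homomorphism that fixes `t` and respects the relations respects the closed ideals. -/
theorem cls_map {H : Type} {T : Set (FreeTop H)} (φ : FreeTop G →+* FreeTop H)
    (hφ : φ PowerSeries.X = PowerSeries.X) (hr : ∀ r ∈ S, cls T (φ r) = 0) {f g : FreeTop G}
    (h : cls S f = cls S g) : cls T (φ f) = cls T (φ g) := by
  rw [cls_eq_iff, ← map_sub, mem_closedIdeal]
  intro N
  have hle : TwoSidedIdeal.span (S ∪ {(PowerSeries.X : FreeTop G) ^ N}) ≤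
      TwoSidedIdeal.comap φ (TwoSidedIdeal.span (T ∪ {(PowerSeries.X : FreeTop H) ^ N})) := by
    rw [TwoSidedIdeal.span_le]
    rintro r (hr' | rfl)
    · refine (TwoSidedIdeal.mem_comap _).2 ?_
      have := hr r hr'
      rw [← map_zero (cls T), cls_eq_iff, sub_zero, mem_closedIdeal] at this
      exact this N
    · refine (TwoSidedIdeal.mem_comap _).2 ?_
      rw [map_pow, hφ]
      exact TwoSidedIdeal.subset_span (Or.inr rfl)
  exact (TwoSidedIdeal.mem_comap _).1 (hle (mem_closedIdeal.1 (cls_eq_iff.1 h) N))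

end Cls

/-! ### `q`-factorials -/

/-- The coefficient `1 / (n)_Q!` of the `q`-exponential. -/
noncomputable def qCoeff (Q : PowerSeries Laur) (n : ℕ) : PowerSeries Laur :=
  Ring.inverse (qFactorial Q n)

theorem isUnit_of_constantCoeff {f : PowerSeries Laur} {n : ℕ} (hn : n ≠ 0)
    (h : PowerSeries.constantCoeff f = (n : Laur)) : IsUnit f := by
  rw [PowerSeries.isUnit_iff_constantCoeff, h, ← map_natCast (algebraMap ℂ Laur)]
  exact (isUnit_iff_ne_zero.2 (Nat.cast_ne_zero.2 hn)).map _

theorem constantCoeff_qInt {Q : PowerSeries Laur} (hQ : PowerSeries.constantCoeff Q = 1) (n : ℕ) :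
    PowerSeries.constantCoeff (qInt Q n) = (n : Laur) := by
  simp [qInt, hQ]

theorem isUnit_qInt {Q : PowerSeries Laur} (hQ : PowerSeries.constantCoeff Q = 1) (n : ℕ) :
    IsUnit (qInt Q (n + 1)) :=
  isUnit_of_constantCoeff n.succ_ne_zero (constantCoeff_qInt hQ _)

theorem isUnit_qFactorial {Q : PowerSeries Laur} (hQ : PowerSeries.constantCoeff Q = 1) (n : ℕ) :
    IsUnit (qFactorial Q n) := by
  induction n with
  | zero => simp [qFactorial]
  | succ n ih => rw [qFactorial, Finset.prod_range_succ]; exact ih.mul (isUnit_qInt hQ n)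

@[simp] theorem qCoeff_zero (Q : PowerSeries Laur) : qCoeff Q 0 = 1 := by
  simp [qCoeff, qFactorial]

@[simp] theorem qInt_zero (Q : PowerSeries Laur) : qInt Q 0 = 0 := by simp [qInt]

theorem qInt_mul_qCoeff {Q : PowerSeries Laur} (hQ : PowerSeries.constantCoeff Q = 1) (n : ℕ) :
    qInt Q (n + 1) * qCoeff Q (n + 1) = qCoeff Q n := by
  have h : qFactorial Q (n + 1) = qFactorial Q n * qInt Q (n + 1) := Finset.prod_range_succ _ _
  refine (isUnit_qFactorial hQ n).mul_left_cancel ?_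
  rw [← mul_assoc, ← h, qCoeff, qCoeff, Ring.mul_inverse_cancel _ (isUnit_qFactorial hQ _),
    Ring.mul_inverse_cancel _ (isUnit_qFactorial hQ _)]

theorem qInt_add (Q : PowerSeries Laur) (k l : ℕ) :
    qInt Q (k + l) = qInt Q k + Q ^ k * qInt Q l := by
  simp only [qInt, Finset.sum_range_add, Finset.mul_sum, pow_add]

section Algebra

variable {A : Type*} [Ring A] [Algebra (PowerSeries Laur) A]

open Finset.HasAntidiagonal

/-- The summation argument for `qInt_smul_sum_antidiagonal`, for any sequence `i` of "integers" with
reciprocal "factorials" `c`. -/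
theorem smul_sum_antidiagonal_of_recursion {K B : Type*} [CommRing K] [AddCommGroup B] [Module K B]
    (Q : K) (i c : ℕ → K) (h₀ : i 0 = 0) (hi : ∀ k l, i (k + l) = i k + Q ^ k * i l)
    (hc : ∀ k, i (k + 1) * c (k + 1) = c k) (g : ℕ → ℕ → B) (n : ℕ) :
    i (n + 1) • ∑ p ∈ antidiagonal (n + 1), (c p.1 * c p.2) • g p.1 p.2 =
      ∑ p ∈ antidiagonal n, (c p.1 * c p.2) • (g (p.1 + 1) p.2 + Q ^ p.1 • g p.1 (p.2 + 1)) := by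
  have h : ∀ p ∈ antidiagonal (n + 1),
      i (n + 1) • (c p.1 * c p.2) • g p.1 p.2 =
        (i p.1 * c p.1 * c p.2) • g p.1 p.2 +
        (Q ^ p.1 * c p.1 * (i p.2 * c p.2)) • g p.1 p.2 := by
    intro p hp
    rw [← mem_antidiagonal.1 hp, hi, ← add_smul, smul_smul]
    congr 1
    ring
  rw [Finset.smul_sum, Finset.sum_congr rfl h, Finset.sum_add_distrib,
    Finset.Nat.sum_antidiagonal_succ, Finset.Nat.sum_antidiagonal_succ']
  simp only [h₀, zero_mul, zero_smul, mul_zero, zero_add, smul_add,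
    Finset.sum_add_distrib, hc, smul_smul]
  congr 1
  refine Finset.sum_congr rfl fun p _ => ?_
  congr 1
  ring

/-- The recursion behind the `q`-binomial theorems, from
`(k + l)_Q = (k)_Q + Q^k (l)_Q`. -/
theorem qInt_smul_sum_antidiagonal {Q : PowerSeries Laur}
    (hQ : PowerSeries.constantCoeff Q = 1) (g : ℕ → ℕ → A) (n : ℕ) :
    qInt Q (n + 1) • ∑ p ∈ antidiagonal (n + 1), (qCoeff Q p.1 * qCoeff Q p.2) • g p.1 p.2 =
      ∑ p ∈ antidiagonal n, (qCoeff Q p.1 * qCoeff Q p.2) •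
        (g (p.1 + 1) p.2 + Q ^ p.1 • g p.1 (p.2 + 1)) :=
  smul_sum_antidiagonal_of_recursion Q (qInt Q) (qCoeff Q) (qInt_zero Q) (qInt_add Q)
    (qInt_mul_qCoeff hQ) g n

theorem eq_of_qInt_smul {Q : PowerSeries Laur}
    (hQ : PowerSeries.constantCoeff Q = 1) (n : ℕ) {x y : A}
    (h : qInt Q (n + 1) • x = qInt Q (n + 1) • y) : x = y :=
  (isUnit_qInt hQ n).smul_left_cancel.1 h

theorem mul_pow_of_qComm {Q : PowerSeries Laur} {x y : A} (h : y * x = Q • (x * y)) (n : ℕ) :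
    y * x ^ n = Q ^ n • (x ^ n * y) := by
  induction n with
  | zero => simp
  | succ n ih =>
    rw [pow_succ x, ← mul_assoc, ih, smul_mul_assoc, mul_assoc, h, mul_smul_comm, smul_smul,
      ← pow_succ, mul_assoc]

theorem pow_mul_of_qComm {Q : PowerSeries Laur} {x y : A} (h : y * x = Q • (x * y)) (n : ℕ) :
    y ^ n * x = Q ^ n • (x * y ^ n) := by
  induction n with
  | zero => simp
  | succ n ih =>
    rw [pow_succ' y, mul_assoc, ih, mul_smul_comm, ← mul_assoc, h, smul_mul_assoc, smul_smul,
      ← pow_succ, mul_assoc]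

/-- The `q`-binomial theorem in degree `n`. -/
theorem qCoeff_smul_add_pow {Q : PowerSeries Laur}
    (hQ : PowerSeries.constantCoeff Q = 1) {x y : A} (h : y * x = Q • (x * y)) (n : ℕ) :
    qCoeff Q n • (x + y) ^ n =
      ∑ p ∈ antidiagonal n, (qCoeff Q p.1 • x ^ p.1) * (qCoeff Q p.2 • y ^ p.2) := by
  simp only [smul_mul_smul_comm]
  induction n with
  | zero => simp
  | succ n ih =>
    refine eq_of_qInt_smul hQ n ?_
    rw [qInt_smul_sum_antidiagonal hQ fun k l => x ^ k * y ^ l, smul_smul, qInt_mul_qCoeff hQ,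
      pow_succ' (x + y), ← mul_smul_comm, ih, Finset.mul_sum]
    refine Finset.sum_congr rfl fun p _ => ?_
    rw [mul_smul_comm, add_mul, ← mul_assoc y, mul_pow_of_qComm h, pow_succ' x, pow_succ' y,
      smul_mul_assoc]
    simp only [mul_assoc]

/-- The product `(1 - M) (1 - M Q) ⋯ (1 - M Q^(n-1))`. -/
noncomputable def qPoch (Q : PowerSeries Laur) (M : A) : ℕ → A
  | 0 => 1
  | n + 1 => qPoch Q M n * (1 - Q ^ n • M)

theorem Commute.qPoch_right {Q : PowerSeries Laur} {M z : A} (h : Commute z M) (n : ℕ) :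
    Commute z (qPoch Q M n) := by
  induction n with
  | zero => exact Commute.one_right _
  | succ n ih => exact ih.mul_right ((Commute.one_right z).sub_right (h.smul_right _))

/-- Cauchy's `q`-binomial theorem as an identity between polynomials in `M`, for each degree. -/
theorem sum_qPoch_mul_pow {Q : PowerSeries Laur}
    (hQ : PowerSeries.constantCoeff Q = 1) (M : A) (n : ℕ) :
    ∑ p ∈ antidiagonal n, (qCoeff Q p.1 * qCoeff Q p.2) • (qPoch Q M p.1 * M ^ p.2) =
      qCoeff Q n • (1 : A) := by
  induction n with
  | zero => simp [qPoch]
  | succ n ih =>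
    refine eq_of_qInt_smul hQ n ?_
    rw [qInt_smul_sum_antidiagonal hQ fun k l => qPoch Q M k * M ^ l, smul_smul,
      qInt_mul_qCoeff hQ, ← ih]
    refine Finset.sum_congr rfl fun p _ => ?_
    rw [qPoch, mul_sub, mul_one, sub_mul, pow_succ' M, mul_smul_comm, smul_mul_assoc]
    simp only [mul_assoc, sub_add_cancel]

/-- The part of degree `n` in `z` of Cauchy's `q`-binomial theorem. -/
theorem qCoeff_smul_pow_eq_sum {Q : PowerSeries Laur}
    (hQ : PowerSeries.constantCoeff Q = 1) {M z : A} (h : Commute M z) (n : ℕ) :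
    qCoeff Q n • z ^ n =
      ∑ p ∈ antidiagonal n,
        (qCoeff Q p.1 • (qPoch Q M p.1 * z ^ p.1)) * (qCoeff Q p.2 • (M * z) ^ p.2) := by
  have h₁ : ∀ p ∈ antidiagonal n,
      (qCoeff Q p.1 • (qPoch Q M p.1 * z ^ p.1)) * (qCoeff Q p.2 • (M * z) ^ p.2) =
        (qCoeff Q p.1 * qCoeff Q p.2) • (qPoch Q M p.1 * M ^ p.2) * z ^ n := by
    intro p hp
    rw [← mem_antidiagonal.1 hp, smul_mul_smul_comm, smul_mul_assoc, h.mul_pow, pow_add]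
    congr 1
    have := (h.pow_pow p.2 p.1).eq
    simp only [mul_assoc]
    rw [← mul_assoc (z ^ p.1), ← this]
    simp only [mul_assoc]
  rw [Finset.sum_congr rfl h₁, ← Finset.sum_mul, sum_qPoch_mul_pow hQ, smul_mul_assoc, one_mul]

end Algebra

/-! ### `q`-exponentials -/

section QExp

variable {G : Type} {S : Set (FreeTop G)} {Q : PowerSeries Laur}

theorem qExp_eq (Q : PowerSeries Laur) (x : FreeTop G) :
    qExp Q x = formalSum fun n => qCoeff Q n • x ^ n := rfl

theorem X_pow_dvd_qExp_term {x : FreeTop G} (hx : PowerSeries.X ∣ x) (n : ℕ) :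
    PowerSeries.X ^ n ∣ qCoeff Q n • x ^ n :=
  X_pow_dvd_smul _ (X_pow_dvd_pow hx n)

theorem qExp_zero (Q : PowerSeries Laur) : qExp Q (0 : FreeTop G) = 1 := by
  rw [qExp_eq, formalSum_eq_zero_add fun n => X_pow_dvd_qExp_term (dvd_zero _) n]
  simp only [qCoeff_zero, pow_zero, one_smul, pow_succ, mul_zero, smul_zero, add_eq_left]
  ext n
  simp [formalSum]

theorem X_dvd_qExp_sub_one {x : FreeTop G} (hx : PowerSeries.X ∣ x) :
    PowerSeries.X ∣ qExp Q x - 1 := by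
  have := X_pow_dvd_formalSum_sub (fun n => X_pow_dvd_qExp_term (Q := Q) hx n) 1
  simpa [qExp_eq] using this

theorem isUnit_of_X_dvd_sub_one {x : FreeTop G} (hx : PowerSeries.X ∣ x - 1) : IsUnit x := by
  rw [PowerSeries.isUnit_iff_constantCoeff]
  rw [PowerSeries.X_dvd_iff, map_sub, map_one, sub_eq_zero] at hx
  simp [hx]

theorem isUnit_qExp {x : FreeTop G} (hx : PowerSeries.X ∣ x) : IsUnit (qExp Q x) :=
  isUnit_of_X_dvd_sub_one (X_dvd_qExp_sub_one hx)

/-- The `q`-binomial theorem: `exp_Q (x + y) = exp_Q x exp_Q y` if `y x = Q x y`. -/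
theorem cls_qExp_add (hQ : PowerSeries.constantCoeff Q = 1) {x y : FreeTop G}
    (hx : PowerSeries.X ∣ x) (hy : PowerSeries.X ∣ y)
    (h : cls S y * cls S x = Q • (cls S x * cls S y)) :
    cls S (qExp Q (x + y)) = cls S (qExp Q x) * cls S (qExp Q y) := by
  have hx' := fun n => X_pow_dvd_qExp_term (Q := Q) hx n
  have hy' := fun n => X_pow_dvd_qExp_term (Q := Q) hy n
  rw [← map_mul, qExp_eq Q x, qExp_eq Q y, formalSum_mul_formalSum hx' hy', qExp_eq]
  refine cls_formalSum_congr (fun n => X_pow_dvd_qExp_term (dvd_add hx hy) n)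
    (fun n => Finset.dvd_sum fun p hp => ?_) fun n => ?_
  · rw [← Finset.HasAntidiagonal.mem_antidiagonal.1 hp]
    exact X_pow_dvd_mul (hx' _) (hy' _)
  · simp only [map_sum, map_mul, cls_smul, map_pow, map_add, qCoeff_smul_add_pow hQ h]

/-- Conjugation of a `q`-exponential. -/
theorem cls_mul_qExp {x y w : FreeTop G} (hx : PowerSeries.X ∣ x) (hy : PowerSeries.X ∣ y)
    (h : cls S w * cls S x = cls S y * cls S w) :
    cls S w * cls S (qExp Q x) = cls S (qExp Q y) * cls S w := by
  have hx' := fun n => X_pow_dvd_qExp_term (Q := Q) hx n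
  have hy' := fun n => X_pow_dvd_qExp_term (Q := Q) hy n
  rw [← map_mul, ← map_mul, qExp_eq, qExp_eq, mul_formalSum _ hx', formalSum_mul _ hy']
  refine cls_formalSum_congr (fun n => X_pow_dvd_mul_left _ (hx' n))
    (fun n => (hy' n).mul_right _) fun n => ?_
  simp only [map_mul, cls_smul, map_pow, mul_smul_comm, smul_mul_assoc]
  rw [((show SemiconjBy (cls S w) (cls S x) (cls S y) from h).pow_right n).eq]

theorem cls_qExp_congr {x y : FreeTop G} (hx : PowerSeries.X ∣ x) (hy : PowerSeries.X ∣ y)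
    (h : cls S x = cls S y) : cls S (qExp Q x) = cls S (qExp Q y) := by
  simpa using cls_mul_qExp (S := S) (Q := Q) (w := 1) hx hy (by simpa using h)

/-- If `[a, b] = v - u` with `a v = Q v a` and `u a = Q a u`, then conjugation by `exp_Q a` maps
`b + u` to `b + v`. -/
theorem cls_qExp_mul_add (hQ : PowerSeries.constantCoeff Q = 1) {a b u v : FreeTop G}
    (ha : PowerSeries.X ∣ a)
    (hab : cls S a * cls S b + cls S u = cls S b * cls S a + cls S v)
    (hv : cls S a * cls S v = Q • (cls S v * cls S a))
    (hu : cls S u * cls S a = Q • (cls S a * cls S u)) :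
    cls S (qExp Q a) * (cls S b + cls S u) = (cls S b + cls S v) * cls S (qExp Q a) := by
  have ha' := fun n => X_pow_dvd_qExp_term (Q := Q) ha n
  -- By induction, from `(n + 2)_Q = 1 + Q (n + 1)_Q` for the terms in `v` and from
  -- `(n + 2)_Q = (n + 1)_Q + Q^(n + 1)` for the terms in `u`.
  have hcomm : ∀ n : ℕ, cls S a ^ (n + 1) * cls S b - cls S b * cls S a ^ (n + 1) =
      qInt Q (n + 1) • (cls S v * cls S a ^ n - cls S a ^ n * cls S u) := by
    intro n
    induction n with
    | zero =>
      simp only [zero_add, pow_one, pow_zero, mul_one, one_mul, qInt, Finset.range_one,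
        Finset.sum_singleton, one_smul]
      rw [sub_eq_sub_iff_add_eq_add, hab, add_comm]
    | succ n ih =>
      have h₁ := pow_mul_of_qComm hv (n + 1)
      rw [pow_succ' _ (n + 1), mul_assoc, sub_eq_iff_eq_add.1 ih]
      have h₂ : cls S a * cls S b = cls S b * cls S a + cls S v - cls S u := by
        rw [← hab, add_sub_cancel_right]
      have h₃ : cls S u * cls S a ^ (n + 1) = Q ^ (n + 1) • (cls S a ^ (n + 1) * cls S u) :=
        mul_pow_of_qComm hu _
      have h₄ := qInt_add Q 1 (n + 1)
      have h₅ := qInt_add Q (n + 1) 1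
      have h₆ : qInt Q 1 = 1 := by simp [qInt]
      rw [h₆, pow_one] at h₄
      rw [h₆, mul_one] at h₅
      rw [mul_add, ← mul_assoc (cls S a), h₂, mul_smul_comm, mul_sub, ← mul_assoc, hv,
        ← mul_assoc (cls S a), ← pow_succ', smul_sub, smul_mul_assoc, mul_assoc (cls S v),
        ← pow_succ', sub_mul, add_mul, h₃, smul_sub]
      have h₇ : qInt Q (n + 1 + 1) • (cls S v * cls S a ^ (n + 1)) =
          cls S v * cls S a ^ (n + 1) + (Q * qInt Q (n + 1)) • (cls S v * cls S a ^ (n + 1)) := by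
        rw [add_comm (n + 1) 1, h₄, add_smul, one_smul]
      have h₈ : qInt Q (n + 1 + 1) • (cls S a ^ (n + 1) * cls S u) =
          qInt Q (n + 1) • (cls S a ^ (n + 1) * cls S u) +
            Q ^ (n + 1) • (cls S a ^ (n + 1) * cls S u) := by
        rw [h₅, add_smul]
      rw [h₇, h₈, mul_assoc, ← pow_succ', smul_smul, mul_comm (qInt Q (n + 1)) Q]
      abel
  -- Summed over `n`, the commutators `[aⁿ, b] / (n)_Q!` give `v exp_Q a - exp_Q a u`.
  have key : cls S (qExp Q a * b - b * qExp Q a) = cls S (v * qExp Q a - qExp Q a * u) := by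
    rw [qExp_eq, mul_formalSum _ ha', formalSum_mul _ ha', ← formalSum_sub, mul_formalSum _ ha',
      formalSum_mul _ ha', ← formalSum_sub, formalSum_eq_zero_add]
    · simp only [qCoeff_zero, pow_zero, one_smul, one_mul, mul_one, sub_self, zero_add]
      refine cls_formalSum_congr (fun n => ?_) (fun n => ?_) fun n => ?_
      · exact (pow_dvd_pow _ n.le_succ).trans
          (dvd_sub ((ha' _).mul_right _) (X_pow_dvd_mul_left _ (ha' _)))
      · exact dvd_sub (X_pow_dvd_mul_left _ (ha' _)) ((ha' _).mul_right _)
      · simp only [map_sub, map_mul, cls_smul, map_pow, smul_mul_assoc, mul_smul_comm, ← smul_sub]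
        rw [hcomm, smul_smul, mul_comm, qInt_mul_qCoeff hQ]
    · exact fun n => dvd_sub ((ha' _).mul_right _) (X_pow_dvd_mul_left _ (ha' _))
  simp only [map_sub, map_mul] at key
  rw [mul_add, add_mul, add_comm (cls S b * _), ← sub_eq_sub_iff_add_eq_add, key]

/-- The quotient `exp_Q z / exp_Q (M z) = ∑ₙ (1 - M) (1 - M Q) ⋯ (1 - M Q^(n-1)) zⁿ / (n)_Q!`, for
commuting `M` and `z`. -/
noncomputable def qRatio (Q : PowerSeries Laur) (M z : FreeTop G) : FreeTop G :=
  formalSum fun n => qCoeff Q n • (qPoch Q M n * z ^ n)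

theorem X_pow_dvd_qRatio_term (M : FreeTop G) {z : FreeTop G} (hz : PowerSeries.X ∣ z) (n : ℕ) :
    PowerSeries.X ^ n ∣ qCoeff Q n • (qPoch Q M n * z ^ n) :=
  X_pow_dvd_smul _ (X_pow_dvd_mul_left _ (X_pow_dvd_pow hz n))

theorem cls_qPoch (Q : PowerSeries Laur) (M : FreeTop G) (n : ℕ) :
    cls S (qPoch Q M n) = qPoch Q (cls S M) n := by
  induction n with
  | zero => simp [qPoch]
  | succ n ih => simp only [qPoch, map_mul, ih, map_sub, map_one, cls_smul]

/-- Cauchy's `q`-binomial theorem. -/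
theorem cls_qExp_eq_qRatio_mul (hQ : PowerSeries.constantCoeff Q = 1) {M z : FreeTop G}
    (hz : PowerSeries.X ∣ z) (h : cls S M * cls S z = cls S z * cls S M) :
    cls S (qExp Q z) = cls S (qRatio Q M z) * cls S (qExp Q (M * z)) := by
  have h₁ := fun n => X_pow_dvd_qRatio_term (Q := Q) M hz n
  have h₂ := fun n => X_pow_dvd_qExp_term (Q := Q) (X_dvd_mul_left M hz) n
  rw [← map_mul, qExp_eq, qExp_eq, qRatio, formalSum_mul_formalSum h₁ h₂]
  refine cls_formalSum_congr (fun n => X_pow_dvd_qExp_term hz n)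
    (fun n => Finset.dvd_sum fun p hp => ?_) fun n => ?_
  · rw [← Finset.HasAntidiagonal.mem_antidiagonal.1 hp]
    exact X_pow_dvd_mul (h₁ _) (h₂ _)
  · simp only [map_sum, map_mul, cls_smul, map_pow, cls_qPoch]
    exact qCoeff_smul_pow_eq_sum hQ h n

end QExp

/-! ### The deformation parameter -/

/-- The inclusion `ℂ[s]⟦t⟧ → ℂ[s,s⁻¹]⟦t⟧`. -/
noncomputable def intScal : PowerSeries ℂ[X] →+* PowerSeries Laur :=
  PowerSeries.map Polynomial.toLaurent

/-- `s` as an element of `ℂ[s]⟦t⟧`. -/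
noncomputable def sInt : PowerSeries ℂ[X] := PowerSeries.C Polynomial.X

theorem intScal_sInt : intScal sInt = sVar := by
  simp [intScal, sInt, sVar]

theorem intScal_X : intScal PowerSeries.X = tVar := by
  simp [intScal, tVar]

theorem IsDeformationParameter.exists_intScal {q : PowerSeries Laur}
    (hq : IsDeformationParameter q) :
    ∃ g : PowerSeries ℂ[X], q = intScal (1 + sInt ^ 2 * PowerSeries.X * (1 + sInt * g)) := by
  obtain ⟨g, rfl⟩ := hq
  refine ⟨g, ?_⟩
  simp only [map_add, map_mul, map_pow, map_one, intScal_sInt, intScal_X]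
  rw [intScal]
  ring

theorem IsDeformationParameter.constantCoeff {q : PowerSeries Laur}
    (hq : IsDeformationParameter q) : PowerSeries.constantCoeff q = 1 := by
  obtain ⟨g, rfl⟩ := hq
  simp [tVar]

theorem IsDeformationParameter.isUnit {q : PowerSeries Laur}
    (hq : IsDeformationParameter q) : IsUnit q :=
  isUnit_of_constantCoeff one_ne_zero (by simp [hq.constantCoeff])

theorem hasSubst_of_X_dvd {A : Type*} [CommRing A] {a : PowerSeries A} (ha : PowerSeries.X ∣ a) :
    PowerSeries.HasSubst a :=
  PowerSeries.HasSubst.of_constantCoeff_zero' (PowerSeries.X_dvd_iff.1 ha)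

theorem subst_eq_formalSum {A : Type*} [CommRing A] (f : PowerSeries A) {a : PowerSeries A}
    (ha : PowerSeries.X ∣ a) :
    f.subst a = formalSum fun k => PowerSeries.C (PowerSeries.coeff k f) * a ^ k := by
  ext n
  rw [PowerSeries.coeff_subst' (hasSubst_of_X_dvd ha), formalSum, PowerSeries.coeff_mk,
    finsum_eq_sum_of_support_subset (s := Finset.range (n + 1))]
  · simp
  · intro k hk
    rw [Finset.coe_range, Set.mem_Iio]
    by_contra hlt
    refine hk ?_
    have := PowerSeries.X_pow_dvd_iff.1 (X_pow_dvd_pow ha k) n (by omega)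
    simp only [this, smul_zero]

section ExpLog

variable {A : Type*} [CommRing A] [Algebra ℚ A]

/-- The series `g = exp (log (1 + X))` satisfies `(1 + X) g' = g`, which determines it up to its
constant coefficient. -/
theorem exp_subst_log : (PowerSeries.exp A).subst (PowerSeries.log A) = 1 + PowerSeries.X := by
  have : IsAddTorsionFree A := IsAddTorsionFree.of_module_rat A
  set g := (PowerSeries.exp A).subst (PowerSeries.log A) with hg
  have hd : (1 + PowerSeries.X) * PowerSeries.derivative A g = g := by
    rw [hg, PowerSeries.derivative_subst PowerSeries.HasSubst.log, PowerSeries.derivative_exp,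
      PowerSeries.deriv_log, mul_left_comm]
    convert mul_one _
    ext n
    cases n with
    | zero => simp
    | succ n =>
      rw [add_mul, one_mul, map_add, PowerSeries.coeff_succ_X_mul, PowerSeries.coeff_mk,
        PowerSeries.coeff_mk, PowerSeries.coeff_one, if_neg n.succ_ne_zero, pow_succ]
      simp
  have h0 : PowerSeries.coeff 0 g = 1 := by
    rw [hg, PowerSeries.coeff_subst' PowerSeries.HasSubst.log, finsum_eq_single _ 0]
    · simp
    · intro n hn
      simp [hn]
  have hrec : ∀ n : ℕ, ((n : A) + 1) * PowerSeries.coeff (n + 1) g =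
      (1 - n) * PowerSeries.coeff n g := by
    intro n
    have := congrArg (PowerSeries.coeff n) hd
    cases n with
    | zero =>
      simp only [add_mul, one_mul, map_add, PowerSeries.coeff_zero_X_mul,
        PowerSeries.coeff_derivative] at this
      simpa [mul_comm] using this
    | succ n =>
      rw [add_mul, one_mul, map_add, PowerSeries.coeff_succ_X_mul,
        PowerSeries.coeff_derivative, PowerSeries.coeff_derivative] at this
      push_cast at this ⊢
      linear_combination this
  have hcancel : ∀ (n : ℕ) (x : A), ((n : A) + 1) * x = 0 → x = 0 := by
    intro n x hx
    have : (n + 1) • x = (n + 1) • 0 := by rw [nsmul_eq_mul, Nat.cast_succ, hx, smul_zero]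
    exact (smul_right_inj n.succ_ne_zero).1 this
  have h1 : PowerSeries.coeff 1 g = 1 := by
    have := hrec 0
    simp only [Nat.cast_zero, zero_add, one_mul, sub_zero, h0] at this
    exact this
  have h2 : ∀ n, PowerSeries.coeff (n + 2) g = 0 := by
    intro n
    induction n with
    | zero => exact hcancel 1 _ (by simpa using hrec 1)
    | succ n ih => exact hcancel (n + 2) _ (by simpa [ih] using hrec (n + 2))
  ext n
  match n with
  | 0 => simp [h0]
  | 1 => simp [h1, PowerSeries.coeff_one]
  | n + 2 => simp [h2, PowerSeries.coeff_one, PowerSeries.coeff_X]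

theorem X_dvd_logOf {q : PowerSeries A} (hq : PowerSeries.constantCoeff q = 1) :
    PowerSeries.X ∣ PowerSeries.logOf q :=
  PowerSeries.X_dvd_iff.2 (PowerSeries.constantCoeff_logOf hq)

theorem exp_subst_logOf {q : PowerSeries A} (hq : PowerSeries.constantCoeff q = 1) :
    (PowerSeries.exp A).subst (PowerSeries.logOf q) = q := by
  have h : PowerSeries.HasSubst (q - 1) :=
    hasSubst_of_X_dvd (PowerSeries.X_dvd_iff.2 (by simp [hq]))
  rw [PowerSeries.logOf_eq, ← PowerSeries.subst_comp_subst_apply PowerSeries.HasSubst.log h,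
    exp_subst_log, PowerSeries.subst_add h, PowerSeries.subst_X h,
    ← map_one (PowerSeries.C (R := A)), PowerSeries.subst_C]
  change PowerSeries.C 1 + _ = _
  simp

/-- `log q` is divisible by `q - 1`. -/
theorem sub_one_dvd_logOf {q : PowerSeries A} (hq : PowerSeries.constantCoeff q = 1) :
    q - 1 ∣ PowerSeries.logOf q := by
  have h : PowerSeries.HasSubst (q - 1) :=
    hasSubst_of_X_dvd (PowerSeries.X_dvd_iff.2 (by simp [hq]))
  obtain ⟨l, hl⟩ := PowerSeries.X_dvd_iff.2 (PowerSeries.constantCoeff_log (A := A))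
  rw [PowerSeries.logOf_eq, hl, PowerSeries.subst_mul h, PowerSeries.subst_X h]
  exact dvd_mul_right _ _

end ExpLog

/-! ### Exponentials and powers of `q` -/

theorem qFactorial_one (k : ℕ) : qFactorial 1 k = (k.factorial : PowerSeries Laur) := by
  induction k with
  | zero => simp [qFactorial]
  | succ k ih =>
    rw [qFactorial, Finset.prod_range_succ, ← qFactorial, ih, Nat.factorial_succ]
    simp [qInt, mul_comm]

theorem cscal_inv_factorial (k : ℕ) : cscal ((k.factorial : ℂ)⁻¹) = qCoeff 1 k := by
  have h : cscal ((k.factorial : ℂ)⁻¹) * qFactorial 1 k = 1 := by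
    rw [qFactorial_one, cscal, ← map_natCast (PowerSeries.C (R := Laur)),
      ← map_natCast (algebraMap ℂ Laur), ← map_mul, ← map_mul,
      inv_mul_cancel₀ (Nat.cast_ne_zero.2 k.factorial_ne_zero), map_one, map_one]
  exact (isUnit_qFactorial (by simp) k).mul_right_cancel
    (h.trans (Ring.inverse_mul_cancel _ (isUnit_qFactorial (by simp) k)).symm)

theorem texp_eq_qExp {G : Type} (x : FreeTop G) : texp x = qExp 1 x := by
  rw [texp, qExp_eq]
  simp only [csmul_eq, cscal_inv_factorial]

theorem csmul_eq_mul (c : ℂ) (x : PowerSeries Laur) : c • x = cscal c * x := by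
  ext n
  rw [cscal, PowerSeries.coeff_C_mul, PowerSeries.coeff_smul, Algebra.smul_def]

theorem texp_eq_formalSum (x : PowerSeries Laur) :
    texp x = formalSum fun n => qCoeff 1 n • x ^ n := by
  rw [texp]
  simp only [csmul_eq_mul, cscal_inv_factorial, smul_eq_mul]

theorem texp_add {x y : PowerSeries Laur} (hx : PowerSeries.X ∣ x) (hy : PowerSeries.X ∣ y) :
    texp (x + y) = texp x * texp y := by
  have h : ∀ {z : PowerSeries Laur}, PowerSeries.X ∣ z →
      ∀ n, PowerSeries.X ^ n ∣ qCoeff 1 n • z ^ n :=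
    fun hz n => (X_pow_dvd_pow hz n).mul_left _
  simp only [texp_eq_formalSum]
  rw [formalSum_mul_formalSum (h hx) (h hy)]
  simp only [qCoeff_smul_add_pow (A := PowerSeries Laur) (Q := 1) (x := x) (y := y) (by simp)
    (by rw [one_smul, mul_comm])]

theorem texp_eq_subst {x : PowerSeries Laur} (hx : PowerSeries.X ∣ x) :
    texp x = (PowerSeries.exp Laur).subst x := by
  rw [subst_eq_formalSum _ hx, texp_eq_formalSum]
  simp only [smul_eq_mul, ← cscal_inv_factorial, cscal, PowerSeries.coeff_exp]
  congr! 5 with k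
  rw [IsScalarTower.algebraMap_apply ℚ ℂ Laur]
  simp

theorem texp_logOf {q : PowerSeries Laur} (hq : PowerSeries.constantCoeff q = 1) :
    texp (PowerSeries.logOf q) = q := by
  rw [texp_eq_subst (X_dvd_logOf hq), exp_subst_logOf hq]

theorem texp_zero : texp (0 : PowerSeries Laur) = 1 := by
  rw [texp_eq_formalSum, formalSum_eq_zero_add fun n => (X_pow_dvd_pow (dvd_zero _) n).mul_left _]
  simp only [qCoeff_zero, pow_zero, one_smul, pow_succ, mul_zero, smul_zero, add_eq_left]
  ext n
  simp [formalSum]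

theorem texp_neg_logOf {q : PowerSeries Laur} (hq : PowerSeries.constantCoeff q = 1) :
    texp (-PowerSeries.logOf q) = Ring.inverse q := by
  have hX := X_dvd_logOf hq
  have h := texp_add hX (dvd_neg.2 hX)
  rw [add_neg_cancel, texp_zero, texp_logOf hq] at h
  have hu : IsUnit q := isUnit_of_constantCoeff one_ne_zero (by simp [hq])
  exact hu.mul_left_cancel (h.symm.trans (Ring.mul_inverse_cancel _ hu).symm)

theorem map_texp_scal {G : Type} {x : PowerSeries Laur} (hx : PowerSeries.X ∣ x) :
    (scal (texp x) : FreeTop G) = texp (scal x) := by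
  rw [texp_eq_formalSum, map_formalSum (scal : PowerSeries Laur →+* FreeTop G) scal_X
      (f := fun n => qCoeff 1 n • x ^ n) fun n => (X_pow_dvd_pow hx n).mul_left _,
    texp_eq_qExp, qExp_eq]
  simp only [smul_eq_mul, map_mul, map_pow, scal_mul]

/-- A sum whose even terms vanish is the sum of its odd terms. -/
theorem formalSum_of_odd {R : Type*} [Ring R] {f : ℕ → PowerSeries R}
    (hf : ∀ k, PowerSeries.X ^ k ∣ f k) (h : ∀ k, f (2 * k) = 0) :
    formalSum f = formalSum fun k => f (2 * k + 1) := by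
  refine eq_formalSum (fun k => (pow_dvd_pow _ (by omega)).trans (hf _)) fun N => ?_
  have h₁ := X_pow_dvd_formalSum_sub hf (2 * N)
  have h₂ : ∑ k ∈ Finset.range (2 * N), f k = ∑ k ∈ Finset.range N, f (2 * k + 1) := by
    clear h₁
    induction N with
    | zero => simp
    | succ N ih =>
      rw [show 2 * (N + 1) = 2 * N + 1 + 1 by ring, Finset.sum_range_succ, Finset.sum_range_succ,
        ih, h, add_zero, Finset.sum_range_succ]
  rw [h₂] at h₁
  exact (pow_dvd_pow _ (by omega)).trans h₁

theorem scal_commute {R : Type*} [Ring R] [Algebra Laur R] (c : PowerSeries Laur)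
    (x : PowerSeries R) : Commute (scal c) x := by
  rw [Commute, SemiconjBy]
  ext n
  simp only [scal, PowerSeries.coeff_mul, PowerSeries.coeff_map]
  rw [← Finset.Nat.sum_antidiagonal_swap]
  exact Finset.sum_congr rfl fun p _ => Algebra.commutes _ _

theorem mul_csmul {R : Type*} [Ring R] [Algebra ℂ R] (c : ℂ) (x y : PowerSeries R) :
    x * c • y = c • (x * y) := by
  ext n; simp [PowerSeries.coeff_mul, Finset.smul_sum]

section Sinh

variable {R : Type*} [Ring R] [Algebra ℂ R] [Algebra Laur R]

/-- `2 l (sinh (l x) / l) = exp (l x) - exp (-l x)`. -/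
theorem two_mul_sinhDiv {l : PowerSeries Laur} (hl : PowerSeries.X ∣ l) (x : PowerSeries R) :
    2 * (scal l * sinhDiv l x) = texp (scal l * x) - texp (-(scal l * x)) := by
  have hl' : PowerSeries.X ∣ (scal l : PowerSeries R) := by
    obtain ⟨m, rfl⟩ := hl
    exact ⟨scal m, by simp [scal]⟩
  have hy : PowerSeries.X ∣ scal l * x := hl'.mul_right x
  have hterm : ∀ (c : ℂ) {z : PowerSeries R} {n : ℕ}, PowerSeries.X ^ n ∣ z →
      PowerSeries.X ^ n ∣ c • z := fun c z n ⟨w, hw⟩ => ⟨c • w, by rw [hw, mul_csmul]⟩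
  have hs : ∀ k : ℕ, PowerSeries.X ^ k ∣
      (((2 * k + 1).factorial : ℂ)⁻¹) • (scal (l ^ (2 * k)) * x ^ (2 * k + 1)) := fun k =>
    hterm _ (((pow_dvd_pow _ (by omega : k ≤ 2 * k)).trans
      (by rw [map_pow]; exact X_pow_dvd_pow hl' _)).mul_right _)
  rw [texp, texp, ← formalSum_sub, formalSum_of_odd, sinhDiv, mul_formalSum _ hs, mul_formalSum]
  · congr 1
    funext k
    rw [mul_csmul, mul_csmul, (odd_two_mul_add_one k).neg_pow, smul_neg, sub_neg_eq_add,
      ← smul_add, ← two_mul, map_pow, (scal_commute l x).mul_pow, pow_succ' (scal l), mul_assoc]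
  · exact fun k => X_pow_dvd_mul_left _ (hs k)
  · exact fun k => dvd_sub (hterm _ (X_pow_dvd_pow hy k))
      (hterm _ (X_pow_dvd_pow (dvd_neg.2 hy) k))
  · intro k
    rw [(even_two_mul k).neg_pow, sub_self]

end Sinh

section QPow

variable {G : Type} {S : Set (FreeTop G)} {q : PowerSeries Laur}

theorem qPow_eq (q : PowerSeries Laur) (x : FreeTop G) :
    qPow q x = qExp 1 (PowerSeries.logOf q • x) := by
  rw [qPow, texp_eq_qExp, scal_mul]

theorem cls_qPow_add (hq : PowerSeries.constantCoeff q = 1) {x y : FreeTop G}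
    (h : cls S y * cls S x = cls S x * cls S y) :
    cls S (qPow q (x + y)) = cls S (qPow q x) * cls S (qPow q y) := by
  have hX := X_dvd_logOf hq
  simp only [qPow_eq, smul_add]
  refine cls_qExp_add (by simp) (X_dvd_smul' hX _) (X_dvd_smul' hX _) ?_
  rw [one_smul, cls_smul, cls_smul, smul_mul_smul_comm, smul_mul_smul_comm, h]

@[simp] theorem qPow_zero : qPow q (0 : FreeTop G) = 1 := by
  rw [qPow_eq, smul_zero, qExp_zero]

theorem qPow_one (hq : PowerSeries.constantCoeff q = 1) :
    qPow q (1 : FreeTop G) = scal q := by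
  rw [qPow, mul_one, ← map_texp_scal (X_dvd_logOf hq), texp_logOf hq]

theorem cls_qPow_neg_mul (hq : PowerSeries.constantCoeff q = 1) (x : FreeTop G) :
    cls S (qPow q (-x)) * cls S (qPow q x) = 1 := by
  rw [← cls_qPow_add hq (by simp), neg_add_cancel, qPow_zero, map_one]

theorem cls_qPow_natCast (hq : PowerSeries.constantCoeff q = 1) (n : ℕ) :
    cls S (qPow q (n : FreeTop G)) = q ^ n • 1 := by
  induction n with
  | zero => simp
  | succ n ih =>
    rw [Nat.cast_succ, cls_qPow_add hq (by simp), ih, qPow_one hq, cls_scal, smul_mul_smul_comm,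
      one_mul, pow_succ]

/-- An element `x` with `x h = h' x` carries `q^h` to `q^(h')`. -/
theorem cls_mul_qPow (hq : PowerSeries.constantCoeff q = 1) {h h' x : FreeTop G}
    (hx : cls S x * cls S h = cls S h' * cls S x) :
    cls S x * cls S (qPow q h) = cls S (qPow q h') * cls S x := by
  simp only [qPow_eq]
  refine cls_mul_qExp (X_dvd_smul' (X_dvd_logOf hq) _) (X_dvd_smul' (X_dvd_logOf hq) _) ?_
  rw [cls_smul, cls_smul, mul_smul_comm, smul_mul_assoc, hx]

/-- `q^h x = qⁿ x q^h` if `[h, x] = n x`. -/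
theorem cls_qPow_mul_of_lie (hq : PowerSeries.constantCoeff q = 1) {h x : FreeTop G} (n : ℕ)
    (hx : cls S ⁅h, x⁆ = n * cls S x) :
    cls S (qPow q h) * cls S x = q ^ n • (cls S x * cls S (qPow q h)) := by
  rw [Ring.lie_def, map_sub, map_mul, map_mul, sub_eq_iff_eq_add] at hx
  rw [← cls_mul_qPow (h := h + (n : FreeTop G)) hq, cls_qPow_add hq, cls_qPow_natCast hq,
    mul_smul_comm, mul_smul_comm, mul_one]
  · simpa using (Nat.cast_commute n (cls S h)).eq
  · rw [hx, map_add, map_natCast, mul_add, add_comm, (Nat.cast_commute n (cls S x)).eq]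

/-- `qⁿ q^h x = x q^h` if `[h, x] = -n x`. -/
theorem cls_qPow_mul_of_lie_neg (hq : PowerSeries.constantCoeff q = 1) {h x : FreeTop G} (n : ℕ)
    (hx : cls S ⁅h, x⁆ = -(n * cls S x)) :
    cls S x * cls S (qPow q h) = q ^ n • (cls S (qPow q h) * cls S x) := by
  rw [Ring.lie_def, map_sub, map_mul, map_mul, sub_eq_iff_eq_add] at hx
  rw [cls_mul_qPow (h' := h + (n : FreeTop G)) hq, cls_qPow_add hq, cls_qPow_natCast hq,
    mul_smul_comm, smul_mul_assoc, mul_one]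
  · simpa using (Nat.cast_commute n (cls S h)).eq
  · rw [map_add, map_natCast, add_mul, hx]
    abel

/-- The quantum number, which is defined by dividing two `sinh` series, is
`(q^x - q^(-x)) / (q - q⁻¹)`. -/
theorem smul_qNumber (hq : PowerSeries.constantCoeff q = 1) (x : FreeTop G) :
    (q - Ring.inverse q) • qNumber q x = qPow q x - qPow q (-x) := by
  have hX := X_dvd_logOf hq
  set l := PowerSeries.logOf q with hl
  have h₁ : q - Ring.inverse q = 2 * (l * sinhDiv l (1 : PowerSeries Laur)) := by
    have := two_mul_sinhDiv hX (1 : PowerSeries Laur)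
    have hid : ∀ c : PowerSeries Laur, (scal c : PowerSeries Laur) = c := fun c => by
      ext n; simp [scal]
    rw [hid, mul_one, texp_logOf hq, texp_neg_logOf hq] at this
    exact this.symm
  -- Only the quotient `sinh l / l` is invertible: `q - q⁻¹` itself is divisible by `t`.
  have hu : IsUnit (sinhDiv l (1 : PowerSeries Laur)) := by
    refine isUnit_of_constantCoeff one_ne_zero ?_
    rw [← PowerSeries.coeff_zero_eq_constantCoeff_apply, sinhDiv, formalSum, PowerSeries.coeff_mk]
    simp
  have h₂ : (q - Ring.inverse q) * Ring.inverse (sinhDiv l (1 : PowerSeries Laur)) = 2 * l := by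
    rw [h₁, mul_assoc, mul_assoc, Ring.mul_inverse_cancel _ hu, mul_one]
  rw [qNumber, ← hl, scal_mul, smul_smul, h₂, mul_smul, qPow, qPow, ← hl, mul_neg (scal l) x,
    ← two_mul_sinhDiv hX, ← scal_mul, ← scal_mul, map_ofNat]

end QPow

/-! ### Continuous homomorphisms -/

section TopHom

variable {G H I : Type}

/-- A homomorphism is linear over the ground ring `ℂ[s,s⁻¹]⟦t⟧`. It is then `t`-adically
continuous. -/
def IsTopHom (φ : FreeTop G →+* FreeTop H) : Prop :=
  ∀ c : PowerSeries Laur, φ (scal c) = scal c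

theorem extendT_C {R S : Type*} [Ring R] [Ring S] (φ : R →+* PowerSeries S) (r : R) :
    extendT φ (PowerSeries.C r) = φ r := by
  ext n
  simp only [extendT, RingHom.coe_mk, MonoidHom.coe_mk, OneHom.coe_mk, PowerSeries.coeff_mk]
  rw [Finset.sum_eq_single (0, n)]
  · simp
  · rintro ⟨a, b⟩ h hne
    have ha : a ≠ 0 := by
      rintro rfl
      rw [Finset.HasAntidiagonal.mem_antidiagonal] at h
      exact hne (by simpa using h)
    simp [PowerSeries.coeff_C, ha]
  · simp

theorem extendT_map_algebraMap {R S : Type*} [Ring R] [Algebra Laur R] [Ring S] [Algebra Laur S]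
    (φ : R →+* PowerSeries S)
    (hφ : ∀ c : Laur, φ (algebraMap Laur R c) = PowerSeries.C (algebraMap Laur S c))
    (c : PowerSeries Laur) : extendT φ (scal c) = scal c := by
  ext n
  simp only [extendT, RingHom.coe_mk, MonoidHom.coe_mk, OneHom.coe_mk, PowerSeries.coeff_mk, scal,
    PowerSeries.coeff_map, hφ]
  rw [Finset.sum_eq_single (n, 0)]
  · simp
  · rintro ⟨a, b⟩ h hne
    have hb : b ≠ 0 := by
      rintro rfl
      rw [Finset.HasAntidiagonal.mem_antidiagonal] at h
      exact hne (by simpa using h)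
    simp [PowerSeries.coeff_C, hb]
  · simp

theorem isTopHom_homOfGen (v : G → FreeTop H) : IsTopHom (homOfGen v) := by
  intro c
  refine extendT_map_algebraMap _ (fun c => ?_) c
  rw [AlgHom.toRingHom_eq_coe, RingHom.coe_coe, AlgHom.commutes, PowerSeries.algebraMap_apply]

theorem homOfGen_gen (v : G → FreeTop H) (x : G) : homOfGen v (gen x) = v x := by
  rw [homOfGen, gen, extendT_C]
  simp

namespace IsTopHom

variable {φ ψ : FreeTop G →+* FreeTop H}

theorem map_X (hφ : IsTopHom φ) : φ PowerSeries.X = PowerSeries.X := by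
  rw [← scal_X, hφ, scal_X]

theorem map_smul (hφ : IsTopHom φ) (c : PowerSeries Laur) (x : FreeTop G) :
    φ (c • x) = c • φ x := by
  rw [← scal_mul, map_mul, hφ, scal_mul]

theorem map_csmul (hφ : IsTopHom φ) (c : ℂ) (x : FreeTop G) : φ (c • x) = c • φ x := by
  rw [csmul_eq, hφ.map_smul, csmul_eq]

theorem X_dvd (hφ : IsTopHom φ) {x : FreeTop G} (hx : PowerSeries.X ∣ x) :
    PowerSeries.X ∣ φ x := by
  rw [← hφ.map_X]; exact map_dvd φ hx

theorem map_qExp (hφ : IsTopHom φ) (Q : PowerSeries Laur) {x : FreeTop G}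
    (hx : PowerSeries.X ∣ x) : φ (qExp Q x) = qExp Q (φ x) := by
  rw [qExp_eq, map_formalSum φ hφ.map_X (X_pow_dvd_qExp_term hx), qExp_eq]
  simp only [hφ.map_smul, map_pow]

theorem map_qPow (hφ : IsTopHom φ) {q : PowerSeries Laur} (hq : PowerSeries.constantCoeff q = 1)
    (x : FreeTop G) : φ (qPow q x) = qPow q (φ x) := by
  rw [qPow_eq, hφ.map_qExp _ (X_dvd_smul' (X_dvd_logOf hq) _), hφ.map_smul, qPow_eq]

theorem comp {χ : FreeTop H →+* FreeTop I} (hχ : IsTopHom χ) (hφ : IsTopHom φ) :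
    IsTopHom (χ.comp φ) := fun c => by rw [RingHom.comp_apply, hφ, hχ]

end IsTopHom

theorem isTopHom_id : IsTopHom (RingHom.id (FreeTop G)) := fun _ => rfl

/-- Induction for closed properties of elements of a topologically free algebra; `hc` is the
closedness in the `t`-adic topology. -/
theorem freeTop_induction {P : FreeTop G → Prop} (hs : ∀ c, P (scal c)) (hg : ∀ x, P (gen x))
    (ha : ∀ f g, P f → P g → P (f + g)) (hm : ∀ f g, P f → P g → P (f * g))
    (hc : ∀ f, (∀ N : ℕ, ∃ r, P (f - PowerSeries.X ^ N * r)) → P f) (f : FreeTop G) : P f := by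
  have h₁ : ∀ a : FreeAlgebra Laur G, P (PowerSeries.C a) := by
    intro a
    induction a using FreeAlgebra.induction with
    | grade0 r => simpa [scal] using hs (PowerSeries.C r)
    | grade1 x => exact hg x
    | mul a b h h' => rw [map_mul]; exact hm _ _ h h'
    | add a b h h' => rw [map_add]; exact ha _ _ h h'
  have hX : ∀ n : ℕ, P (PowerSeries.X ^ n) := fun n => by
    have := hs (PowerSeries.X ^ n)
    rwa [map_pow, scal_X] at this
  refine hc f fun N => ?_
  have h₂ : PowerSeries.X ^ N ∣
      f - ∑ n ∈ Finset.range N, PowerSeries.X ^ n * PowerSeries.C (PowerSeries.coeff n f) := by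
    rw [PowerSeries.X_pow_dvd_iff]
    intro m hm
    rw [map_sub, map_sum, Finset.sum_eq_single m]
    · simp
    · intro n _ hn
      rw [PowerSeries.coeff_X_pow_mul', PowerSeries.coeff_C]
      split_ifs with h h'
      · omega
      · rfl
      · rfl
    · simp [hm]
  obtain ⟨r, hr⟩ := h₂
  refine ⟨r, ?_⟩
  rw [← hr, sub_sub_cancel]
  refine Finset.sum_induction _ P ha (by simpa using hs 0) fun n _ => hm _ _ (hX n) (h₁ _)

/-- A topological homomorphism is determined by its values on the generators. -/
theorem IsTopHom.ext {φ ψ : FreeTop G →+* FreeTop H} (hφ : IsTopHom φ) (hψ : IsTopHom ψ)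
    (h : ∀ x, φ (gen x) = ψ (gen x)) (f : FreeTop G) : φ f = ψ f := by
  refine freeTop_induction (P := fun f => φ f = ψ f) (fun c => by rw [hφ, hψ]) h
    (fun f g hf hg => by simp only [map_add, hf, hg])
    (fun f g hf hg => by simp only [map_mul, hf, hg]) (fun f hf => ?_) f
  refine eq_of_X_pow_dvd_sub fun N => ?_
  obtain ⟨r, hr⟩ := hf N
  refine ⟨φ r - ψ r, ?_⟩
  simp only [map_sub, map_mul, map_pow, hφ.map_X, hψ.map_X] at hr
  rw [mul_sub, sub_eq_sub_iff_sub_eq_sub, hr]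

theorem IsTopHom.cls_ext {S : Set (FreeTop H)} {φ ψ : FreeTop G →+* FreeTop H} (hφ : IsTopHom φ)
    (hψ : IsTopHom ψ) (h : ∀ x, cls S (φ (gen x)) = cls S (ψ (gen x))) (f : FreeTop G) :
    cls S (φ f) = cls S (ψ f) := by
  refine freeTop_induction (P := fun f => cls S (φ f) = cls S (ψ f)) (fun c => by rw [hφ, hψ]) h
    (fun f g hf hg => by simp only [map_add, hf, hg])
    (fun f g hf hg => by simp only [map_mul, hf, hg]) (fun f hf => ?_) f
  refine cls_eq_of_forall fun N => ?_
  obtain ⟨r, hr⟩ := hf N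
  refine ⟨φ r - ψ r, ?_⟩
  simp only [map_sub, map_mul, map_pow, hφ.map_X, hψ.map_X] at hr ⊢
  rw [mul_sub, sub_eq_sub_iff_sub_eq_sub, hr]

/-- An element that commutes with the images of the generators commutes with the whole image. -/
theorem IsTopHom.cls_commute {S : Set (FreeTop H)} {φ : FreeTop G →+* FreeTop H} (hφ : IsTopHom φ)
    {b : FreeTop H} (h : ∀ x, Commute (cls S b) (cls S (φ (gen x)))) (f : FreeTop G) :
    Commute (cls S b) (cls S (φ f)) := by
  refine freeTop_induction (P := fun f => Commute (cls S b) (cls S (φ f))) (fun c => ?_) h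
    (fun f g hf hg => by rw [map_add, map_add]; exact hf.add_right hg)
    (fun f g hf hg => by rw [map_mul, map_mul]; exact hf.mul_right hg) (fun f hf => ?_) f
  · rw [hφ, cls_scal]
    exact (Commute.one_right _).smul_right c
  · change cls S b * cls S (φ f) = cls S (φ f) * cls S b
    rw [← map_mul, ← map_mul]
    refine cls_eq_of_forall fun N => ?_
    obtain ⟨r, hr⟩ := hf N
    refine ⟨b * φ r - φ r * b, ?_⟩
    have hr' := hr.eq
    simp only [map_sub, map_mul, map_pow, hφ.map_X, mul_sub, sub_mul] at hr' ⊢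
    have hX : cls S b * cls S PowerSeries.X ^ N = cls S PowerSeries.X ^ N * cls S b := by
      rw [← map_pow, ← map_mul, ← map_mul, (PowerSeries.commute_X_pow b N).eq]
    rw [← mul_assoc, ← mul_assoc, ← hX, mul_assoc, mul_assoc, ← mul_assoc (cls S b),
      sub_eq_sub_iff_sub_eq_sub]
    simpa only [mul_assoc] using hr'

end TopHom

/-! ### Tensor legs -/

section Legs

variable {G : Type}

theorem isTopHom_leg {n : ℕ} (k : Fin n) : IsTopHom (leg (G := G) k) := isTopHom_homOfGen _
theorem isTopHom_leg₂ (i j : Fin 3) : IsTopHom (leg₂ (G := G) i j) := isTopHom_homOfGen _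
theorem isTopHom_counitId : IsTopHom (counitId G) := isTopHom_homOfGen _
theorem isTopHom_idCounit : IsTopHom (idCounit G) := isTopHom_homOfGen _

@[simp] theorem leg_gen {n : ℕ} (k : Fin n) (x : G) : leg k (gen x) = gen (k, x) :=
  homOfGen_gen _ _

@[simp] theorem leg₂_gen (i j : Fin 3) (p : Fin 2 × G) :
    leg₂ i j (gen p) = gen (![i, j] p.1, p.2) :=
  homOfGen_gen _ _

@[simp] theorem leg₂_leg_zero (i j : Fin 3) (x : FreeTop G) : leg₂ i j (leg 0 x) = leg i x :=
  ((isTopHom_leg₂ i j).comp (isTopHom_leg 0)).ext (isTopHom_leg i) (fun x => by simp) x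

@[simp] theorem leg₂_leg_one (i j : Fin 3) (x : FreeTop G) : leg₂ i j (leg 1 x) = leg j x :=
  ((isTopHom_leg₂ i j).comp (isTopHom_leg 1)).ext (isTopHom_leg j) (fun x => by simp) x

@[simp] theorem counitId_gen (p : Fin 2 × G) :
    counitId G (gen p) = if p.1 = 0 then 0 else gen p.2 :=
  homOfGen_gen _ _

@[simp] theorem idCounit_gen (p : Fin 2 × G) :
    idCounit G (gen p) = if p.1 = 0 then gen p.2 else 0 :=
  homOfGen_gen _ _

@[simp] theorem counitId_leg_one (x : FreeTop G) : counitId G (leg 1 x) = x :=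
  (isTopHom_counitId.comp (isTopHom_leg 1)).ext isTopHom_id
    (fun x => by simp) x

@[simp] theorem idCounit_leg_zero (x : FreeTop G) : idCounit G (leg 0 x) = x :=
  (isTopHom_idCounit.comp (isTopHom_leg 0)).ext isTopHom_id
    (fun x => by simp) x

theorem tmul_one (x : FreeTop G) : tmul x 1 = leg 0 x := by simp [tmul]

theorem one_tmul (x : FreeTop G) : tmul 1 x = leg 1 x := by simp [tmul]

end Legs

namespace HopfPresentation

variable {G : Type} (U : HopfPresentation G)

theorem isTopHom_Δ : IsTopHom U.Δ := isTopHom_homOfGen _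
theorem isTopHom_Δid : IsTopHom U.Δid := isTopHom_homOfGen _
theorem isTopHom_idΔ : IsTopHom U.idΔ := isTopHom_homOfGen _

@[simp] theorem Δ_gen (x : G) : U.Δ (gen x) = U.comul x := homOfGen_gen _ _

@[simp] theorem Δid_leg_zero (x : FreeTop G) : U.Δid (leg 0 x) = leg₂ 0 1 (U.Δ x) :=
  (U.isTopHom_Δid.comp (isTopHom_leg 0)).ext ((isTopHom_leg₂ 0 1).comp U.isTopHom_Δ)
    (fun x => by simp [Δid, homOfGen_gen]) x

@[simp] theorem Δid_leg_one (x : FreeTop G) : U.Δid (leg 1 x) = leg 2 x :=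
  (U.isTopHom_Δid.comp (isTopHom_leg 1)).ext (isTopHom_leg 2)
    (fun x => by simp [Δid, homOfGen_gen]) x

@[simp] theorem idΔ_leg_zero (x : FreeTop G) : U.idΔ (leg 0 x) = leg 0 x :=
  (U.isTopHom_idΔ.comp (isTopHom_leg 0)).ext (isTopHom_leg 0)
    (fun x => by simp [idΔ, homOfGen_gen]) x

@[simp] theorem idΔ_leg_one (x : FreeTop G) : U.idΔ (leg 1 x) = leg₂ 1 2 (U.Δ x) :=
  (U.isTopHom_idΔ.comp (isTopHom_leg 1)).ext ((isTopHom_leg₂ 1 2).comp U.isTopHom_Δ)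
    (fun x => by simp [idΔ, homOfGen_gen]) x

/-- Different tensor legs commute. -/
theorem leg_commute {n : ℕ} {k l : Fin n} (h : k ≠ l) (x y : FreeTop G) :
    Commute (cls (U.tensorRel n) (leg k x)) (cls (U.tensorRel n) (leg l y)) := by
  refine (isTopHom_leg l).cls_commute (fun y => ?_) y
  refine ((isTopHom_leg k).cls_commute (fun x => ?_) x).symm
  rw [leg_gen, leg_gen, Commute, SemiconjBy, ← sub_eq_zero, ← map_mul, ← map_mul, ← map_sub]
  exact cls_eq_zero_of_mem (Or.inr ⟨l, k, h.symm, y, x, rfl⟩)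

theorem leg_leg₂_commute {i j k : Fin 3} (hi : k ≠ i) (hj : k ≠ j) (x : FreeTop G)
    (y : FreeTop (Fin 2 × G)) :
    Commute (cls (U.tensorRel 3) (leg k x)) (cls (U.tensorRel 3) (leg₂ i j y)) := by
  refine (isTopHom_leg₂ i j).cls_commute (fun p => ?_) y
  rw [leg₂_gen, ← leg_gen]
  refine U.leg_commute ?_ _ _
  rcases p with ⟨a, p⟩
  fin_cases a
  · exact hi
  · exact hj

/-- The relations hold in every tensor leg. -/
theorem cls_leg {n : ℕ} (k : Fin n) {x y : FreeTop G} (h : cls U.rel x = cls U.rel y) :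
    cls (U.tensorRel n) (leg k x) = cls (U.tensorRel n) (leg k y) :=
  cls_map (leg k) (isTopHom_leg k).map_X
    (fun r hr => cls_eq_zero_of_mem (Or.inl ⟨k, r, hr, rfl⟩)) h

/-- The coproduct is coassociative and counital on the generators. Coassociativity holds modulo the
relations, since it uses `q^(h ⊗ 1 + 1 ⊗ h) = q^h ⊗ q^h`. -/
structure IsCoassociative : Prop where
  coassoc : ∀ x, cls (U.tensorRel 3) (U.Δid (U.comul x)) = cls (U.tensorRel 3) (U.idΔ (U.comul x))
  counitId_comul : ∀ x, counitId G (U.comul x) = gen x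
  idCounit_comul : ∀ x, idCounit G (U.comul x) = gen x

variable {U}

/-- If `R` is a twist, then so is every gauge transform `(W ⊗ W) R Δ(W⁻¹)`. -/
theorem IsTwist.gauge {R : FreeTop (Fin 2 × G)} (hR : U.IsTwist R) (hU : U.IsCoassociative)
    {W : FreeTop G} (hW : IsUnit W) (h₀ : counitId G (leg 0 W) = 1)
    (h₁ : idCounit G (leg 1 W) = 1) :
    U.IsTwist (tmul W W * R * U.Δ (Ring.inverse W)) := by
  obtain ⟨hu, hc, hε₀, hε₁⟩ := hR
  set V := Ring.inverse W with hV
  have hVW : V * W = 1 := Ring.inverse_mul_cancel W hW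
  have hWV : W * V = 1 := Ring.mul_inverse_cancel W hW
  have hV' : IsUnit V := ⟨⟨V, W, hVW, hWV⟩, rfl⟩
  refine ⟨?_, ?_, ?_, ?_⟩
  · rw [map_mul, map_mul, tmul, map_mul]
    exact (((hW.map _).map _).mul ((hW.map _).map _)).mul hu |>.mul ((hV'.map _).map _)
  · have e₁ : leg₂ 0 1 (U.Δ V) * leg₂ 0 1 (U.Δ W) = 1 := by
      rw [← map_mul, ← map_mul, hVW, map_one, map_one]
    have e₂ : leg₂ 1 2 (U.Δ V) * leg₂ 1 2 (U.Δ W) = 1 := by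
      rw [← map_mul, ← map_mul, hVW, map_one, map_one]
    have e₃ : cls (U.tensorRel 3) (U.Δid (U.Δ V)) = cls (U.tensorRel 3) (U.idΔ (U.Δ V)) :=
      (U.isTopHom_Δid.comp U.isTopHom_Δ).cls_ext (U.isTopHom_idΔ.comp U.isTopHom_Δ)
        (fun x => by simpa using hU.coassoc x) V
    have c₁ := (U.leg_leg₂_commute (i := 0) (j := 1) (k := 2) (by decide) (by decide) W R).eq
    have c₂ := (U.leg_leg₂_commute (i := 1) (j := 2) (k := 0) (by decide) (by decide) W R).eq
    have c₃ := (U.leg_leg₂_commute (i := 1) (j := 2) (k := 0) (by decide) (by decide) W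
      (U.Δ W)).eq
    have c₄ := (U.leg_commute (k := (0 : Fin 3)) (l := 1) (by decide) W W).eq
    have c₅ := (U.leg_commute (k := (0 : Fin 3)) (l := 2) (by decide) W W).eq
    simp only [tmul, map_mul, leg₂_leg_zero, leg₂_leg_one, Δid_leg_zero, Δid_leg_one,
      idΔ_leg_zero, idΔ_leg_one] at hc ⊢
    rw [e₃]
    have e₁' := congrArg (cls (U.tensorRel 3)) e₁
    have e₂' := congrArg (cls (U.tensorRel 3)) e₂
    rw [map_mul, map_one] at e₁' e₂'
    set w₀ := cls (U.tensorRel 3) (leg 0 W)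
    set w₁ := cls (U.tensorRel 3) (leg 1 W)
    set w₂ := cls (U.tensorRel 3) (leg 2 W)
    set r₀ := cls (U.tensorRel 3) (leg₂ 0 1 R)
    set r₁ := cls (U.tensorRel 3) (leg₂ 1 2 R)
    set d := cls (U.tensorRel 3) (U.idΔ (U.Δ V))
    set a := cls (U.tensorRel 3) (leg₂ 0 1 (U.Δ V))
    set a' := cls (U.tensorRel 3) (leg₂ 0 1 (U.Δ W))
    set b := cls (U.tensorRel 3) (leg₂ 1 2 (U.Δ V))
    set b' := cls (U.tensorRel 3) (leg₂ 1 2 (U.Δ W))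
    set x := cls (U.tensorRel 3) (U.Δid R)
    set y := cls (U.tensorRel 3) (U.idΔ R)
    -- The middle factors `Δ(W⁻¹)` and `Δ(W)` cancel, and `W` in one tensor factor commutes with `R`
    -- in the two others; what remains is the cocycle equation for `R` and coassociativity on `W⁻¹`.
    calc w₀ * w₁ * r₀ * a * (a' * w₂ * x * d) = w₀ * w₁ * r₀ * (a * a') * w₂ * x * d := by
          simp only [mul_assoc]
      _ = w₀ * w₁ * (w₂ * r₀) * x * d := by rw [e₁', mul_one, c₁]; simp only [mul_assoc]
      _ = w₀ * w₁ * w₂ * (r₀ * x) * d := by simp only [mul_assoc]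
      _ = w₀ * w₁ * w₂ * r₁ * y * d := by rw [hc]; simp only [mul_assoc]
      _ = w₁ * (w₀ * w₂) * r₁ * y * d := by rw [c₄]; simp only [mul_assoc]
      _ = w₁ * w₂ * (w₀ * r₁) * y * d := by rw [c₅]; simp only [mul_assoc]
      _ = w₁ * w₂ * r₁ * (b * b') * w₀ * y * d := by
          rw [c₂, e₂', mul_one]; simp only [mul_assoc]
      _ = w₁ * w₂ * r₁ * b * (b' * w₀) * y * d := by simp only [mul_assoc]
      _ = w₁ * w₂ * r₁ * b * (w₀ * b' * y * d) := by rw [← c₃]; simp only [mul_assoc]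
  · have e : counitId G (U.Δ V) = V :=
      (isTopHom_counitId.comp U.isTopHom_Δ).ext isTopHom_id
        (fun x => by simpa using hU.counitId_comul x) V
    rw [tmul, map_mul, map_mul (counitId G), map_mul (counitId G), map_mul (cls U.rel), h₀,
      counitId_leg_one, one_mul, e, map_mul, hε₀, mul_one, ← map_mul, hWV, map_one]
  · have e : idCounit G (U.Δ V) = V :=
      (isTopHom_idCounit.comp U.isTopHom_Δ).ext isTopHom_id
        (fun x => by simpa using hU.idCounit_comul x) V
    rw [tmul, map_mul, map_mul (idCounit G), map_mul (idCounit G), map_mul (cls U.rel), h₁,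
      idCounit_leg_zero, mul_one, e, map_mul, hε₁, mul_one, ← map_mul, hWV, map_one]

variable (U) in
theorem isTwist_one : U.IsTwist 1 := by
  simp [IsTwist]

end HopfPresentation

/-! ### Simple tensors and coassociativity -/

namespace HopfPresentation

variable {G : Type} (U : HopfPresentation G)

/-- The embedding of `U` as the tensor factor `k` of a completed tensor power. -/
noncomputable def legHom {n : ℕ} (k : Fin n) :
    Presented U.rel →ₐ[PowerSeries Laur] Presented (U.tensorRel n) where
  toRingHom := RingCon.lift _ ((cls (U.tensorRel n)).comp (leg k)) fun x y h =>
    U.cls_leg k ((RingCon.eq _).2 h)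
  commutes' c := by
    change cls (U.tensorRel n) (leg k (scal c)) = cls (U.tensorRel n) (scal c)
    rw [isTopHom_leg k c]

theorem legHom_cls {n : ℕ} (k : Fin n) (x : FreeTop G) :
    U.legHom k (cls U.rel x) = cls (U.tensorRel n) (leg k x) := rfl

theorem legHom_commute {n : ℕ} {k l : Fin n} (h : k ≠ l) (x y : Presented U.rel) :
    Commute (U.legHom k x) (U.legHom l y) := by
  obtain ⟨x, rfl⟩ := RingCon.mk'_surjective _ x
  obtain ⟨y, rfl⟩ := RingCon.mk'_surjective _ y
  exact U.leg_commute h x y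

/-- The simple tensor `x ⊗ y` in `U ⊗ U`. -/
noncomputable def ten (x y : Presented U.rel) : Presented (U.tensorRel 2) :=
  U.legHom 0 x * U.legHom 1 y

/-- The simple tensor `x ⊗ y ⊗ z` in `U ⊗ U ⊗ U`. -/
noncomputable def ten₃ (x y z : Presented U.rel) : Presented (U.tensorRel 3) :=
  U.legHom 0 x * U.legHom 1 y * U.legHom 2 z

variable (x y z x' y' z' : Presented U.rel) (c : PowerSeries Laur)

theorem cls_tmul (x y : FreeTop G) :
    cls (U.tensorRel 2) (tmul x y) = U.ten (cls U.rel x) (cls U.rel y) := by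
  rw [tmul, map_mul]; rfl

theorem ten_mul : U.ten x y * U.ten x' y' = U.ten (x * x') (y * y') := by
  rw [ten, ten, ten, mul_assoc, ← mul_assoc (U.legHom 1 y),
    ← (U.legHom_commute (by decide : (0 : Fin 2) ≠ 1) x' y).eq, map_mul, map_mul]
  simp only [mul_assoc]

theorem ten₃_mul : U.ten₃ x y z * U.ten₃ x' y' z' = U.ten₃ (x * x') (y * y') (z * z') := by
  have h₁ := (U.legHom_commute (by decide : (0 : Fin 3) ≠ 1) x' y).eq
  have h₂ := (U.legHom_commute (by decide : (0 : Fin 3) ≠ 2) x' z).eq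
  have h₃ := (U.legHom_commute (by decide : (1 : Fin 3) ≠ 2) y' z).eq
  simp only [ten₃, map_mul]
  set a := U.legHom (n := 3) 0 x
  set b := U.legHom (n := 3) 1 y
  set d := U.legHom (n := 3) 2 z
  set a' := U.legHom (n := 3) 0 x'
  set b' := U.legHom (n := 3) 1 y'
  set d' := U.legHom (n := 3) 2 z'
  calc a * b * d * (a' * b' * d') = a * b * (d * a') * b' * d' := by simp only [mul_assoc]
    _ = a * (b * a') * (d * b') * d' := by rw [← h₂]; simp only [mul_assoc]
    _ = a * a' * (b * b') * (d * d') := by rw [← h₁, ← h₃]; simp only [mul_assoc]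

theorem ten_sub_left : U.ten (x - x') y = U.ten x y - U.ten x' y := by simp [ten, sub_mul]
theorem ten_sub_right : U.ten x (y - y') = U.ten x y - U.ten x y' := by simp [ten, mul_sub]
theorem ten_smul_left : U.ten (c • x) y = c • U.ten x y := by simp [ten]
theorem ten_smul_right : U.ten x (c • y) = c • U.ten x y := by simp [ten]

theorem ten₃_sub_mid : U.ten₃ x (y - y') z = U.ten₃ x y z - U.ten₃ x y' z := by
  simp [ten₃, mul_sub, sub_mul]
theorem ten₃_smul_mid : U.ten₃ x (c • y) z = c • U.ten₃ x y z := by simp [ten₃]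

theorem cls_leg_zero (x : FreeTop G) :
    cls (U.tensorRel 2) (leg 0 x) = U.ten (cls U.rel x) 1 := by
  rw [ten, map_one, mul_one]; rfl

theorem cls_leg_one (x : FreeTop G) :
    cls (U.tensorRel 2) (leg 1 x) = U.ten 1 (cls U.rel x) := by
  rw [ten, map_one, one_mul]; rfl

theorem coassoc_of_isPrimitive {x : G} (h : U.comul x = tmul (gen x) 1 + tmul 1 (gen x)) :
    cls (U.tensorRel 3) (U.Δid (U.comul x)) = cls (U.tensorRel 3) (U.idΔ (U.comul x)) := by
  simp only [h, tmul_one, one_tmul, map_add, Δid_leg_zero, Δid_leg_one, idΔ_leg_zero,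
    idΔ_leg_one, Δ_gen, leg₂_leg_zero, leg₂_leg_one, add_assoc]

variable {q : PowerSeries Laur} (hq : PowerSeries.constantCoeff q = 1)
include hq

/-- Coassociativity on a generator `x` with `Δ(x) = q^h ⊗ x + x ⊗ 1` and `h` primitive. -/
theorem coassoc_of_left {x : G} {h : FreeTop G} (hh : U.Δ h = leg 0 h + leg 1 h)
    (hx : U.comul x = tmul (qPow q h) (gen x) + tmul (gen x) 1) :
    cls (U.tensorRel 3) (U.Δid (U.comul x)) = cls (U.tensorRel 3) (U.idΔ (U.comul x)) := by
  have e := cls_qPow_add (S := U.tensorRel 3) hq (x := leg 0 h) (y := leg 1 h)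
    (U.leg_commute (by decide) _ _).eq
  rw [← (isTopHom_leg 0).map_qPow hq, ← (isTopHom_leg 1).map_qPow hq] at e
  simp only [hx, tmul, map_add, Δid_leg_zero, Δid_leg_one, idΔ_leg_zero,
    idΔ_leg_one, Δ_gen, leg₂_leg_zero, leg₂_leg_one, add_assoc, map_mul, mul_add,
    U.isTopHom_Δ.map_qPow hq, (isTopHom_leg₂ 0 1).map_qPow hq, hh, e,
    map_one, mul_one, mul_assoc]

/-- Coassociativity on a generator `x` with `Δ(x) = x ⊗ q^h + 1 ⊗ x` and `h` primitive. -/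
theorem coassoc_of_right {x : G} {h : FreeTop G} (hh : U.Δ h = leg 0 h + leg 1 h)
    (hx : U.comul x = tmul (gen x) (qPow q h) + tmul 1 (gen x)) :
    cls (U.tensorRel 3) (U.Δid (U.comul x)) = cls (U.tensorRel 3) (U.idΔ (U.comul x)) := by
  have e := cls_qPow_add (S := U.tensorRel 3) hq (x := leg 1 h) (y := leg 2 h)
    (U.leg_commute (by decide) _ _).eq
  rw [← (isTopHom_leg 1).map_qPow hq, ← (isTopHom_leg 2).map_qPow hq] at e
  simp only [hx, tmul, map_add, Δid_leg_zero, Δid_leg_one, idΔ_leg_zero,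
    idΔ_leg_one, Δ_gen, leg₂_leg_zero, leg₂_leg_one, add_assoc, map_mul, add_mul,
    U.isTopHom_Δ.map_qPow hq, (isTopHom_leg₂ 1 2).map_qPow hq, hh, e,
    map_one, one_mul, mul_assoc]

end HopfPresentation

theorem qPow_of_map_eq_zero {G H : Type} {φ : FreeTop G →+* FreeTop H} (hφ : IsTopHom φ)
    {q : PowerSeries Laur} (hq : PowerSeries.constantCoeff q = 1) {h : FreeTop G} (hh : φ h = 0) :
    φ (qPow q h) = 1 := by
  rw [hφ.map_qPow hq, hh, qPow_zero]

namespace GenA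

variable {q : PowerSeries Laur} (hq : PowerSeries.constantCoeff q = 1)

include hq in
theorem isCoassociative : (UqSL3 q).IsCoassociative := by
  have h12' : (UqSL3 q).Δ H12 = leg 0 H12 + leg 1 H12 := by
    rw [H12, HopfPresentation.Δ_gen]; simp only [UqSL3, comul, tmul_one, one_tmul, H12]
  have h23' : (UqSL3 q).Δ H23 = leg 0 H23 + leg 1 H23 := by
    rw [H23, HopfPresentation.Δ_gen]; simp only [UqSL3, comul, tmul_one, one_tmul, H23]
  have hn : ∀ {h : FreeTop GenA}, (UqSL3 q).Δ h = leg 0 h + leg 1 h →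
      (UqSL3 q).Δ (-h) = leg 0 (-h) + leg 1 (-h) := fun hh => by
    simp only [map_neg, hh, neg_add]
  constructor
  · rintro (_ | _ | _ | _ | _ | _)
    · exact HopfPresentation.coassoc_of_isPrimitive _ rfl
    · exact HopfPresentation.coassoc_of_isPrimitive _ rfl
    · exact HopfPresentation.coassoc_of_left _ hq (hn h12') rfl
    · exact HopfPresentation.coassoc_of_left _ hq (hn h23') rfl
    · exact HopfPresentation.coassoc_of_right _ hq h12' rfl
    · exact HopfPresentation.coassoc_of_right _ hq h23' rfl
  · have e : ∀ x : GenA, counitId GenA (leg 0 (qPow q (-gen x))) = 1 := fun x =>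
      qPow_of_map_eq_zero (isTopHom_counitId.comp (isTopHom_leg 0)) hq (by simp)
    rintro (_ | _ | _ | _ | _ | _) <;>
    simp [UqSL3, comul, tmul, H12, H23, E12, E23, E21, E32, e]
  · have e : ∀ x : GenA, idCounit GenA (leg 1 (qPow q (gen x))) = 1 := fun x =>
      qPow_of_map_eq_zero (isTopHom_idCounit.comp (isTopHom_leg 1)) hq (by simp)
    rintro (_ | _ | _ | _ | _ | _) <;>
    simp [UqSL3, comul, tmul, H12, H23, E12, E23, E21, E32, e]

end GenA

/-! ### Weights -/

section Weight

theorem cls_two_mul {G : Type} {S : Set (FreeTop G)} (x : FreeTop G) :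
    cls S (2 * x) = 2 * cls S x := by
  rw [map_mul]
  exact congrArg (· * _) (map_ofNat (cls S) 2)

theorem ring_lie_mul {R : Type*} [Ring R] (h x y : R) : ⁅h, x * y⁆ = ⁅h, x⁆ * y + x * ⁅h, y⁆ := by
  simp only [Ring.lie_def]
  noncomm_ring

theorem ring_neg_lie {R : Type*} [Ring R] (h x : R) : ⁅-h, x⁆ = -⁅h, x⁆ := by
  simp only [Ring.lie_def]
  noncomm_ring

theorem ring_add_lie {R : Type*} [Ring R] (h h' x : R) : ⁅h + h', x⁆ = ⁅h, x⁆ + ⁅h', x⁆ := by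
  simp only [Ring.lie_def]
  noncomm_ring

theorem ring_lie_sub {R : Type*} [Ring R] (h x y : R) : ⁅h, x - y⁆ = ⁅h, x⁆ - ⁅h, y⁆ := by
  simp only [Ring.lie_def]
  noncomm_ring

variable {G : Type} {S : Set (FreeTop G)} {q : PowerSeries Laur}

/-- The relation `[h, x] = n x`. -/
def HasWeight (S : Set (FreeTop G)) (h x : FreeTop G) (n : ℤ) : Prop :=
  cls S ⁅h, x⁆ = n * cls S x

namespace HasWeight

variable {h h' x y : FreeTop G} {m n : ℤ}

theorem of_mem {r : FreeTop G} (hr : r ∈ S) (h' : cls S r = cls S ⁅h, x⁆ - n * cls S x) :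
    HasWeight S h x n := by
  rw [HasWeight, ← sub_eq_zero, ← h', cls_eq_zero_of_mem hr]

theorem neg (hx : HasWeight S h x n) : HasWeight S (-h) x (-n) := by
  have e : ⁅-h, x⁆ = -⁅h, x⁆ := ring_neg_lie h x
  rw [HasWeight, e, map_neg, show cls S ⁅h, x⁆ = _ from hx]
  push_cast
  rw [neg_mul]

theorem add (hx : HasWeight S h x m) (hx' : HasWeight S h' x n) :
    HasWeight S (h + h') x (m + n) := by
  have e : ⁅h + h', x⁆ = ⁅h, x⁆ + ⁅h', x⁆ := ring_add_lie h h' x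
  rw [HasWeight, e, map_add, show cls S ⁅h, x⁆ = _ from hx, show cls S ⁅h', x⁆ = _ from hx']
  push_cast
  rw [add_mul]

theorem mul (hx : HasWeight S h x m) (hy : HasWeight S h y n) :
    HasWeight S h (x * y) (m + n) := by
  have e : ⁅h, x * y⁆ = ⁅h, x⁆ * y + x * ⁅h, y⁆ := ring_lie_mul h x y
  rw [HasWeight, e, map_add, map_mul, map_mul, show cls S ⁅h, x⁆ = _ from hx,
    show cls S ⁅h, y⁆ = _ from hy]
  push_cast
  rw [map_mul, add_mul, ← mul_assoc (cls S x), ← (Int.cast_commute n (cls S x)).eq]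
  simp only [mul_assoc]

theorem sub (hx : HasWeight S h x n) (hy : HasWeight S h y n) : HasWeight S h (x - y) n := by
  have e : ⁅h, x - y⁆ = ⁅h, x⁆ - ⁅h, y⁆ := ring_lie_sub h x y
  rw [HasWeight, e, map_sub, map_sub, show cls S ⁅h, x⁆ = _ from hx,
    show cls S ⁅h, y⁆ = _ from hy, mul_sub]

theorem smul (hx : HasWeight S h x n) (c : PowerSeries Laur) : HasWeight S h (c • x) n := by
  have e : ⁅h, c • x⁆ = c • ⁅h, x⁆ := by
    simp only [Ring.lie_def, mul_smul_comm, smul_mul_assoc, smul_sub]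
  rw [HasWeight, e, cls_smul, cls_smul, show cls S ⁅h, x⁆ = _ from hx, mul_smul_comm]

theorem qPow_mul {n : ℕ} (hx : HasWeight S h x n) (hq : PowerSeries.constantCoeff q = 1) :
    cls S (qPow q h) * cls S x = q ^ n • (cls S x * cls S (qPow q h)) :=
  cls_qPow_mul_of_lie hq n (by simpa [HasWeight] using hx)

theorem mul_qPow {n : ℕ} (hx : HasWeight S h x (-n)) (hq : PowerSeries.constantCoeff q = 1) :
    cls S x * cls S (qPow q h) = q ^ n • (cls S (qPow q h) * cls S x) :=
  cls_qPow_mul_of_lie_neg hq n (by simpa [HasWeight] using hx)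

end HasWeight

end Weight

/-! ### Commutation relations of `U_q(sl₃)` -/

namespace GenA

variable {q : PowerSeries Laur}

theorem E13_eq (q : PowerSeries Laur) : E13 q = E12 * E23 - Ring.inverse q • (E23 * E12) := rfl

theorem weight_H12_E12 : HasWeight (UqSL3 q).rel H12 E12 2 :=
  .of_mem (r := ⁅H12, E12⁆ - 2 * E12) (Or.inr (Or.inl rfl)) (by simp [cls_two_mul])

theorem weight_H12_E23 : HasWeight (UqSL3 q).rel H12 E23 (-1) :=
  .of_mem (r := ⁅H12, E23⁆ + E23) (Or.inr (Or.inr (Or.inl rfl))) (by simp)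

theorem weight_H12_E21 : HasWeight (UqSL3 q).rel H12 E21 (-2) :=
  .of_mem (r := ⁅H12, E21⁆ + 2 * E21) (Or.inr (Or.inr (Or.inr (Or.inl rfl))))
    (by simp [cls_two_mul])

theorem weight_H23_E12 : HasWeight (UqSL3 q).rel H23 E12 (-1) :=
  .of_mem (r := ⁅H23, E12⁆ + E12)
    (Or.inr (Or.inr (Or.inr (Or.inr (Or.inr (Or.inl rfl)))))) (by simp)

theorem weight_H23_E23 : HasWeight (UqSL3 q).rel H23 E23 2 :=
  .of_mem (r := ⁅H23, E23⁆ - 2 * E23)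
    (Or.inr (Or.inr (Or.inr (Or.inr (Or.inr (Or.inr (Or.inl rfl))))))) (by simp [cls_two_mul])

theorem weight_H23_E21 : HasWeight (UqSL3 q).rel H23 E21 1 :=
  .of_mem (r := ⁅H23, E21⁆ - E21)
    (Or.inr (Or.inr (Or.inr (Or.inr (Or.inr (Or.inr (Or.inr (Or.inl rfl)))))))) (by simp)

theorem weight_H12_E13 : HasWeight (UqSL3 q).rel H12 (E13 q) 1 :=
  (weight_H12_E12.mul weight_H12_E23).sub ((weight_H12_E23.mul weight_H12_E12).smul _)

theorem weight_H13_E12 : HasWeight (UqSL3 q).rel H13 E12 1 := weight_H12_E12.add weight_H23_E12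

theorem weight_H13_E21 : HasWeight (UqSL3 q).rel H13 E21 (-1) := weight_H12_E21.add weight_H23_E21

theorem weight_H13_E23 : HasWeight (UqSL3 q).rel H13 E23 1 := weight_H12_E23.add weight_H23_E23

theorem weight_H13_E13 : HasWeight (UqSL3 q).rel H13 (E13 q) 2 :=
  (weight_H13_E12.mul weight_H13_E23).sub ((weight_H13_E23.mul weight_H13_E12).smul _)

theorem H12_mul_H23 :
    cls (UqSL3 q).rel H12 * cls (UqSL3 q).rel H23 =
      cls (UqSL3 q).rel H23 * cls (UqSL3 q).rel H12 := by
  have := cls_eq_zero_of_mem (S := (UqSL3 q).rel) (f := ⁅H12, H23⁆) (Or.inl rfl)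
  rwa [Ring.lie_def, map_sub, map_mul, map_mul, sub_eq_zero] at this

theorem E21_mul_E23 :
    cls (UqSL3 q).rel E21 * cls (UqSL3 q).rel E23 =
      cls (UqSL3 q).rel E23 * cls (UqSL3 q).rel E21 := by
  have := cls_eq_zero_of_mem (S := (UqSL3 q).rel) (f := ⁅E21, E23⁆)
    (by simp only [UqSL3, rels, Set.mem_insert_iff, true_or, or_true])
  rwa [Ring.lie_def, map_sub, map_mul, map_mul, sub_eq_zero] at this

theorem E13_mul_E12 :
    cls (UqSL3 q).rel (E13 q) * cls (UqSL3 q).rel E12 =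
      Ring.inverse q • (cls (UqSL3 q).rel E12 * cls (UqSL3 q).rel (E13 q)) := by
  have := cls_eq_zero_of_mem (S := (UqSL3 q).rel)
    (f := E13 q * E12 - scal (Ring.inverse q) * (E12 * E13 q))
    (by simp only [UqSL3, rels, Set.mem_insert_iff, true_or, or_true])
  rwa [scal_mul, map_sub, map_mul, cls_smul, map_mul, sub_eq_zero] at this

variable (hq : PowerSeries.constantCoeff q = 1)
include hq

theorem smul_E12_lie_E21 :
    (q - Ring.inverse q) • (cls (UqSL3 q).rel E12 * cls (UqSL3 q).rel E21 -
      cls (UqSL3 q).rel E21 * cls (UqSL3 q).rel E12) =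
      cls (UqSL3 q).rel (qPow q H12) - cls (UqSL3 q).rel (qPow q (-H12)) := by
  have := cls_eq_zero_of_mem (S := (UqSL3 q).rel) (f := ⁅E12, E21⁆ - qNumber q H12)
    (by simp only [UqSL3, rels, Set.mem_insert_iff, true_or, or_true])
  rw [Ring.lie_def, map_sub, map_sub, map_mul, map_mul, sub_eq_zero] at this
  rw [this, ← cls_smul, smul_qNumber hq, map_sub]

theorem qPow_neg_H13 :
    cls (UqSL3 q).rel (qPow q (-H13)) =
      cls (UqSL3 q).rel (qPow q (-H12)) * cls (UqSL3 q).rel (qPow q (-H23)) := by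
  rw [H13, neg_add, cls_qPow_add hq]
  simp only [map_neg, neg_mul_neg, H12_mul_H23]

theorem inverse_smul_smul {A : Type*} [AddCommGroup A] [Module (PowerSeries Laur) A] (x : A) :
    Ring.inverse q • q • x = x := by
  rw [smul_smul, Ring.inverse_mul_cancel q (isUnit_of_constantCoeff one_ne_zero (by simp [hq])),
    one_smul]

/-- The commutator `[e₂₁, e₁₃] = e₂₃ q^(-h₁₂)`, multiplied by `q - q⁻¹`. -/
theorem smul_E21_lie_E13 :
    (q - Ring.inverse q) • (cls (UqSL3 q).rel E21 * cls (UqSL3 q).rel (E13 q) -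
      cls (UqSL3 q).rel (E13 q) * cls (UqSL3 q).rel E21) =
      (q - Ring.inverse q) • (cls (UqSL3 q).rel E23 * cls (UqSL3 q).rel (qPow q (-H12))) := by
  have h₁ := smul_E12_lie_E21 hq
  have h₂ := (weight_H12_E23 (q := q)).mul_qPow (n := 1) hq
  have h₃ := (weight_H12_E23 (q := q)).neg.qPow_mul (n := 1) hq
  have h₄ := E21_mul_E23 (q := q)
  rw [pow_one] at h₂ h₃
  rw [E13_eq, map_sub, cls_smul, map_mul, map_mul]
  set a := cls (UqSL3 q).rel E12
  set b := cls (UqSL3 q).rel E21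
  set e := cls (UqSL3 q).rel E23
  set k := cls (UqSL3 q).rel (qPow q H12)
  set k' := cls (UqSL3 q).rel (qPow q (-H12))
  set d := q - Ring.inverse q with hd
  have e₁ : b * (a * e - Ring.inverse q • (e * a)) - (a * e - Ring.inverse q • (e * a)) * b =
      -((a * b - b * a) * e) + Ring.inverse q • (e * (a * b - b * a)) := by
    have e₂ : b * (e * a) = e * (b * a) := by rw [← mul_assoc, h₄, mul_assoc]
    have e₃ : a * e * b = a * b * e := by rw [mul_assoc, ← h₄, mul_assoc]
    rw [mul_sub, sub_mul, mul_smul_comm, smul_mul_assoc, e₂, e₃, sub_mul, mul_sub, smul_sub]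
    simp only [mul_assoc]
    abel
  rw [e₁, smul_add, smul_neg, ← smul_mul_assoc, h₁, smul_comm, ← mul_smul_comm, h₁, sub_mul,
    mul_sub, h₂, h₃, smul_sub, inverse_smul_smul hq, hd, sub_smul]
  abel

/-- `q^(-h₁₂) e₁₂` commutes with `e₁₃`. -/
theorem qPow_E12_commute_E13 :
    Commute (cls (UqSL3 q).rel (qPow q (-H12)) * cls (UqSL3 q).rel E12)
      (cls (UqSL3 q).rel (E13 q)) := by
  have h₁ := (weight_H12_E13 (q := q)).neg.mul_qPow (n := 1) hq
  rw [pow_one] at h₁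
  rw [Commute, SemiconjBy, ← mul_assoc, h₁, smul_mul_assoc,
    mul_assoc (cls _ (qPow q _)) (cls _ (E13 q)), E13_mul_E12, mul_smul_comm, smul_comm,
    inverse_smul_smul hq, mul_assoc]

end GenA

/-! ### The twist `R₁` -/

namespace GenA

variable {q : PowerSeries Laur}

/-- The exponent `-(q - q⁻¹) e₂₁ ⊗ e₁₂` of `R₁`. -/
noncomputable def expR₁ (q : PowerSeries Laur) : FreeTop (Fin 2 × GenA) :=
  -(scal (q - Ring.inverse q) * tmul E21 E12)

theorem cls_expR₁ : cls ((UqSL3 q).tensorRel 2) (expR₁ q) =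
    -((q - Ring.inverse q) •
      (UqSL3 q).ten (cls (UqSL3 q).rel E21) (cls (UqSL3 q).rel E12)) := by
  rw [expR₁, scal_mul, map_neg, cls_smul, HopfPresentation.cls_tmul]

theorem R₁_eq (q : PowerSeries Laur) : R₁ q = qExp (q ^ 2) (expR₁ q) := rfl

variable (hq : PowerSeries.constantCoeff q = 1)
include hq

theorem X_dvd_sub_inverse : PowerSeries.X ∣ q - Ring.inverse q := by
  rw [PowerSeries.X_dvd_iff, map_sub, hq, sub_eq_zero]
  have h := Ring.mul_inverse_cancel q (isUnit_of_constantCoeff one_ne_zero (by simp [hq]))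
  have := congrArg PowerSeries.constantCoeff h
  rwa [map_mul, hq, one_mul, map_one, eq_comm] at this

theorem X_dvd_expR₁ : PowerSeries.X ∣ expR₁ q := by
  rw [expR₁, scal_mul]
  exact dvd_neg.2 (X_dvd_smul' (X_dvd_sub_inverse hq) _)

theorem constantCoeff_sq : PowerSeries.constantCoeff (q ^ 2) = 1 := by simp [hq]

theorem isUnit_R₁ : IsUnit (R₁ q) := isUnit_qExp (X_dvd_expR₁ hq)

/-- Conjugation by `R₁` changes the sign in the Cartan factor of `Δ(e₁₂)`: this is
`cls_qExp_mul_add` with `b = e₁₂ ⊗ 1`, `u = q^(-h₁₂) ⊗ e₁₂` and `v = q^(h₁₂) ⊗ e₁₂`. -/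
theorem R₁_mul_Δ_E12 : (UqSL3 q).Eq₂ (R₁ q * (UqSL3 q).Δ E12)
    ((tmul (qPow q H12) E12 + tmul E12 1) * R₁ q) := by
  have h₁ := smul_E12_lie_E21 hq
  have h₂ := (weight_H12_E21 (q := q)).mul_qPow (n := 2) hq
  have h₃ := (weight_H12_E21 (q := q)).neg.qPow_mul (n := 2) hq
  have hΔ : (UqSL3 q).Δ E12 = tmul (qPow q (-H12)) E12 + tmul E12 1 := by
    rw [E12, HopfPresentation.Δ_gen]; rfl
  rw [HopfPresentation.Eq₂, hΔ, map_mul, map_mul, map_add, map_add]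
  have := cls_qExp_mul_add (S := (UqSL3 q).tensorRel 2) (constantCoeff_sq hq) (X_dvd_expR₁ hq)
    (b := tmul E12 1) (u := tmul (qPow q (-H12)) E12) (v := tmul (qPow q H12) E12) ?_ ?_ ?_
  · rw [R₁_eq, add_comm, this, add_comm]
  all_goals
    simp only [cls_expR₁, HopfPresentation.cls_tmul, map_one, neg_mul, mul_neg, smul_mul_assoc,
      mul_smul_comm, HopfPresentation.ten_mul, mul_one, one_mul]
  · have := congrArg (fun x => (UqSL3 q).ten x (cls (UqSL3 q).rel E12)) h₁
    simp only [HopfPresentation.ten_smul_left, HopfPresentation.ten_sub_left, smul_sub] at this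
    rw [← sub_eq_zero, ← sub_eq_zero.2 this]
    abel
  · rw [h₂, HopfPresentation.ten_smul_left, smul_neg, smul_comm]
  · rw [h₃, HopfPresentation.ten_smul_left, smul_neg, smul_comm]

/-- The coproduct of `e₁₃` has a third term, which conjugation by `R₁` removes. -/
theorem cls_Δ_E13 : cls ((UqSL3 q).tensorRel 2) ((UqSL3 q).Δ (E13 q)) =
    (UqSL3 q).ten (cls _ (qPow q (-H13))) (cls _ (E13 q)) + (UqSL3 q).ten (cls _ (E13 q)) 1 +
      (q - Ring.inverse q) • (UqSL3 q).ten
        (cls _ E23 * cls _ (qPow q (-H12))) (cls _ E12) := by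
  have h₂ := (weight_H12_E23 (q := q)).neg.qPow_mul (n := 1) hq
  have h₃ := (weight_H23_E12 (q := q)).neg.qPow_mul (n := 1) hq
  rw [pow_one] at h₂ h₃
  have hΔ : (UqSL3 q).Δ E12 = tmul (qPow q (-H12)) E12 + tmul E12 1 := by
    rw [E12, HopfPresentation.Δ_gen]; rfl
  have hΔ' : (UqSL3 q).Δ E23 = tmul (qPow q (-H23)) E23 + tmul E23 1 := by
    rw [E23, HopfPresentation.Δ_gen]; rfl
  have hk : cls (UqSL3 q).rel (qPow q (-H23)) * cls (UqSL3 q).rel (qPow q (-H12)) =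
      cls (UqSL3 q).rel (qPow q (-H13)) := by
    rw [qPow_neg_H13 hq, ← cls_qPow_add hq, ← cls_qPow_add hq, add_comm] <;>
    simp only [map_neg, neg_mul_neg, H12_mul_H23]
  have hk' := (qPow_neg_H13 hq).symm
  rw [E13_eq, map_sub, (UqSL3 q).isTopHom_Δ.map_smul, map_mul, map_mul, hΔ, hΔ', map_sub, cls_smul]
  simp only [map_mul, map_add, map_sub, cls_smul, HopfPresentation.cls_tmul, map_one, mul_add,
    add_mul, HopfPresentation.ten_mul, mul_one, one_mul, hk, hk', h₂, h₃,
    HopfPresentation.ten_smul_left, HopfPresentation.ten_sub_left,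
    HopfPresentation.ten_sub_right, HopfPresentation.ten_smul_right, smul_add, sub_smul,
    inverse_smul_smul hq]
  abel

/-- This is `cls_qExp_mul_add` with `b = q^(-h₁₃) ⊗ e₁₃ + e₁₃ ⊗ 1`, with `u` the third term of
`Δ(e₁₃)` and `v = 0`. -/
theorem R₁_mul_Δ_E13 : (UqSL3 q).Eq₂ (R₁ q * (UqSL3 q).Δ (E13 q))
    ((tmul (qPow q (-H13)) (E13 q) + tmul (E13 q) 1) * R₁ q) := by
  have h₁ := smul_E21_lie_E13 hq
  have h₂ := (weight_H13_E21 (q := q)).neg.qPow_mul (n := 1) hq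
  have h₃ := (weight_H12_E21 (q := q)).neg.qPow_mul (n := 2) hq
  have h₄ := E13_mul_E12 (q := q)
  have h₅ := E21_mul_E23 (q := q)
  rw [pow_one] at h₂
  rw [HopfPresentation.Eq₂, map_mul, map_mul, map_add, cls_Δ_E13 hq, R₁_eq]
  -- `q^(-h₁₃) ⊗ e₁₃` commutes with `e₂₁ ⊗ e₁₂`, as the two powers of `q` cancel.
  have hc : (UqSL3 q).ten (cls _ (qPow q (-H13)) * cls _ E21) (cls _ (E13 q) * cls _ E12) =
      (UqSL3 q).ten (cls _ E21 * cls _ (qPow q (-H13))) (cls _ E12 * cls _ (E13 q)) := by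
    rw [h₂, h₄, HopfPresentation.ten_smul_left, HopfPresentation.ten_smul_right, smul_smul,
      Ring.mul_inverse_cancel q (isUnit_of_constantCoeff one_ne_zero (by simp [hq])), one_smul]
  have ca := cls_expR₁ (q := q)
  set d := q - Ring.inverse q
  set π := cls (UqSL3 q).rel
  have hlie : d • (UqSL3 q).ten (π E21 * π (E13 q)) (π E12) =
      d • (UqSL3 q).ten (π (E13 q) * π E21) (π E12) +
        d • (UqSL3 q).ten (π E23 * π (qPow q (-H12))) (π E12) := by
    have := congrArg (fun x => (UqSL3 q).ten x (π E12)) h₁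
    simp only [HopfPresentation.ten_smul_left, HopfPresentation.ten_sub_left] at this
    rw [← this, smul_sub]
    exact (add_sub_cancel _ _).symm
  have cb : cls ((UqSL3 q).tensorRel 2) (tmul (qPow q (-H13)) (E13 q) + tmul (E13 q) 1) =
      (UqSL3 q).ten (π (qPow q (-H13))) (π (E13 q)) + (UqSL3 q).ten (π (E13 q)) 1 := by
    rw [map_add, HopfPresentation.cls_tmul, HopfPresentation.cls_tmul, map_one]
  have cu : cls ((UqSL3 q).tensorRel 2) (d • tmul (E23 * qPow q (-H12)) E12) =
      d • (UqSL3 q).ten (π E23 * π (qPow q (-H12))) (π E12) := by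
    rw [cls_smul, HopfPresentation.cls_tmul, map_mul]
  have hu : cls ((UqSL3 q).tensorRel 2) (d • tmul (E23 * qPow q (-H12)) E12) *
      cls ((UqSL3 q).tensorRel 2) (expR₁ q) =
      q ^ 2 • (cls ((UqSL3 q).tensorRel 2) (expR₁ q) *
        cls ((UqSL3 q).tensorRel 2) (d • tmul (E23 * qPow q (-H12)) E12)) := by
    have : π E23 * π (qPow q (-H12)) * π E21 =
        q ^ 2 • (π E21 * (π E23 * π (qPow q (-H12)))) := by
      rw [mul_assoc, h₃, mul_smul_comm, ← mul_assoc, ← h₅, mul_assoc]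
    rw [cu, ca, mul_neg, neg_mul, smul_neg, smul_mul_smul_comm, smul_mul_smul_comm,
      HopfPresentation.ten_mul, HopfPresentation.ten_mul, this, HopfPresentation.ten_smul_left,
      smul_smul, smul_smul, mul_comm (d * d)]
  have hab : cls ((UqSL3 q).tensorRel 2) (expR₁ q) *
      cls ((UqSL3 q).tensorRel 2) (tmul (qPow q (-H13)) (E13 q) + tmul (E13 q) 1) +
      cls ((UqSL3 q).tensorRel 2) (d • tmul (E23 * qPow q (-H12)) E12) =
      cls ((UqSL3 q).tensorRel 2) (tmul (qPow q (-H13)) (E13 q) + tmul (E13 q) 1) *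
      cls ((UqSL3 q).tensorRel 2) (expR₁ q) + cls ((UqSL3 q).tensorRel 2) 0 := by
    rw [cb, cu, ca, map_zero, add_zero, neg_mul, mul_neg, smul_mul_assoc, mul_smul_comm, mul_add,
      add_mul, HopfPresentation.ten_mul, HopfPresentation.ten_mul, HopfPresentation.ten_mul,
      HopfPresentation.ten_mul, mul_one, one_mul, hc, smul_add, smul_add, hlie]
    generalize d • (UqSL3 q).ten (π E21 * π (qPow q (-H13))) (π E12 * π (E13 q)) = r₁
    generalize d • (UqSL3 q).ten (π (E13 q) * π E21) (π E12) = r₂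
    generalize d • (UqSL3 q).ten (π E23 * π (qPow q (-H12))) (π E12) = r₃
    abel
  have := cls_qExp_mul_add (S := (UqSL3 q).tensorRel 2) (constantCoeff_sq hq) (X_dvd_expR₁ hq)
    hab (by rw [map_zero, mul_zero, zero_mul, smul_zero]) hu
  rw [map_zero, add_zero, cu, cb] at this
  rw [this, ← cb, map_add]

/-- Let `a = (R₁ exponent) ⊗ 1` and `b = 1 ⊗ (R₁ exponent)`. Then `Δ ⊗ id` maps the exponent of `R₁`
to `b + u` and `id ⊗ Δ` maps it to `v + a`, where `[a, b] = v - u`. The cocycle equation is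
`E(a) E(b + u) = E(b + v) E(a) = E(b) E(v) E(a) = E(b) E(v + a)` for `E = exp_{q²}`. -/
theorem R₁_isTwist : (UqSL3 q).IsTwist (R₁ q) := by
  have hX := X_dvd_expR₁ hq
  refine ⟨(isUnit_R₁ hq).map _, ?_, ?_, ?_⟩
  · have h₁ := smul_E12_lie_E21 hq
    have h₂ := (weight_H12_E21 (q := q)).neg.qPow_mul (n := 2) hq
    have h₃ := (weight_H12_E12 (q := q)).neg.mul_qPow (n := 2) hq
    have h₄ := (weight_H12_E12 (q := q)).qPow_mul (n := 2) hq
    set d := q - Ring.inverse q with hd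
    set π := cls (UqSL3 q).rel
    let a : FreeTop (Fin 3 × GenA) := leg₂ 0 1 (expR₁ q)
    let b : FreeTop (Fin 3 × GenA) := leg₂ 1 2 (expR₁ q)
    let u : FreeTop (Fin 3 × GenA) := -(d • (leg 0 E21 * leg 1 (qPow q H12) * leg 2 E12))
    let v : FreeTop (Fin 3 × GenA) := -(d • (leg 0 E21 * leg 1 (qPow q (-H12)) * leg 2 E12))
    have ha : PowerSeries.X ∣ a := (isTopHom_leg₂ 0 1).X_dvd hX
    have hb : PowerSeries.X ∣ b := (isTopHom_leg₂ 1 2).X_dvd hX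
    have hu : PowerSeries.X ∣ u := dvd_neg.2 (X_dvd_smul' (X_dvd_sub_inverse hq) _)
    have hv : PowerSeries.X ∣ v := dvd_neg.2 (X_dvd_smul' (X_dvd_sub_inverse hq) _)
    have e₁ : (UqSL3 q).Δid (expR₁ q) = b + u := by
      have hΔ : (UqSL3 q).Δ E21 = leg 0 E21 * leg 1 (qPow q H12) + leg 1 E21 := by
        rw [E21, HopfPresentation.Δ_gen, ← one_tmul (gen e21)]; rfl
      simp only [b, u, expR₁, scal_mul, map_neg, (UqSL3 q).isTopHom_Δid.map_smul,
        (isTopHom_leg₂ 1 2).map_smul, tmul, map_mul, HopfPresentation.Δid_leg_zero,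
        HopfPresentation.Δid_leg_one, hΔ, map_add, leg₂_leg_zero, leg₂_leg_one, add_mul, smul_add,
        neg_add, ← hd]
      exact add_comm _ _
    have e₂ : (UqSL3 q).idΔ (expR₁ q) = v + a := by
      have hΔ : (UqSL3 q).Δ E12 = leg 0 (qPow q (-H12)) * leg 1 E12 + leg 0 E12 := by
        rw [E12, HopfPresentation.Δ_gen, ← tmul_one (gen e12)]; rfl
      simp only [a, v, expR₁, scal_mul, map_neg, (UqSL3 q).isTopHom_idΔ.map_smul,
        (isTopHom_leg₂ 0 1).map_smul, tmul, map_mul, HopfPresentation.idΔ_leg_zero,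
        HopfPresentation.idΔ_leg_one, hΔ, map_add, leg₂_leg_zero, leg₂_leg_one, mul_add, smul_add,
        neg_add, ← hd, mul_assoc]
    have ca : cls ((UqSL3 q).tensorRel 3) a = -(d • (UqSL3 q).ten₃ (π E21) (π E12) 1) := by
      simp only [a, expR₁, scal_mul, map_neg, (isTopHom_leg₂ 0 1).map_smul, tmul, map_mul,
        leg₂_leg_zero, leg₂_leg_one, cls_smul, HopfPresentation.ten₃, map_one, mul_one]
      rfl
    have cb : cls ((UqSL3 q).tensorRel 3) b = -(d • (UqSL3 q).ten₃ 1 (π E21) (π E12)) := by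
      simp only [b, expR₁, scal_mul, map_neg, (isTopHom_leg₂ 1 2).map_smul, tmul, map_mul,
        leg₂_leg_zero, leg₂_leg_one, cls_smul, HopfPresentation.ten₃, map_one, one_mul]
      rfl
    have cu : cls ((UqSL3 q).tensorRel 3) u =
        -(d • (UqSL3 q).ten₃ (π E21) (π (qPow q H12)) (π E12)) := by
      simp only [u, map_neg, cls_smul, HopfPresentation.ten₃, map_mul]
      rfl
    have cv : cls ((UqSL3 q).tensorRel 3) v =
        -(d • (UqSL3 q).ten₃ (π E21) (π (qPow q (-H12))) (π E12)) := by
      simp only [v, map_neg, cls_smul, HopfPresentation.ten₃, map_mul]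
      rfl
    have hQ := constantCoeff_sq hq
    have hab : cls ((UqSL3 q).tensorRel 3) a * cls ((UqSL3 q).tensorRel 3) b +
        cls ((UqSL3 q).tensorRel 3) u = cls ((UqSL3 q).tensorRel 3) b *
        cls ((UqSL3 q).tensorRel 3) a + cls ((UqSL3 q).tensorRel 3) v := by
      have := congrArg (fun x => d • (UqSL3 q).ten₃ (π E21) x (π E12)) h₁
      simp only [HopfPresentation.ten₃_smul_mid, HopfPresentation.ten₃_sub_mid, smul_sub] at this
      simp only [ca, cb, cu, cv, neg_mul_neg, smul_mul_assoc, mul_smul_comm,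
        HopfPresentation.ten₃_mul, mul_one, one_mul]
      rw [← sub_eq_zero, ← sub_eq_zero.2 this]
      abel
    have hav : cls ((UqSL3 q).tensorRel 3) a * cls ((UqSL3 q).tensorRel 3) v =
        q ^ 2 • (cls ((UqSL3 q).tensorRel 3) v * cls ((UqSL3 q).tensorRel 3) a) := by
      simp only [ca, cv, neg_mul_neg, smul_mul_assoc, mul_smul_comm,
        HopfPresentation.ten₃_mul, mul_one, one_mul]
      rw [h₃, HopfPresentation.ten₃_smul_mid, smul_comm _ (q ^ 2), smul_comm _ (q ^ 2)]
    have hua : cls ((UqSL3 q).tensorRel 3) u * cls ((UqSL3 q).tensorRel 3) a =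
        q ^ 2 • (cls ((UqSL3 q).tensorRel 3) a * cls ((UqSL3 q).tensorRel 3) u) := by
      simp only [ca, cu, neg_mul_neg, smul_mul_assoc, mul_smul_comm,
        HopfPresentation.ten₃_mul, mul_one, one_mul]
      rw [h₄, HopfPresentation.ten₃_smul_mid, smul_comm _ (q ^ 2), smul_comm _ (q ^ 2)]
    have hvb : cls ((UqSL3 q).tensorRel 3) v * cls ((UqSL3 q).tensorRel 3) b =
        q ^ 2 • (cls ((UqSL3 q).tensorRel 3) b * cls ((UqSL3 q).tensorRel 3) v) := by
      simp only [cb, cv, neg_mul_neg, smul_mul_assoc, mul_smul_comm,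
        HopfPresentation.ten₃_mul, mul_one, one_mul]
      rw [h₂, HopfPresentation.ten₃_smul_mid, smul_comm _ (q ^ 2), smul_comm _ (q ^ 2)]
    have k₁ := cls_qExp_mul_add hQ ha hab hav hua
    rw [← map_add, ← map_add] at k₁
    have k₂ := cls_mul_qExp (Q := q ^ 2) (dvd_add hb hu) (dvd_add hb hv) k₁
    rw [cls_qExp_add hQ hb hv hvb] at k₂
    have k₃ := cls_qExp_add hQ hv ha hav
    rw [R₁_eq, (isTopHom_leg₂ 0 1).map_qExp _ hX, (isTopHom_leg₂ 1 2).map_qExp _ hX,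
      (UqSL3 q).isTopHom_Δid.map_qExp _ hX, (UqSL3 q).isTopHom_idΔ.map_qExp _ hX, e₁, e₂,
      map_mul, map_mul, k₃, ← mul_assoc]
    exact k₂
  · have : counitId GenA (R₁ q) = 1 := by
      rw [R₁_eq, isTopHom_counitId.map_qExp _ hX, expR₁, map_neg, map_mul, tmul, map_mul, E21,
        leg_gen, counitId_gen, if_pos rfl, zero_mul, mul_zero, neg_zero, qExp_zero]
    rw [this, map_one]
  · have : idCounit GenA (R₁ q) = 1 := by
      rw [R₁_eq, isTopHom_idCounit.map_qExp _ hX, expR₁, map_neg, map_mul, tmul, map_mul, E12,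
        leg_gen 1, idCounit_gen, if_neg (by decide), mul_zero, mul_zero, neg_zero, qExp_zero]
    rw [this, map_one]

end GenA

/-! ### Factorization of gauged twists -/

section Factor

variable {G : Type} {S : Set (FreeTop G)} {Q P : PowerSeries Laur}

theorem cls_commute_qExp {x b : FreeTop G} (hx : PowerSeries.X ∣ x)
    (h : Commute (cls S b) (cls S x)) : Commute (cls S b) (cls S (qExp Q x)) :=
  cls_mul_qExp hx hx h

theorem cls_commute_qRatio {M z b : FreeTop G} (hz : PowerSeries.X ∣ z)
    (hM : Commute (cls S b) (cls S M)) (h : Commute (cls S b) (cls S z)) :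
    Commute (cls S b) (cls S (qRatio Q M z)) := by
  have hz' := fun n => X_pow_dvd_qRatio_term (Q := Q) M hz n
  rw [Commute, SemiconjBy, ← map_mul, ← map_mul, qRatio, mul_formalSum _ hz', formalSum_mul _ hz']
  refine cls_formalSum_congr (fun n => X_pow_dvd_mul_left _ (hz' n))
    (fun n => (hz' n).mul_right _) fun n => ?_
  rw [map_mul, map_mul, cls_smul, map_mul, map_pow, cls_qPoch]
  exact ((Commute.qPoch_right hM n).mul_right (h.pow_right n)).smul_right _

/-- The factorization of the product of `q`-exponentials that arises from `Δ(W)`, where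
`W = exp_Q x · exp_P y`. With `exp_Q x · m = m' · exp_Q x`, one has
`exp_Q x = D · exp_Q (k x)` and `exp_P y' = D' · exp_P (m' y')` for `q`-Pochhammer series
`D` and `D'`. -/
theorem cls_qRatio_mul_qExp (hQ : PowerSeries.constantCoeff Q = 1)
    (hP : PowerSeries.constantCoeff P = 1) {v w : PowerSeries Laur} (hvw : v * w = 1)
    {x x' y y' k m : FreeTop G}
    (hx : PowerSeries.X ∣ x) (hx' : PowerSeries.X ∣ x') (hy' : PowerSeries.X ∣ y')
    (hkx : Commute (cls S k) (cls S x)) (hmy' : Commute (cls S m) (cls S y'))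
    (hxm : cls S x * cls S m = w • (cls S m * cls S x))
    (hxx' : Commute (cls S x) (cls S x')) (hxy' : Commute (cls S x) (cls S y'))
    (hmx' : Commute (cls S m) (cls S x')) (hxy : Commute (cls S x') (cls S y')) :
    cls S (qRatio P (m * qRatio Q (scal v) (w • x)) y' * qRatio Q k x) *
      (cls S (qExp Q (k * x)) * cls S (qExp Q x') * cls S (qExp P (m * y')) * cls S (qExp P y)) =
    cls S (qExp P y') * cls S (qExp Q x') * cls S (qExp Q x) * cls S (qExp P y) := by
  set D := qRatio Q (scal v) (w • x) with hD
  have hwx : PowerSeries.X ∣ w • x := X_dvd_smul _ hx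
  have hs : ∀ b : FreeTop G, Commute (cls S b) (cls S (scal v)) := fun b => by
    rw [cls_scal]; exact (Commute.one_right _).smul_right _
  have hDc : ∀ b : FreeTop G, Commute (cls S b) (cls S x) → Commute (cls S b) (cls S D) :=
    fun b hb => cls_commute_qRatio hwx (hs b) (by rw [cls_smul]; exact hb.smul_right _)
  -- Moving `m` to the left of `exp_Q x` rescales `x` to `w x`; Cauchy's theorem with the scalar
  -- `v = w⁻¹` brings `exp_Q x` back.
  have hEm : cls S (qExp Q x) * cls S m = cls S (m * D) * cls S (qExp Q x) := by
    rw [← cls_mul_qExp (w := m) hwx hx (by rw [cls_smul, mul_smul_comm, hxm]),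
      cls_qExp_eq_qRatio_mul (M := scal v) hQ hwx (hs (w • x)).symm, scal_mul, smul_smul, hvw,
      one_smul, map_mul, mul_assoc]
  have hEy : Commute (cls S (qExp Q x)) (cls S y') := (cls_commute_qExp hx hxy'.symm).symm
  have hmD : Commute (cls S (m * D)) (cls S y') := by
    rw [map_mul]; exact hmy'.mul_left (hDc y' hxy'.symm).symm
  have hmDx : Commute (cls S (m * D)) (cls S x') := by
    rw [map_mul]; exact hmx'.mul_left (hDc x' hxx'.symm).symm
  have h₁ : cls S (qExp Q x) * cls S (qExp P (m * y')) =
      cls S (qExp P (m * D * y')) * cls S (qExp Q x) := by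
    refine cls_mul_qExp (X_dvd_mul_left _ hy') (X_dvd_mul_left _ hy') ?_
    rw [map_mul, map_mul (cls S) (m * D), ← mul_assoc, hEm, mul_assoc, hEy.eq, mul_assoc]
  have h₂ : Commute (cls S (qExp Q x')) (cls S (qExp P (m * D * y'))) := by
    refine cls_commute_qExp (X_dvd_mul_left _ hy') (Commute.symm ?_)
    refine cls_commute_qExp hx' ?_
    rw [map_mul]
    exact hmDx.mul_left hxy.symm
  have h₃ : Commute (cls S (qExp Q x)) (cls S (qExp Q x')) :=
    cls_commute_qExp hx' (cls_commute_qExp hx hxx'.symm).symm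
  have h₄ := cls_qExp_eq_qRatio_mul hP hy' hmD.eq
  have h₅ := cls_qExp_eq_qRatio_mul hQ hx hkx.eq
  calc _ = cls S (qRatio P (m * D) y') * (cls S (qRatio Q k x) * cls S (qExp Q (k * x))) *
        cls S (qExp Q x') * cls S (qExp P (m * y')) * cls S (qExp P y) := by
        rw [map_mul]; simp only [mul_assoc]
    _ = cls S (qRatio P (m * D) y') * (cls S (qExp Q x) * cls S (qExp Q x')) *
        cls S (qExp P (m * y')) * cls S (qExp P y) := by
        rw [← h₅]; simp only [mul_assoc]
    _ = cls S (qRatio P (m * D) y') * cls S (qExp Q x') *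
        (cls S (qExp Q x) * cls S (qExp P (m * y'))) * cls S (qExp P y) := by
        rw [h₃.eq]; simp only [mul_assoc]
    _ = cls S (qRatio P (m * D) y') * (cls S (qExp Q x') * cls S (qExp P (m * D * y'))) *
        cls S (qExp Q x) * cls S (qExp P y) := by
        rw [h₁]; simp only [mul_assoc]
    _ = (cls S (qRatio P (m * D) y') * cls S (qExp P (m * D * y'))) * cls S (qExp Q x') *
        cls S (qExp Q x) * cls S (qExp P y) := by
        rw [h₂.eq]; simp only [mul_assoc]
    _ = _ := by rw [← h₄]

end Factor

/-- The rearrangement of the eight exponentials in `F Δ(W) = (W ⊗ W) R`: `A`, `B` stand for the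
factors of `Δ(W)`, `a₀ b₀` and `a₁ b₁` for the two copies of `W`, and `r R` for `F`. -/
theorem mul_eq_of_factor {M : Type*} [Monoid M] {r R A B a₀ a₁ b₀ b₁ k m : M}
    (h : r * (k * a₁ * m * b₀) = b₁ * a₁ * a₀ * b₀) (hA : R * A = k * a₁ * R)
    (hB : R * B = m * b₀ * R) (h₁ : Commute a₀ b₁) (h₂ : Commute a₀ a₁) (h₃ : Commute b₀ a₁)
    (h₄ : Commute b₀ b₁) (h₅ : Commute a₁ b₁) :
    r * R * (A * B) = a₀ * b₀ * (a₁ * b₁) * R := by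
  calc _ = r * (R * A * B) := by simp only [mul_assoc]
    _ = r * (k * a₁ * (R * B)) := by rw [hA]; simp only [mul_assoc]
    _ = r * (k * a₁ * m * b₀) * R := by rw [hB]; simp only [mul_assoc]
    _ = b₁ * a₁ * (a₀ * b₀) * R := by rw [h]; simp only [mul_assoc]
    _ = a₁ * b₁ * (a₀ * b₀) * R := by rw [h₅.eq]
    _ = _ := by rw [((h₂.mul_right h₁).mul_left (h₃.mul_right h₄)).eq]

/-- A gauged twist `(W ⊗ W) R Δ(W⁻¹)` is determined by `F Δ(W) = (W ⊗ W) R`. -/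
theorem HopfPresentation.cls_gauge_eq {G : Type} (U : HopfPresentation G)
    {R F T : FreeTop (Fin 2 × G)} {W : FreeTop G} (hW : IsUnit W)
    (h : cls (U.tensorRel 2) (F * U.Δ W) = cls (U.tensorRel 2) (T * R)) :
    cls (U.tensorRel 2) (T * R * U.Δ (Ring.inverse W)) = cls (U.tensorRel 2) F := by
  rw [map_mul, ← h, ← map_mul, mul_assoc, ← map_mul, Ring.mul_inverse_cancel W hW, map_one, mul_one]

theorem IsTopHom.map_qExp_of_eq_zero {G H : Type} {φ : FreeTop G →+* FreeTop H} (hφ : IsTopHom φ)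
    (Q : PowerSeries Laur) {x : FreeTop G} (hX : PowerSeries.X ∣ x) (hx : φ x = 0) :
    φ (qExp Q x) = 1 := by
  rw [hφ.map_qExp _ hX, hx, qExp_zero]

theorem X_dvd_sInv_mul_tVar : PowerSeries.X ∣ sInv * tVar := Dvd.intro_left sInv rfl

namespace GenA

variable {q : PowerSeries Laur} {c : ℂ}

/-- The first exponent `c s⁻¹ t q^(-h₁₂) e₁₂` of `W_c`. -/
noncomputable def expX (q : PowerSeries Laur) (c : ℂ) : FreeTop GenA :=
  c • (scal (sInv * tVar) * (qPow q (-H12) * E12))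

/-- The second exponent `s⁻¹ t e₁₃` of `W_c`. -/
noncomputable def expY (q : PowerSeries Laur) : FreeTop GenA := scal (sInv * tVar) * E13 q

theorem expX_eq : expX q c = (cscal c * (sInv * tVar)) • (qPow q (-H12) * E12) := by
  rw [expX, scal_mul, csmul_eq, smul_smul]

theorem expY_eq : expY q = (sInv * tVar) • E13 q := rfl

theorem X_dvd_expX : PowerSeries.X ∣ expX q c := by
  rw [expX_eq]; exact X_dvd_smul' (X_dvd_sInv_mul_tVar.mul_left _) _

theorem X_dvd_expY : PowerSeries.X ∣ expY q := X_dvd_smul' X_dvd_sInv_mul_tVar _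

theorem W01_eq : W01 q c = qExp (q ^ 2) (expX q c) * qExp (q ^ 2) (expY q) := rfl

theorem isUnit_W01 : IsUnit (W01 q c) := (isUnit_qExp X_dvd_expX).mul (isUnit_qExp X_dvd_expY)

theorem map_W01_of_map_eq_zero {H : Type} {φ : FreeTop GenA →+* FreeTop H} (hφ : IsTopHom φ)
    (h : φ E12 = 0) : φ (W01 q c) = 1 := by
  rw [W01_eq, map_mul, hφ.map_qExp_of_eq_zero _ X_dvd_expX, hφ.map_qExp_of_eq_zero _ X_dvd_expY,
    one_mul]
  · rw [expY_eq, hφ.map_smul, E13_eq, map_sub, hφ.map_smul, map_mul, map_mul, h, zero_mul, mul_zero,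
      smul_zero, sub_zero, smul_zero]
  · rw [expX_eq, hφ.map_smul, map_mul, h, mul_zero, smul_zero]

variable (hq : PowerSeries.constantCoeff q = 1)
include hq

theorem F01_isTwist : (UqSL3 q).IsTwist (F01 q c) :=
  (R₁_isTwist hq).gauge (isCoassociative hq) isUnit_W01
    (map_W01_of_map_eq_zero (isTopHom_counitId.comp (isTopHom_leg 0)) (by simp [E12]))
    (map_W01_of_map_eq_zero (isTopHom_idCounit.comp (isTopHom_leg 1)) (by simp [E12]))

theorem R₁_mul_Δ_expY :
    cls ((UqSL3 q).tensorRel 2) (R₁ q) * cls ((UqSL3 q).tensorRel 2) ((UqSL3 q).Δ (expY q)) =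
    cls ((UqSL3 q).tensorRel 2) (leg 0 (qPow q (-H13)) * leg 1 (expY q) + leg 0 (expY q)) *
      cls ((UqSL3 q).tensorRel 2) (R₁ q) := by
  have h : cls ((UqSL3 q).tensorRel 2) _ = cls ((UqSL3 q).tensorRel 2) _ := R₁_mul_Δ_E13 hq
  rw [map_mul, map_mul, tmul_one, tmul] at h
  rw [expY_eq, (UqSL3 q).isTopHom_Δ.map_smul, (isTopHom_leg 0).map_smul,
    (isTopHom_leg 1).map_smul, mul_smul_comm, ← smul_add, cls_smul, cls_smul, mul_smul_comm, h,
    smul_mul_assoc]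

theorem Δ_qPow_neg_H12 : cls ((UqSL3 q).tensorRel 2) ((UqSL3 q).Δ (qPow q (-H12))) =
    (UqSL3 q).ten (cls _ (qPow q (-H12))) (cls _ (qPow q (-H12))) := by
  rw [(UqSL3 q).isTopHom_Δ.map_qPow hq, ← HopfPresentation.cls_tmul, tmul, map_mul,
    (isTopHom_leg 0).map_qPow hq, (isTopHom_leg 1).map_qPow hq, ← cls_qPow_add hq]
  · rw [H12, map_neg, HopfPresentation.Δ_gen, map_neg, map_neg, ← neg_add]
    simp only [UqSL3, comul, tmul_one, one_tmul, H12]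
  · exact ((UqSL3 q).leg_commute zero_ne_one _ _).symm.eq

/-- Since `R₁` commutes with `Δ(q^(-h₁₂))`, the formula for `R₁ Δ(e₁₂) R₁⁻¹` applies to
`q^(-h₁₂) e₁₂`. -/
theorem R₁_mul_Δ_expX :
    cls ((UqSL3 q).tensorRel 2) (R₁ q) * cls ((UqSL3 q).tensorRel 2) ((UqSL3 q).Δ (expX q c)) =
    cls ((UqSL3 q).tensorRel 2) (leg 1 (qPow q (-H12)) * leg 0 (expX q c) + leg 1 (expX q c)) *
      cls ((UqSL3 q).tensorRel 2) (R₁ q) := by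
  have h : cls ((UqSL3 q).tensorRel 2) _ = cls ((UqSL3 q).tensorRel 2) _ := R₁_mul_Δ_E12 hq
  have h₁ := (weight_H12_E21 (q := q)).neg.qPow_mul (n := 2) hq
  have h₂ := (weight_H12_E12 (q := q)).neg.mul_qPow (n := 2) hq
  have hk := cls_qPow_neg_mul (S := (UqSL3 q).rel) hq H12
  have hc : Commute (cls ((UqSL3 q).tensorRel 2) ((UqSL3 q).Δ (qPow q (-H12))))
      (cls ((UqSL3 q).tensorRel 2) (R₁ q)) := by
    refine cls_commute_qExp (X_dvd_expR₁ hq) ?_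
    change Commute _ (cls ((UqSL3 q).tensorRel 2) (expR₁ q))
    rw [cls_expR₁, Δ_qPow_neg_H12 hq]
    refine (Commute.smul_right ?_ _).neg_right
    rw [Commute, SemiconjBy, HopfPresentation.ten_mul, HopfPresentation.ten_mul, h₁, h₂,
      HopfPresentation.ten_smul_left, HopfPresentation.ten_smul_right]
  rw [map_mul, map_mul, tmul_one] at h
  rw [expX_eq, (UqSL3 q).isTopHom_Δ.map_smul, (isTopHom_leg 0).map_smul,
    (isTopHom_leg 1).map_smul, mul_smul_comm, ← smul_add, cls_smul, cls_smul, mul_smul_comm,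
    smul_mul_assoc, map_mul, map_mul, ← mul_assoc (cls _ (R₁ q)), ← hc.eq, mul_assoc, h,
    ← mul_assoc (cls _ ((UqSL3 q).Δ _))]
  congr 2
  rw [Δ_qPow_neg_H12 hq, map_add, map_add, HopfPresentation.cls_tmul, mul_add, map_mul,
    HopfPresentation.cls_leg_zero, HopfPresentation.cls_leg_zero, HopfPresentation.cls_leg_one,
    HopfPresentation.cls_leg_one, HopfPresentation.ten_mul, HopfPresentation.ten_mul,
    HopfPresentation.ten_mul, hk, map_mul, one_mul, mul_one, add_comm]

/-- The product of `q`-Pochhammer series that represents `F_{q,c} R₁⁻¹`. -/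
noncomputable def ratio01 (q : PowerSeries Laur) (c : ℂ) : FreeTop (Fin 2 × GenA) :=
  qRatio (q ^ 2) (leg 0 (qPow q (-H13)) * qRatio (q ^ 2) (scal (Ring.inverse q))
    (q • leg 0 (expX q c))) (leg 1 (expY q)) *
  qRatio (q ^ 2) (leg 1 (qPow q (-H12))) (leg 0 (expX q c))

/-- The twist `F_{q,c}` as a product of `q`-Pochhammer series and `R₁`; here `k = 1 ⊗ q^(-h₁₂)` and
`m = q^(-h₁₃) ⊗ 1` in `cls_qRatio_mul_qExp`. -/
theorem cls_F01 : cls ((UqSL3 q).tensorRel 2) (F01 q c) =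
    cls ((UqSL3 q).tensorRel 2) (ratio01 q c * R₁ q) := by
  refine HopfPresentation.cls_gauge_eq _ isUnit_W01 ?_
  have hQ := constantCoeff_sq hq
  have hX := X_dvd_expX (q := q) (c := c)
  have hY := X_dvd_expY (q := q)
  have hX₀ := (isTopHom_leg (n := 2) 0).X_dvd hX
  have hX₁ := (isTopHom_leg (n := 2) 1).X_dvd hX
  have hY₀ := (isTopHom_leg (n := 2) 0).X_dvd hY
  have hY₁ := (isTopHom_leg (n := 2) 1).X_dvd hY
  have hc := fun x y => (UqSL3 q).leg_commute (n := 2) zero_ne_one x y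
  have hk : ∀ h h' : FreeTop GenA, cls (UqSL3 q).rel h * cls (UqSL3 q).rel h' =
      cls (UqSL3 q).rel h' * cls (UqSL3 q).rel h →
      Commute (cls (UqSL3 q).rel (qPow q h)) (cls (UqSL3 q).rel (qPow q h')) := fun h h' e => by
    exact cls_mul_qPow hq (cls_mul_qPow hq e.symm).symm
  have hx₂ : cls (UqSL3 q).rel (expX q c) * cls (UqSL3 q).rel (qPow q (-H12)) =
      q ^ 2 • (cls (UqSL3 q).rel (qPow q (-H12)) * cls (UqSL3 q).rel (expX q c)) := by
    have := (weight_H12_E12 (q := q)).neg.mul_qPow (n := 2) hq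
    rw [expX_eq, cls_smul, map_mul, smul_mul_assoc, mul_assoc, this, mul_smul_comm, smul_comm,
      mul_smul_comm]
  have hx₁ : cls (UqSL3 q).rel (expX q c) * cls (UqSL3 q).rel (qPow q (-H13)) =
      q • (cls (UqSL3 q).rel (qPow q (-H13)) * cls (UqSL3 q).rel (expX q c)) := by
    have := (weight_H13_E12 (q := q)).neg.mul_qPow (n := 1) hq
    have h' := hk (-H12) (-H13) (by
      simp only [map_neg, neg_mul_neg, H13, map_add, mul_add, add_mul, H12_mul_H23])
    rw [pow_one] at this
    rw [expX_eq, cls_smul, map_mul, smul_mul_assoc, mul_assoc, this, mul_smul_comm,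
      ← mul_assoc (cls _ (qPow q (-H12))), h'.eq, smul_comm, mul_smul_comm, mul_assoc]
  have hy₂ : cls (UqSL3 q).rel (expY q) * cls (UqSL3 q).rel (qPow q (-H13)) =
      q ^ 2 • (cls (UqSL3 q).rel (qPow q (-H13)) * cls (UqSL3 q).rel (expY q)) := by
    have := (weight_H13_E13 (q := q)).neg.mul_qPow (n := 2) hq
    rw [expY_eq, cls_smul, smul_mul_assoc, this, smul_comm, mul_smul_comm]
  have hxy : Commute (cls (UqSL3 q).rel (expX q c)) (cls (UqSL3 q).rel (expY q)) := by
    rw [expX_eq, expY_eq, cls_smul, cls_smul, map_mul]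
    exact ((qPow_E12_commute_E13 hq).smul_left _).smul_right _
  have hxy₁ : Commute (cls ((UqSL3 q).tensorRel 2) (leg 1 (expX q c)))
      (cls ((UqSL3 q).tensorRel 2) (leg 1 (expY q))) := by
    rw [← HopfPresentation.legHom_cls, ← HopfPresentation.legHom_cls]
    exact hxy.map _
  have key := cls_qRatio_mul_qExp (S := (UqSL3 q).tensorRel 2) hQ hQ
    (Ring.inverse_mul_cancel q (isUnit_of_constantCoeff one_ne_zero (by simp [hq])))
    (x := leg 0 (expX q c)) (x' := leg 1 (expX q c)) (y := leg 0 (expY q)) (y' := leg 1 (expY q))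
    (k := leg 1 (qPow q (-H12))) (m := leg 0 (qPow q (-H13)))
    hX₀ hX₁ hY₁ (hc _ _).symm (hc _ _)
    (by rw [HopfPresentation.cls_leg_zero, HopfPresentation.cls_leg_zero,
          HopfPresentation.ten_mul, HopfPresentation.ten_mul, hx₁, HopfPresentation.ten_smul_left])
    (hc _ _) (hc _ _) (hc _ _) hxy₁
  have e₁ : cls ((UqSL3 q).tensorRel 2)
        (qExp (q ^ 2) (leg 1 (qPow q (-H12)) * leg 0 (expX q c) + leg 1 (expX q c))) =
      cls ((UqSL3 q).tensorRel 2) (qExp (q ^ 2) (leg 1 (qPow q (-H12)) * leg 0 (expX q c))) *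
      cls ((UqSL3 q).tensorRel 2) (qExp (q ^ 2) (leg 1 (expX q c))) := by
    refine cls_qExp_add hQ (X_dvd_mul_left _ hX₀) hX₁ ?_
    rw [map_mul, HopfPresentation.cls_leg_zero, HopfPresentation.cls_leg_one,
      HopfPresentation.cls_leg_one, HopfPresentation.ten_mul, HopfPresentation.ten_mul,
      HopfPresentation.ten_mul]
    simp only [one_mul, mul_one]
    rw [hx₂, HopfPresentation.ten_smul_right]
  have e₂ : cls ((UqSL3 q).tensorRel 2)
        (qExp (q ^ 2) (leg 0 (qPow q (-H13)) * leg 1 (expY q) + leg 0 (expY q))) =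
      cls ((UqSL3 q).tensorRel 2) (qExp (q ^ 2) (leg 0 (qPow q (-H13)) * leg 1 (expY q))) *
      cls ((UqSL3 q).tensorRel 2) (qExp (q ^ 2) (leg 0 (expY q))) := by
    refine cls_qExp_add hQ (X_dvd_mul_left _ hY₁) hY₀ ?_
    rw [map_mul, HopfPresentation.cls_leg_zero, HopfPresentation.cls_leg_zero,
      HopfPresentation.cls_leg_one, HopfPresentation.ten_mul, HopfPresentation.ten_mul,
      HopfPresentation.ten_mul]
    simp only [one_mul, mul_one]
    rw [hy₂, HopfPresentation.ten_smul_left]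
  have hΔX := (UqSL3 q).isTopHom_Δ.X_dvd hX
  have hΔY := (UqSL3 q).isTopHom_Δ.X_dvd hY
  have f₁ := cls_mul_qExp (Q := q ^ 2) hΔX (dvd_add (X_dvd_mul_left _ hX₀) hX₁) (R₁_mul_Δ_expX hq)
  have f₂ := cls_mul_qExp (Q := q ^ 2) hΔY (dvd_add (X_dvd_mul_left _ hY₁) hY₀) (R₁_mul_Δ_expY hq)
  have f₃ := hc (qExp (q ^ 2) (expX q c)) (qExp (q ^ 2) (expY q))
  have f₄ := hc (qExp (q ^ 2) (expX q c)) (qExp (q ^ 2) (expX q c))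
  have f₅ := hc (qExp (q ^ 2) (expY q)) (qExp (q ^ 2) (expX q c))
  have f₆ := hc (qExp (q ^ 2) (expY q)) (qExp (q ^ 2) (expY q))
  rw [(isTopHom_leg 0).map_qExp _ hX, (isTopHom_leg 1).map_qExp _ hY] at f₃
  rw [(isTopHom_leg 0).map_qExp _ hX, (isTopHom_leg 1).map_qExp _ hX] at f₄
  rw [(isTopHom_leg 0).map_qExp _ hY, (isTopHom_leg 1).map_qExp _ hX] at f₅
  rw [(isTopHom_leg 0).map_qExp _ hY, (isTopHom_leg 1).map_qExp _ hY] at f₆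
  have f₇ : Commute (cls ((UqSL3 q).tensorRel 2) (qExp (q ^ 2) (leg 1 (expX q c))))
      (cls ((UqSL3 q).tensorRel 2) (qExp (q ^ 2) (leg 1 (expY q)))) :=
    (cls_commute_qExp hX₁ (cls_commute_qExp hY₁ hxy₁).symm).symm
  rw [map_mul, map_mul, ratio01, map_mul, W01_eq, tmul, map_mul (UqSL3 q).Δ, map_mul (leg 0),
    map_mul (leg 1), (UqSL3 q).isTopHom_Δ.map_qExp _ hX, (UqSL3 q).isTopHom_Δ.map_qExp _ hY,
    (isTopHom_leg 0).map_qExp _ hX, (isTopHom_leg 0).map_qExp _ hY,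
    (isTopHom_leg 1).map_qExp _ hX, (isTopHom_leg 1).map_qExp _ hY, map_mul, map_mul, map_mul,
    map_mul]
  rw [e₁] at f₁
  rw [e₂] at f₂
  rw [map_mul] at key
  exact mul_eq_of_factor key f₁ f₂ f₃ f₄ f₅ f₆ f₇

end GenA

/-! ### The coboundary twists of `U_q(A₂⁽²⁾)` -/

theorem cls_four_mul {G : Type} {S : Set (FreeTop G)} (x : FreeTop G) :
    cls S (4 * x) = 4 * cls S x := by
  rw [map_mul]
  exact congrArg (· * _) (map_ofNat (cls S) 4)

theorem HasWeight.csmul {G : Type} {S : Set (FreeTop G)} {h x : FreeTop G} {n m : ℤ} {c : ℂ}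
    (hx : HasWeight S h x n) (hm : c * n = m) : HasWeight S (c • h) x m := by
  have e : ⁅c • h, x⁆ = cscal c • ⁅h, x⁆ := by
    rw [csmul_eq]
    simp only [Ring.lie_def, mul_smul_comm, smul_mul_assoc, smul_sub]
  rw [HasWeight, e, cls_smul, show cls S ⁅h, x⁆ = _ from hx, ← smul_mul_assoc]
  congr 1
  have h₁ : cscal c * (n : PowerSeries Laur) = m := by
    rw [cscal, ← map_intCast (PowerSeries.C (R := Laur)), ← map_intCast (algebraMap ℂ Laur),
      ← map_mul, ← map_mul, hm, map_intCast, map_intCast]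
  have h₂ : ∀ k : ℤ, (k : Presented S) = (k : PowerSeries Laur) • (1 : Presented S) := fun k => by
    rw [Int.cast_smul_eq_zsmul, zsmul_one]
  rw [h₂, smul_smul, h₁, ← h₂]

namespace GenB

variable {q : PowerSeries Laur}

theorem weight_Hα_Eα : HasWeight (UqA22 q).rel Hα Eα 2 :=
  .of_mem (r := ⁅Hα, Eα⁆ - 2 * Eα) (Or.inl rfl) (by simp [cls_two_mul])

theorem weight_Hα_Fδ : HasWeight (UqA22 q).rel Hα Fδ 4 :=
  .of_mem (r := ⁅Hα, Fδ⁆ - 4 * Fδ) (Or.inr (Or.inr (Or.inr (Or.inl rfl)))) (by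
    simp [cls_four_mul])

theorem weight_halfH_Eα : HasWeight (UqA22 q).rel halfH Eα 1 :=
  weight_Hα_Eα.csmul (by norm_num)

theorem Eα_commute_Fδ : Commute (cls (UqA22 q).rel Eα) (cls (UqA22 q).rel Fδ) := by
  have := cls_eq_zero_of_mem (S := (UqA22 q).rel) (f := ⁅Eα, Fδ⁆)
    (by simp only [UqA22, rels, Set.mem_insert_iff, true_or, or_true])
  rwa [Ring.lie_def, map_sub, map_mul, map_mul, sub_eq_zero] at this

theorem Δ_Hα : (UqA22 q).Δ Hα = leg 0 Hα + leg 1 Hα := by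
  rw [Hα, HopfPresentation.Δ_gen]; simp only [UqA22, comul, tmul_one, one_tmul, Hα]

theorem Δ_halfH : (UqA22 q).Δ halfH = leg 0 halfH + leg 1 halfH := by
  simp only [halfH, (UqA22 q).isTopHom_Δ.map_csmul, (isTopHom_leg _).map_csmul, Δ_Hα, smul_add]

theorem Δ_Eα : (UqA22 q).Δ Eα = leg 0 (qPow q (-halfH)) * leg 1 Eα + leg 0 Eα := by
  rw [Eα, HopfPresentation.Δ_gen, ← tmul_one (gen e)]; rfl

theorem Δ_Fδ : (UqA22 q).Δ Fδ = leg 0 Fδ * leg 1 (qPow q (-Hα)) + leg 1 Fδ := by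
  rw [Fδ, HopfPresentation.Δ_gen, ← one_tmul (gen f₀)]; rfl

theorem isCoassociative (hq : PowerSeries.constantCoeff q = 1) :
    (UqA22 q).IsCoassociative := by
  have hn : ∀ {h : FreeTop GenB}, (UqA22 q).Δ h = leg 0 h + leg 1 h →
      (UqA22 q).Δ (-h) = leg 0 (-h) + leg 1 (-h) := fun hh => by
    simp only [map_neg, hh, neg_add]
  have e₀ : ∀ x : FreeTop GenB, counitId GenB (leg 0 x) = 0 →
      counitId GenB (leg 0 (qPow q x)) = 1 := fun x hx =>
    qPow_of_map_eq_zero (isTopHom_counitId.comp (isTopHom_leg 0)) hq hx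
  have e₁ : ∀ x : FreeTop GenB, idCounit GenB (leg 1 x) = 0 →
      idCounit GenB (leg 1 (qPow q x)) = 1 := fun x hx =>
    qPow_of_map_eq_zero (isTopHom_idCounit.comp (isTopHom_leg 1)) hq hx
  have c₀ : counitId GenB (leg 0 Hα) = 0 := by simp [Hα]
  have c₁ : idCounit GenB (leg 1 Hα) = 0 := by simp [Hα]
  have d₀ : counitId GenB (leg 0 halfH) = 0 := by
    rw [halfH, (isTopHom_leg 0).map_csmul, isTopHom_counitId.map_csmul, c₀, smul_zero]
  have d₁ : idCounit GenB (leg 1 halfH) = 0 := by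
    rw [halfH, (isTopHom_leg 1).map_csmul, isTopHom_idCounit.map_csmul, c₁, smul_zero]
  constructor
  · rintro (_ | _ | _ | _ | _)
    · exact HopfPresentation.coassoc_of_isPrimitive _ rfl
    · exact HopfPresentation.coassoc_of_left _ hq (hn Δ_halfH) rfl
    · exact HopfPresentation.coassoc_of_right _ hq Δ_halfH rfl
    · exact HopfPresentation.coassoc_of_left _ hq Δ_Hα rfl
    · exact HopfPresentation.coassoc_of_right _ hq (hn Δ_Hα) rfl
  · have a₁ := e₀ (-halfH) (by rw [map_neg, map_neg, d₀, neg_zero])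
    have a₂ := e₀ Hα c₀
    rintro (_ | _ | _ | _ | _) <;>
    simp [UqA22, comul, tmul, Eα, Fα, Eδ, Fδ, a₁, a₂]
    simp [Hα]
  · have a₁ := e₁ halfH d₁
    have a₂ := e₁ (-Hα) (by rw [map_neg, map_neg, c₁, neg_zero])
    rintro (_ | _ | _ | _ | _) <;>
    simp [UqA22, comul, tmul, Eα, Fα, Eδ, Fδ, a₁, a₂]
    simp [Hα]

theorem constantCoeff_pow (hq : PowerSeries.constantCoeff q = 1) (n : ℕ) :
    PowerSeries.constantCoeff (q ^ n) = 1 := by simp [hq]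

/-- The first exponent `s⁻¹ t e_α` of `W`. -/
noncomputable def expE : FreeTop GenB := scal (sInv * tVar) * Eα

/-- The second exponent `s⁻¹ t e_{-δ+2α}` of `W`. -/
noncomputable def expF : FreeTop GenB := scal (sInv * tVar) * Fδ

/-- The exponent `-2 t³ e_α e_{-δ+2α}` of the factor of `W'`. -/
noncomputable def expV : FreeTop GenB := -2 * (scal (tVar ^ 3) * (Eα * Fδ))

theorem expE_eq : expE = (sInv * tVar) • Eα := rfl
theorem expF_eq : expF = (sInv * tVar) • Fδ := rfl

theorem X_dvd_expE : PowerSeries.X ∣ expE := X_dvd_smul' X_dvd_sInv_mul_tVar _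
theorem X_dvd_expF : PowerSeries.X ∣ expF := X_dvd_smul' X_dvd_sInv_mul_tVar _
theorem X_dvd_expV : PowerSeries.X ∣ expV :=
  X_dvd_mul_left _ (X_dvd_smul' (dvd_pow_self _ three_ne_zero) _)

theorem W11_eq : W11 q = qExp q expE * qExp (q ^ 4) expF := rfl
theorem W11'_eq : W11' q = qExp 1 expV * W11 q := by rw [W11', texp_eq_qExp]; rfl

theorem isUnit_W11 : IsUnit (W11 q) := (isUnit_qExp X_dvd_expE).mul (isUnit_qExp X_dvd_expF)
theorem isUnit_W11' : IsUnit (W11' q) := by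
  rw [W11'_eq]; exact (isUnit_qExp X_dvd_expV).mul isUnit_W11

theorem map_W11_of_map_eq_zero {H : Type} {φ : FreeTop GenB →+* FreeTop H} (hφ : IsTopHom φ)
    (h : φ Eα = 0) (h' : φ Fδ = 0) : φ (W11 q) = 1 := by
  rw [W11_eq, map_mul, hφ.map_qExp_of_eq_zero _ X_dvd_expE, hφ.map_qExp_of_eq_zero _ X_dvd_expF,
    one_mul]
  · rw [expF_eq, hφ.map_smul, h', smul_zero]
  · rw [expE_eq, hφ.map_smul, h, smul_zero]

theorem map_W11'_of_map_eq_zero {H : Type} {φ : FreeTop GenB →+* FreeTop H} (hφ : IsTopHom φ)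
    (h : φ Eα = 0) (h' : φ Fδ = 0) : φ (W11' q) = 1 := by
  rw [W11'_eq, map_mul, hφ.map_qExp_of_eq_zero _ X_dvd_expV, map_W11_of_map_eq_zero hφ h h',
    one_mul]
  rw [expV, map_mul, map_mul, map_mul, h, zero_mul, mul_zero, mul_zero]

theorem coboundary_isTwist (hq : PowerSeries.constantCoeff q = 1)
    {W : FreeTop GenB} (hW : IsUnit W) (h₀ : counitId GenB (leg 0 W) = 1)
    (h₁ : idCounit GenB (leg 1 W) = 1) : (UqA22 q).IsTwist (coboundary q W) := by
  have := HopfPresentation.IsTwist.gauge (HopfPresentation.isTwist_one (UqA22 q))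
    (isCoassociative hq) hW h₀ h₁
  rwa [mul_one] at this

theorem coboundary_W11_isTwist (hq : PowerSeries.constantCoeff q = 1) :
    (UqA22 q).IsTwist (coboundary q (W11 q)) :=
  coboundary_isTwist hq isUnit_W11
    (map_W11_of_map_eq_zero (isTopHom_counitId.comp (isTopHom_leg 0)) (by simp [Eα]) (by simp [Fδ]))
    (map_W11_of_map_eq_zero (isTopHom_idCounit.comp (isTopHom_leg 1)) (by simp [Eα]) (by simp [Fδ]))

theorem coboundary_W11'_isTwist (hq : PowerSeries.constantCoeff q = 1) :
    (UqA22 q).IsTwist (coboundary q (W11' q)) :=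
  coboundary_isTwist hq isUnit_W11'
    (map_W11'_of_map_eq_zero (isTopHom_counitId.comp (isTopHom_leg 0)) (by simp [Eα])
      (by simp [Fδ]))
    (map_W11'_of_map_eq_zero (isTopHom_idCounit.comp (isTopHom_leg 1)) (by simp [Eα])
      (by simp [Fδ]))

/-- The product of `q`-Pochhammer series that represents `F_q`. -/
noncomputable def ratio11 (q : PowerSeries Laur) : FreeTop (Fin 2 × GenB) :=
  qRatio (q ^ 4) (leg 1 (qPow q (-Hα)) * qRatio q (scal (Ring.inverse q ^ 2))
    (q ^ 2 • leg 1 expE)) (leg 0 expF) * qRatio q (leg 0 (qPow q (-halfH))) (leg 1 expE)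

theorem Δ_expE : cls ((UqA22 q).tensorRel 2) ((UqA22 q).Δ expE) =
    cls ((UqA22 q).tensorRel 2) (leg 0 (qPow q (-halfH)) * leg 1 expE + leg 0 expE) := by
  rw [expE_eq, (UqA22 q).isTopHom_Δ.map_smul, (isTopHom_leg 0).map_smul,
    (isTopHom_leg 1).map_smul, mul_smul_comm, ← smul_add, Δ_Eα]

theorem Δ_expF : cls ((UqA22 q).tensorRel 2) ((UqA22 q).Δ expF) =
    cls ((UqA22 q).tensorRel 2) (leg 1 (qPow q (-Hα)) * leg 0 expF + leg 1 expF) := by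
  rw [expF_eq, (UqA22 q).isTopHom_Δ.map_smul, (isTopHom_leg 0).map_smul,
    (isTopHom_leg 1).map_smul, mul_smul_comm, ← smul_add, Δ_Fδ, cls_smul, cls_smul, map_add,
    map_add, map_mul, map_mul, ((UqA22 q).leg_commute zero_ne_one _ _).eq]

theorem expE_commute_expF : Commute (cls (UqA22 q).rel expE) (cls (UqA22 q).rel expF) := by
  rw [expE_eq, expF_eq, cls_smul, cls_smul]
  exact (Eα_commute_Fδ.smul_left _).smul_right _

/-- Here `k = q^(-h_α/2) ⊗ 1` and `m = 1 ⊗ q^(-h_α)` in `cls_qRatio_mul_qExp`. The tensor factors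
are interchanged in comparison with `GenA.cls_F01`, because `Δ(e_{-δ+2α})` has its Cartan factor
on the right. -/
theorem cls_coboundary_W11 (hq : PowerSeries.constantCoeff q = 1) :
    cls ((UqA22 q).tensorRel 2) (coboundary q (W11 q)) =
    cls ((UqA22 q).tensorRel 2) (ratio11 q) := by
  have hE := X_dvd_expE
  have hF := X_dvd_expF
  have hE₀ := (isTopHom_leg (n := 2) 0).X_dvd hE
  have hE₁ := (isTopHom_leg (n := 2) 1).X_dvd hE
  have hF₀ := (isTopHom_leg (n := 2) 0).X_dvd hF
  have hF₁ := (isTopHom_leg (n := 2) 1).X_dvd hF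
  have hc := fun x y => (UqA22 q).leg_commute (n := 2) zero_ne_one x y
  have hk : cls (UqA22 q).rel expE * cls (UqA22 q).rel (qPow q (-halfH)) =
      q • (cls (UqA22 q).rel (qPow q (-halfH)) * cls (UqA22 q).rel expE) := by
    have := (weight_halfH_Eα (q := q)).neg.mul_qPow (n := 1) hq
    rw [pow_one] at this
    rw [expE_eq, cls_smul, smul_mul_assoc, this, smul_comm, mul_smul_comm]
  have hm : cls (UqA22 q).rel expE * cls (UqA22 q).rel (qPow q (-Hα)) =
      q ^ 2 • (cls (UqA22 q).rel (qPow q (-Hα)) * cls (UqA22 q).rel expE) := by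
    have := (weight_Hα_Eα (q := q)).neg.mul_qPow (n := 2) hq
    rw [expE_eq, cls_smul, smul_mul_assoc, this, smul_comm, mul_smul_comm]
  have hm' : cls (UqA22 q).rel expF * cls (UqA22 q).rel (qPow q (-Hα)) =
      q ^ 4 • (cls (UqA22 q).rel (qPow q (-Hα)) * cls (UqA22 q).rel expF) := by
    have := (weight_Hα_Fδ (q := q)).neg.mul_qPow (n := 4) hq
    rw [expF_eq, cls_smul, smul_mul_assoc, this, smul_comm, mul_smul_comm]
  have hEF : ∀ k : Fin 2, Commute (cls ((UqA22 q).tensorRel 2) (leg k expE))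
      (cls ((UqA22 q).tensorRel 2) (leg k expF)) := fun k => by
    rw [← HopfPresentation.legHom_cls, ← HopfPresentation.legHom_cls]
    exact expE_commute_expF.map _
  have hv : Ring.inverse q ^ 2 * q ^ 2 = 1 := by
    rw [← mul_pow, Ring.inverse_mul_cancel q (isUnit_of_constantCoeff one_ne_zero (by simp [hq])),
      one_pow]
  have key := cls_qRatio_mul_qExp (S := (UqA22 q).tensorRel 2) hq (constantCoeff_pow hq 4) hv
    (x := leg 1 expE) (x' := leg 0 expE) (y := leg 1 expF) (y' := leg 0 expF)
    (k := leg 0 (qPow q (-halfH))) (m := leg 1 (qPow q (-Hα)))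
    hE₁ hE₀ hF₀ (hc _ _) (hc _ _).symm
    (by rw [HopfPresentation.cls_leg_one, HopfPresentation.cls_leg_one,
          HopfPresentation.ten_mul, HopfPresentation.ten_mul, hm, HopfPresentation.ten_smul_right])
    (hc _ _).symm (hc _ _).symm (hc _ _).symm (hEF 0)
  have e₁ : cls ((UqA22 q).tensorRel 2)
        (qExp q (leg 0 (qPow q (-halfH)) * leg 1 expE + leg 0 expE)) =
      cls ((UqA22 q).tensorRel 2) (qExp q (leg 0 (qPow q (-halfH)) * leg 1 expE)) *
      cls ((UqA22 q).tensorRel 2) (qExp q (leg 0 expE)) := by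
    refine cls_qExp_add hq (X_dvd_mul_left _ hE₁) hE₀ ?_
    rw [map_mul, HopfPresentation.cls_leg_zero, HopfPresentation.cls_leg_zero,
      HopfPresentation.cls_leg_one, HopfPresentation.ten_mul, HopfPresentation.ten_mul,
      HopfPresentation.ten_mul]
    simp only [one_mul, mul_one]
    rw [hk, HopfPresentation.ten_smul_left]
  have e₂ : cls ((UqA22 q).tensorRel 2)
        (qExp (q ^ 4) (leg 1 (qPow q (-Hα)) * leg 0 expF + leg 1 expF)) =
      cls ((UqA22 q).tensorRel 2) (qExp (q ^ 4) (leg 1 (qPow q (-Hα)) * leg 0 expF)) *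
      cls ((UqA22 q).tensorRel 2) (qExp (q ^ 4) (leg 1 expF)) := by
    refine cls_qExp_add (constantCoeff_pow hq 4) (X_dvd_mul_left _ hF₀) hF₁ ?_
    rw [map_mul, HopfPresentation.cls_leg_zero, HopfPresentation.cls_leg_one,
      HopfPresentation.cls_leg_one, HopfPresentation.ten_mul, HopfPresentation.ten_mul,
      HopfPresentation.ten_mul]
    simp only [one_mul, mul_one]
    rw [hm', HopfPresentation.ten_smul_right]
  have hΔE := (UqA22 q).isTopHom_Δ.X_dvd hE
  have hΔF := (UqA22 q).isTopHom_Δ.X_dvd hF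
  have f₁ := cls_qExp_congr (Q := q) hΔE (dvd_add (X_dvd_mul_left _ hE₁) hE₀) (Δ_expE (q := q))
  have f₂ := cls_qExp_congr (Q := q ^ 4) hΔF (dvd_add (X_dvd_mul_left _ hF₀) hF₁) (Δ_expF (q := q))
  have f₃ := hc (qExp (q ^ 4) expF) (qExp q expE)
  have f₄ := hc (qExp q expE) (qExp q expE)
  have f₅ := hc (qExp q expE) (qExp (q ^ 4) expF)
  have f₆ := hc (qExp (q ^ 4) expF) (qExp (q ^ 4) expF)
  have f₈ := (hc (W11 q) (W11 q)).eq
  rw [(isTopHom_leg 0).map_qExp _ hF, (isTopHom_leg 1).map_qExp _ hE] at f₃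
  rw [(isTopHom_leg 0).map_qExp _ hE, (isTopHom_leg 1).map_qExp _ hE] at f₄
  rw [(isTopHom_leg 0).map_qExp _ hE, (isTopHom_leg 1).map_qExp _ hF] at f₅
  rw [(isTopHom_leg 0).map_qExp _ hF, (isTopHom_leg 1).map_qExp _ hF] at f₆
  have f₇ : Commute (cls ((UqA22 q).tensorRel 2) (qExp q (leg 0 expE)))
      (cls ((UqA22 q).tensorRel 2) (qExp (q ^ 4) (leg 0 expF))) :=
    (cls_commute_qExp hE₀ (cls_commute_qExp hF₀ (hEF 0)).symm).symm
  have g : cls ((UqA22 q).tensorRel 2) (ratio11 q * (UqA22 q).Δ (W11 q)) =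
      cls ((UqA22 q).tensorRel 2) (tmul (W11 q) (W11 q) * 1) := by
    rw [mul_one, tmul, map_mul, map_mul, f₈, ratio11, W11_eq, map_mul (UqA22 q).Δ, map_mul (leg 0),
      map_mul (leg 1), (UqA22 q).isTopHom_Δ.map_qExp _ hE, (UqA22 q).isTopHom_Δ.map_qExp _ hF,
      (isTopHom_leg 0).map_qExp _ hE, (isTopHom_leg 0).map_qExp _ hF,
      (isTopHom_leg 1).map_qExp _ hE, (isTopHom_leg 1).map_qExp _ hF,
      map_mul (cls _) (qExp q ((UqA22 q).Δ expE)), map_mul (cls _) (qExp q (leg 0 expE)),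
      map_mul (cls _) (qExp q (leg 1 expE))]
    rw [e₁] at f₁
    rw [e₂] at f₂
    have := mul_eq_of_factor (R := 1) key (((one_mul _).trans f₁).trans (mul_one _).symm)
      (((one_mul _).trans f₂).trans (mul_one _).symm) f₃.symm f₄.symm f₅.symm f₆.symm f₇
    rwa [mul_one, mul_one] at this
  have := HopfPresentation.cls_gauge_eq _ isUnit_W11 g
  rwa [mul_one] at this

/-- The gauge transformation of `F_q` by `V = exp (-2 t³ e_α e_{-δ+2α})` is `(V ⊗ V) F_q Δ(V)⁻¹`. -/
theorem cls_coboundary_W11' (hq : PowerSeries.constantCoeff q = 1) :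
    cls ((UqA22 q).tensorRel 2) (coboundary q (W11' q)) =
    cls ((UqA22 q).tensorRel 2) (qExp 1 (leg 0 expV) * qExp 1 (leg 1 expV) * ratio11 q *
      qExp 1 (-(UqA22 q).Δ expV)) := by
  have hV := X_dvd_expV
  have hV₀ := (isTopHom_leg (n := 2) 0).X_dvd hV
  have hV₁ := (isTopHom_leg (n := 2) 1).X_dvd hV
  have hΔV := (UqA22 q).isTopHom_Δ.X_dvd hV
  have h₁ : cls ((UqA22 q).tensorRel 2) (qExp 1 (-(UqA22 q).Δ expV)) *
      cls ((UqA22 q).tensorRel 2) (qExp 1 ((UqA22 q).Δ expV)) = 1 := by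
    rw [← cls_qExp_add (map_one _) (dvd_neg.2 hΔV) hΔV, neg_add_cancel, qExp_zero, map_one]
    rw [one_smul, map_neg, mul_neg, neg_mul]
  have h₂ : cls ((UqA22 q).tensorRel 2) (ratio11 q) *
      cls ((UqA22 q).tensorRel 2) ((UqA22 q).Δ (W11 q)) =
      cls ((UqA22 q).tensorRel 2) (tmul (W11 q) (W11 q)) := by
    rw [← cls_coboundary_W11 hq, coboundary, map_mul, mul_assoc, ← map_mul (cls _),
      ← map_mul (UqA22 q).Δ, Ring.inverse_mul_cancel _ isUnit_W11, map_one, map_one, mul_one]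
  have h₃ := ((UqA22 q).leg_commute (n := 2) zero_ne_one (W11 q) (qExp 1 expV)).eq
  have := HopfPresentation.cls_gauge_eq (UqA22 q) (R := 1) (T := tmul (W11' q) (W11' q))
    (F := qExp 1 (leg 0 expV) * qExp 1 (leg 1 expV) * ratio11 q * qExp 1 (-(UqA22 q).Δ expV))
    (isUnit_W11' (q := q)) ?_
  · rwa [mul_one] at this
  rw [(isTopHom_leg 1).map_qExp _ hV] at h₃
  rw [mul_one, W11'_eq, tmul, map_mul (UqA22 q).Δ, map_mul (leg 0), map_mul (leg 1),
    (UqA22 q).isTopHom_Δ.map_qExp _ hV, (isTopHom_leg 0).map_qExp _ hV,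
    (isTopHom_leg 1).map_qExp _ hV]
  rw [tmul] at h₂
  simp only [map_mul] at h₂ ⊢
  rw [mul_assoc _ (cls _ (qExp 1 (-_))), ← mul_assoc (cls _ (qExp 1 (-_))), h₁, one_mul, mul_assoc,
    h₂]
  exact Commute.mul_mul_mul_comm h₃.symm _ _

end GenB

/-! ### The filtration by powers of `s` -/

section Integral

variable {G : Type}

/-- The inclusion of the free `ℂ[s]`-algebra. -/
noncomputable def inclFree (G : Type) : FreeAlgebra ℂ[X] G →ₐ[ℂ[X]] FreeAlgebra Laur G :=
  FreeAlgebra.lift ℂ[X] (FreeAlgebra.ι Laur)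

theorem T_smul_inclFree (k : ℕ) (z : FreeAlgebra ℂ[X] G) :
    (LaurentPolynomial.T k : Laur) • inclFree G z = inclFree G ((Polynomial.X ^ k : ℂ[X]) • z) := by
  rw [map_smul, ← IsScalarTower.algebraMap_smul Laur (Polynomial.X ^ k : ℂ[X]),
    LaurentPolynomial.algebraMap_eq_toLaurent, Polynomial.toLaurent_X_pow]

/-- `f` lies in `s ^ m` times the integral form: all its coefficients lie in `s ^ m` times the
free `ℂ[s]`-algebra. Negative `m` are allowed. -/
def IsInt (m : ℤ) (f : FreeTop G) : Prop :=
  ∀ n, ∃ z, PowerSeries.coeff n f = (LaurentPolynomial.T m : Laur) • inclFree G z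

namespace IsInt

variable {f g : FreeTop G} {m n : ℤ}

theorem zero (m : ℤ) : IsInt m (0 : FreeTop G) := fun n => ⟨0, by simp⟩

theorem add (hf : IsInt m f) (hg : IsInt m g) : IsInt m (f + g) := fun n => by
  obtain ⟨a, ha⟩ := hf n
  obtain ⟨b, hb⟩ := hg n
  exact ⟨a + b, by rw [map_add, ha, hb, map_add, smul_add]⟩

theorem neg (hf : IsInt m f) : IsInt m (-f) := fun n => by
  obtain ⟨a, ha⟩ := hf n
  exact ⟨-a, by rw [map_neg, ha, map_neg, smul_neg]⟩

theorem sub (hf : IsInt m f) (hg : IsInt m g) : IsInt m (f - g) := by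
  rw [sub_eq_add_neg]; exact hf.add hg.neg

theorem mul (hf : IsInt m f) (hg : IsInt n g) : IsInt (m + n) (f * g) := fun k => by
  choose a ha using hf
  choose b hb using hg
  refine ⟨∑ p ∈ Finset.HasAntidiagonal.antidiagonal k, a p.1 * b p.2, ?_⟩
  rw [PowerSeries.coeff_mul, map_sum, Finset.smul_sum]
  refine Finset.sum_congr rfl fun p _ => ?_
  rw [ha, hb, smul_mul_smul_comm, map_mul, LaurentPolynomial.T_add]

theorem mono (hf : IsInt n f) (h : m ≤ n) : IsInt m f := fun k => by
  obtain ⟨a, ha⟩ := hf k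
  obtain ⟨d, rfl⟩ := Int.le.dest h
  exact ⟨_, by rw [ha, LaurentPolynomial.T_add, mul_smul, T_smul_inclFree]⟩

theorem formalSum {f : ℕ → FreeTop G} (hf : ∀ k, IsInt m (f k)) :
    IsInt m (QTwist.formalSum f) := fun n => by
  choose a ha using hf
  refine ⟨∑ k ∈ Finset.range (n + 1), a k n, ?_⟩
  rw [QTwist.formalSum, PowerSeries.coeff_mk, map_sum, Finset.smul_sum]
  exact Finset.sum_congr rfl fun k _ => ha k n

theorem C (z : FreeAlgebra ℂ[X] G) : IsInt 0 (PowerSeries.C (inclFree G z)) := fun n => by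
  refine ⟨if n = 0 then z else 0, ?_⟩
  rw [PowerSeries.coeff_C, LaurentPolynomial.T_zero, one_smul]
  split_ifs <;> simp

theorem gen (x : G) : IsInt 0 (QTwist.gen x) := by
  simpa [inclFree, QTwist.gen] using C (FreeAlgebra.ι ℂ[X] x)

theorem one : IsInt 0 (1 : FreeTop G) := by
  simpa using C (1 : FreeAlgebra ℂ[X] G)

theorem pow (hf : IsInt m f) (n : ℕ) : IsInt (n * m) (f ^ n) := by
  induction n with
  | zero => simpa using one
  | succ n ih =>
    rw [pow_succ]
    convert ih.mul hf using 1
    push_cast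
    ring

theorem mul_left (hf : IsInt 0 f) (hg : IsInt n g) : IsInt n (f * g) := by
  simpa using hf.mul hg

theorem mul_right (hf : IsInt m f) (hg : IsInt 0 g) : IsInt m (f * g) := by
  simpa using hf.mul hg

theorem scal_intScal (a : PowerSeries ℂ[X]) : IsInt 0 (scal (intScal a) : FreeTop G) := fun n => by
  refine ⟨algebraMap ℂ[X] _ (PowerSeries.coeff n a), ?_⟩
  rw [LaurentPolynomial.T_zero, one_smul, AlgHom.commutes, scal, intScal, PowerSeries.coeff_map,
    PowerSeries.coeff_map, ← LaurentPolynomial.algebraMap_eq_toLaurent,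
    ← IsScalarTower.algebraMap_apply]

theorem scal_C_T (m : ℤ) :
    IsInt m (scal (PowerSeries.C (LaurentPolynomial.T m)) : FreeTop G) := fun n => by
  refine ⟨if n = 0 then 1 else 0, ?_⟩
  rw [scal, PowerSeries.map_C, PowerSeries.coeff_C]
  split_ifs
  · rw [map_one, Algebra.smul_def, mul_one]
  · simp

theorem scal_sInv : IsInt (-1) (scal sInv : FreeTop G) := scal_C_T (-1)

theorem scal_sVar : IsInt 1 (scal sVar : FreeTop G) := scal_C_T 1

theorem scal_tVar : IsInt 0 (scal tVar : FreeTop G) := intScal_X ▸ scal_intScal _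

theorem scal_cscal (c : ℂ) : IsInt 0 (scal (cscal c) : FreeTop G) := by
  have : cscal c = intScal (PowerSeries.C (Polynomial.C c)) := by
    simp [cscal, intScal]
  rw [this]
  exact scal_intScal _

theorem smul {c : PowerSeries Laur} (hc : IsInt m (scal c : FreeTop G)) (hf : IsInt n f) :
    IsInt (m + n) (c • f) := hc.mul hf

/-- An element of the integral form that is divisible by `t` and has coefficients divisible by
`s` is `s t` times an element of the integral form. -/
theorem exists_scal_mul_inclInt (hf : IsInt 1 f) (hX : PowerSeries.X ∣ f) :
    ∃ Z, f = scal (sVar * tVar) * inclInt G Z := by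
  obtain ⟨g, rfl⟩ := hX
  choose a ha using hf
  refine ⟨PowerSeries.mk fun n => a (n + 1), ?_⟩
  rw [map_mul, (scal_commute sVar _).eq, mul_assoc, tVar, scal_X]
  congr 1
  ext n
  rw [← PowerSeries.coeff_succ_X_mul, ha, sVar, scal, PowerSeries.map_C, PowerSeries.coeff_C_mul,
    inclInt, PowerSeries.coeff_map, PowerSeries.coeff_mk, Algebra.smul_def]
  rfl

end IsInt

/-- `f` lies in `s ^ m` times the integral form, and `f'` is congruent to `f` modulo `s ^ (m + 1)`
times the integral form. -/
def Lead (m : ℤ) (f f' : FreeTop G) : Prop := IsInt m f' ∧ IsInt (m + 1) (f - f')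

theorem IsInt.lead_self {m : ℤ} {f : FreeTop G} (hf : IsInt m f) : Lead m f f :=
  ⟨hf, by rw [sub_self]; exact .zero _⟩

namespace Lead

variable {f f' f'' g g' : FreeTop G} {m n : ℤ}

theorem isInt (h : Lead m f f') : IsInt m f := by
  have := (h.2.mono (show m ≤ m + 1 by omega)).add h.1
  rwa [sub_add_cancel] at this

theorem add (hf : Lead m f f') (hg : Lead m g g') : Lead m (f + g) (f' + g') :=
  ⟨hf.1.add hg.1, by rw [add_sub_add_comm]; exact hf.2.add hg.2⟩

theorem neg (hf : Lead m f f') : Lead m (-f) (-f') :=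
  ⟨hf.1.neg, by rw [neg_sub_neg, ← neg_sub]; exact hf.2.neg⟩

theorem trans (hf : Lead m f f') (hf' : Lead m f' f'') : Lead m f f'' :=
  ⟨hf'.1, by rw [← sub_add_sub_cancel f f' f'']; exact hf.2.add hf'.2⟩

theorem mul (hf : Lead m f f') (hg : Lead n g g') : Lead (m + n) (f * g) (f' * g') := by
  refine ⟨hf.1.mul hg.1, ?_⟩
  have e : f * g - f' * g' = f * (g - g') + (f - f') * g' := by
    rw [mul_sub, sub_mul, sub_add_sub_cancel]
  rw [e]
  exact ((hf.isInt.mul hg.2).mono (by omega)).add ((hf.2.mul hg.1).mono (by omega))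

theorem pow (hf : Lead m f f') (n : ℕ) : Lead (n * m) (f ^ n) (f' ^ n) := by
  induction n with
  | zero => simpa using IsInt.one.lead_self
  | succ n ih =>
    rw [pow_succ, pow_succ]
    convert ih.mul hf using 1
    push_cast
    ring

theorem smul {c c' : PowerSeries Laur} (hc : Lead m (scal c : FreeTop G) (scal c'))
    (hf : Lead n f f') : Lead (m + n) (c • f) (c' • f') := hc.mul hf

theorem formalSum {f f' : ℕ → FreeTop G} (h : ∀ k, Lead m (f k) (f' k)) :
    Lead m (QTwist.formalSum f) (QTwist.formalSum f') :=
  ⟨.formalSum fun k => (h k).1, by rw [← formalSum_sub]; exact .formalSum fun k => (h k).2⟩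

end Lead

end Integral

/-! ### Parameters congruent to `1` modulo `s² t` -/

section NearOne

variable {G : Type}

theorem scalar_sub_smul (c d : PowerSeries Laur) (x : FreeTop G) :
    (c - d) • x = c • x - d • x := by
  rw [← scal_mul, map_sub, sub_mul]
  rfl

/-- `Q` lies in the integral form and is congruent to `1` modulo `s² t`. -/
def NearOne (Q : PowerSeries Laur) : Prop :=
  ∃ a : PowerSeries ℂ[X], Q = intScal (1 + sInt ^ 2 * PowerSeries.X * a)

theorem intScal_inverse {u : PowerSeries ℂ[X]} (hu : IsUnit u) :
    Ring.inverse (intScal u) = intScal (Ring.inverse u) := by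
  have h : intScal u * intScal (Ring.inverse u) = 1 := by
    rw [← map_mul, Ring.mul_inverse_cancel u hu, map_one]
  rw [← mul_one (Ring.inverse (intScal u)), ← h, ← mul_assoc,
    Ring.inverse_mul_cancel _ (hu.map intScal), one_mul]

theorem isUnit_one_add_X_mul (a : PowerSeries ℂ[X]) :
    IsUnit (1 + sInt ^ 2 * PowerSeries.X * a) := by
  rw [PowerSeries.isUnit_iff_constantCoeff]
  simp

theorem IsDeformationParameter.nearOne {q : PowerSeries Laur} (hq : IsDeformationParameter q) :
    NearOne q := by
  obtain ⟨g, rfl⟩ := hq.exists_intScal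
  exact ⟨_, rfl⟩

namespace NearOne

variable {Q P : PowerSeries Laur}

theorem one : NearOne 1 := ⟨0, by simp⟩

theorem mul (hQ : NearOne Q) (hP : NearOne P) : NearOne (Q * P) := by
  obtain ⟨a, rfl⟩ := hQ
  obtain ⟨b, rfl⟩ := hP
  refine ⟨a + b + sInt ^ 2 * PowerSeries.X * a * b, ?_⟩
  rw [← map_mul]
  congr 1
  ring

theorem pow (hQ : NearOne Q) (n : ℕ) : NearOne (Q ^ n) := by
  induction n with
  | zero => rw [pow_zero]; exact one
  | succ n ih => rw [pow_succ]; exact ih.mul hQ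

theorem inverse (hQ : NearOne Q) : NearOne (Ring.inverse Q) := by
  obtain ⟨a, rfl⟩ := hQ
  have h := isUnit_one_add_X_mul a
  rw [intScal_inverse h]
  refine ⟨-(a * Ring.inverse (1 + sInt ^ 2 * PowerSeries.X * a)), ?_⟩
  congr 1
  refine h.mul_left_cancel ?_
  rw [Ring.mul_inverse_cancel _ h]
  linear_combination (sInt ^ 2 * PowerSeries.X * a) * Ring.mul_inverse_cancel _ h

theorem constantCoeff (hQ : NearOne Q) : PowerSeries.constantCoeff Q = 1 := by
  obtain ⟨a, rfl⟩ := hQ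
  simp [intScal, sInt]

theorem isInt_sub_one (hQ : NearOne Q) : IsInt 2 (scal (Q - 1) : FreeTop G) := by
  obtain ⟨a, rfl⟩ := hQ
  have e : intScal (1 + sInt ^ 2 * PowerSeries.X * a) - 1 =
      sVar ^ 2 * intScal (PowerSeries.X * a) := by
    rw [← intScal_sInt, ← map_one intScal, ← map_pow, ← map_mul, ← map_sub]
    congr 1
    ring
  rw [e, map_mul, map_pow]
  exact (IsInt.scal_sVar.pow 2).mul_right (.scal_intScal _)

theorem lead (hQ : NearOne Q) : Lead 0 (scal Q : FreeTop G) 1 :=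
  ⟨.one, by rw [← map_one scal, ← map_sub]; exact hQ.isInt_sub_one.mono (by norm_num)⟩

theorem isInt (hQ : NearOne Q) : IsInt 0 (scal Q : FreeTop G) := hQ.lead.isInt

/-- `log q` is divisible by `s²`, so that `q^h ≡ 1` modulo `s²`. -/
theorem isInt_logOf (hQ : NearOne Q) : IsInt 2 (scal (PowerSeries.logOf Q) : FreeTop G) := by
  obtain ⟨a, rfl⟩ := hQ
  have h₁ : PowerSeries.constantCoeff (1 + sInt ^ 2 * PowerSeries.X * a) = 1 := by simp
  obtain ⟨b, hb⟩ := sub_one_dvd_logOf h₁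
  have e : PowerSeries.logOf (intScal (1 + sInt ^ 2 * PowerSeries.X * a)) =
      intScal (PowerSeries.logOf (1 + sInt ^ 2 * PowerSeries.X * a)) := by
    have hX : PowerSeries.X ∣ 1 + sInt ^ 2 * PowerSeries.X * a - 1 :=
      ⟨sInt ^ 2 * a, by ring⟩
    have hX' : (PowerSeries.X : PowerSeries Laur) ∣
        intScal (1 + sInt ^ 2 * PowerSeries.X * a) - 1 := by
      have := map_dvd intScal hX
      rw [intScal_X, map_sub, map_one] at this
      exact this
    rw [PowerSeries.logOf_eq, PowerSeries.logOf_eq, subst_eq_formalSum _ hX,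
      subst_eq_formalSum _ hX', map_formalSum intScal intScal_X
        fun k => X_pow_dvd_mul_left _ (X_pow_dvd_pow hX k)]
    congr 1
    funext k
    rw [map_mul, map_pow, map_sub, map_one, intScal, PowerSeries.map_C]
    congr 2
    by_cases hk : k = 0 <;> simp [PowerSeries.coeff_log, hk]
  have e' : intScal (PowerSeries.logOf (1 + sInt ^ 2 * PowerSeries.X * a)) =
      sVar ^ 2 * intScal (PowerSeries.X * a * b) := by
    rw [hb, ← intScal_sInt, ← map_pow, ← map_mul]
    refine congrArg intScal ?_
    generalize sInt = s
    ring
  rw [e, e', map_mul, map_pow]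
  exact (IsInt.scal_sVar.pow 2).mul_right (.scal_intScal _)

/-- The `q`-factorials are invertible already in `ℂ[s]⟦t⟧`, as their constant coefficients are
`n!`. -/
theorem isInt_qCoeff (hQ : NearOne Q) (n : ℕ) : IsInt 0 (scal (qCoeff Q n) : FreeTop G) := by
  obtain ⟨a, rfl⟩ := hQ
  set Q₀ := 1 + sInt ^ 2 * PowerSeries.X * a
  have e : qFactorial (intScal Q₀) n =
      intScal (∏ i ∈ Finset.range n, ∑ j ∈ Finset.range (i + 1), Q₀ ^ j) := by
    simp only [qFactorial, qInt, map_prod, map_sum, map_pow]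
  have hu : IsUnit (∏ i ∈ Finset.range n, ∑ j ∈ Finset.range (i + 1), Q₀ ^ j) := by
    rw [IsUnit.prod_iff]
    intro i _
    rw [PowerSeries.isUnit_iff_constantCoeff]
    have : PowerSeries.constantCoeff (∑ j ∈ Finset.range (i + 1), Q₀ ^ j) =
        Polynomial.C ((i + 1 : ℕ) : ℂ) := by
      simp [Q₀]
    rw [this]
    exact (isUnit_iff_ne_zero.2 (Nat.cast_ne_zero.2 i.succ_ne_zero)).map _
  rw [qCoeff, e, intScal_inverse hu]
  exact .scal_intScal _

theorem lead_qFactorial (hQ : NearOne Q) (n : ℕ) :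
    Lead 0 (scal (qFactorial Q n) : FreeTop G) (scal (qFactorial 1 n)) := by
  have hi : ∀ n, Lead 0 (scal (qInt Q n) : FreeTop G) (scal (qInt 1 n)) := fun n => by
    induction n with
    | zero => simpa [qInt] using (IsInt.zero (G := G) 0).lead_self
    | succ n ih =>
      simp only [qInt, Finset.sum_range_succ, map_add, map_pow] at ih ⊢
      exact ih.add (by simpa using hQ.lead.pow n)
  induction n with
  | zero => simpa [qFactorial] using (IsInt.one (G := G)).lead_self
  | succ n ih =>
    simp only [qFactorial, Finset.prod_range_succ, map_mul] at ih ⊢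
    exact ih.mul (hi (n + 1))

theorem lead_qCoeff (hQ : NearOne Q) (n : ℕ) :
    Lead 0 (scal (qCoeff Q n) : FreeTop G) (scal (qCoeff 1 n)) := by
  refine ⟨one.isInt_qCoeff n, ?_⟩
  have h₁ : qFactorial Q n * qCoeff Q n = 1 :=
    Ring.mul_inverse_cancel _ (isUnit_qFactorial hQ.constantCoeff n)
  have h₂ : qFactorial 1 n * qCoeff 1 n = 1 :=
    Ring.mul_inverse_cancel _ (isUnit_qFactorial (map_one _) n)
  have e : qCoeff Q n - qCoeff 1 n =
      -((qFactorial Q n - qFactorial 1 n) * (qCoeff Q n * qCoeff 1 n)) := by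
    linear_combination qCoeff 1 n * h₁ - qCoeff Q n * h₂
  rw [← map_sub, e, map_neg, map_mul, map_mul, map_sub]
  exact ((hQ.lead_qFactorial n).2.mul_right
    ((hQ.isInt_qCoeff n).mul_left (one.isInt_qCoeff n))).neg

/-! ### Leading terms of `q`-exponentials and `q`-Pochhammer series -/

theorem isInt_qExp_sub_one (hQ : NearOne Q) {m : ℤ} (hm : 0 ≤ m) {x : FreeTop G}
    (hx : IsInt m x) (hX : PowerSeries.X ∣ x) : IsInt m (qExp Q x - 1) := by
  rw [qExp_eq, formalSum_eq_zero_add fun n => X_pow_dvd_qExp_term hX n, qCoeff_zero, pow_zero,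
    one_smul, add_sub_cancel_left]
  refine .formalSum fun n => ?_
  have := IsInt.smul (hQ.isInt_qCoeff (n + 1)) (hx.pow (n + 1))
  refine this.mono ?_
  push_cast
  nlinarith

theorem isInt_qPow_sub_one (hQ : NearOne Q) {h : FreeTop G} (hh : IsInt 0 h) :
    IsInt 2 (qPow Q h - 1) := by
  rw [qPow_eq]
  exact one.isInt_qExp_sub_one (by norm_num) (IsInt.smul hQ.isInt_logOf hh)
    (X_dvd_smul' (X_dvd_logOf hQ.constantCoeff) _)

theorem isInt_one_sub_smul (hQ : NearOne Q) {M : FreeTop G} {m : ℤ} (hm : 0 ≤ m) (hm' : m ≤ 2)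
    (hM : IsInt m (1 - M)) (i : ℕ) :
    IsInt m (1 - Q ^ i • M) ∧ IsInt 2 (1 - Q ^ i • M - (1 - M)) := by
  have hM' : IsInt 0 M := by
    have := IsInt.one.sub (hM.mono hm)
    rwa [sub_sub_cancel] at this
  have e : 1 - Q ^ i • M - (1 - M) = -(scal (Q ^ i - 1) * M) := by
    rw [scal_mul, scalar_sub_smul, one_smul, sub_sub_sub_cancel_left, neg_sub]
  have h₂ : IsInt 2 (1 - Q ^ i • M - (1 - M)) := by
    rw [e]; exact ((hQ.pow i).isInt_sub_one.mul_right hM').neg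
  refine ⟨?_, h₂⟩
  have := (h₂.mono hm').add hM
  rwa [sub_add_cancel] at this

theorem isInt_qPoch (hQ : NearOne Q) {M : FreeTop G} {m : ℤ} (hm : 0 ≤ m) (hm' : m ≤ 2)
    (hM : IsInt m (1 - M)) (n : ℕ) : IsInt (n * m) (qPoch Q M n) := by
  induction n with
  | zero => simpa [qPoch] using IsInt.one
  | succ n ih =>
    rw [qPoch]
    convert ih.mul (hQ.isInt_one_sub_smul hm hm' hM n).1 using 1
    push_cast
    ring

/-- Each factor `1 - Q^i M` has the leading term of `1 - M`, since `Q ≡ 1` modulo `s²`. -/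
theorem lead_qPoch (hQ : NearOne Q) {M A : FreeTop G} (hM : Lead 1 (1 - M) A) (n : ℕ) :
    Lead n (qPoch Q M n) (A ^ n) := by
  induction n with
  | zero => simpa [qPoch] using IsInt.one.lead_self
  | succ n ih =>
    rw [qPoch, pow_succ]
    have := hQ.isInt_one_sub_smul (by norm_num) (by norm_num) hM.isInt n
    push_cast
    exact ih.mul (Lead.trans ⟨hM.isInt, this.2⟩ hM)

/-- If `1 - M` is divisible by `s²`, then the term of degree `n` of the `q`-Pochhammer series is
divisible by `s^(2n - n)`, so only the first two terms matter modulo `s²`. -/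
theorem isInt_qRatio_sub (hQ : NearOne Q) {M z : FreeTop G} (hM : IsInt 2 (1 - M))
    (hz : IsInt (-1) z) (hX : PowerSeries.X ∣ z) :
    IsInt 2 (qRatio Q M z - (1 + (1 - M) * z)) := by
  have hd := fun n => X_pow_dvd_qRatio_term (Q := Q) M hX n
  have h₁ : qCoeff Q 1 = 1 := by
    have := qInt_mul_qCoeff hQ.constantCoeff 0
    simpa [qInt, qCoeff_zero] using this
  have e : qRatio Q M z = (1 + (1 - M) * z) +
      QTwist.formalSum fun n => qCoeff Q (n + 2) • (qPoch Q M (n + 2) * z ^ (n + 2)) := by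
    rw [qRatio, formalSum_eq_zero_add hd,
      formalSum_eq_zero_add fun n => (pow_dvd_pow _ n.le_succ).trans (hd (n + 1)), add_assoc]
    congr 1
    · rw [qCoeff_zero, one_smul, pow_zero, mul_one, qPoch]
    · congr 1
      rw [zero_add, h₁, one_smul, pow_one, qPoch, qPoch, pow_zero, one_smul, one_mul]
  rw [e, add_sub_cancel_left]
  refine .formalSum fun n => ?_
  refine (IsInt.smul (hQ.isInt_qCoeff (n + 2)) ((hQ.isInt_qPoch (by norm_num) le_rfl hM (n + 2)).mul
    (hz.pow (n + 2)))).mono ?_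
  push_cast
  linarith

theorem isInt_qRatio_sub_one (hQ : NearOne Q) {M z : FreeTop G} (hM : IsInt 2 (1 - M))
    (hz : IsInt (-1) z) (hX : PowerSeries.X ∣ z) : IsInt 1 (qRatio Q M z - 1) := by
  have := ((hQ.isInt_qRatio_sub hM hz hX).mono (show (1 : ℤ) ≤ 2 by norm_num)).add (hM.mul hz)
  rwa [← sub_sub, sub_add_cancel] at this

/-- The product of `n` factors divisible by `s` compensates the pole `s⁻ⁿ` of `zⁿ`. -/
theorem lead_qRatio (hQ : NearOne Q) {M A z : FreeTop G} (hM : Lead 1 (1 - M) A)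
    (hz : IsInt (-1) z) :
    Lead 0 (qRatio Q M z) (QTwist.formalSum fun n => qCoeff 1 n • (A ^ n * z ^ n)) :=
  .formalSum fun n => by
    have := Lead.smul (hQ.lead_qCoeff n) ((hQ.lead_qPoch hM n).mul (hz.lead_self.pow n))
    simpa using this

end NearOne

/-- The leading term of the `q`-Pochhammer series in `y`, whose second argument is the conjugate
`m' = m · D` of `m` by `exp_Q x`. -/
theorem lead_qRatio_mul_qRatio {Q P v w : PowerSeries Laur} (hQ : NearOne Q) (hP : NearOne P)
    (hv : NearOne v) (hvw : v * w = 1) {m x y A : FreeTop G} (hm : IsInt 2 (m - 1))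
    (hx : IsInt (-1) x) (hX : PowerSeries.X ∣ x) (hy : IsInt (-1) y)
    (hA : Lead 1 (-((w - 1) • x)) A) :
    Lead 0 (qRatio P (m * qRatio Q (scal v) (w • x)) y)
      (formalSum fun n => qCoeff 1 n • (A ^ n * y ^ n)) := by
  have hw : w = Ring.inverse v := by
    have hu : IsUnit v := IsUnit.of_mul_eq_one _ hvw
    rw [← mul_one (Ring.inverse v), ← hvw, ← mul_assoc, Ring.inverse_mul_cancel v hu, one_mul]
  have hwN : NearOne w := hw ▸ hv.inverse
  refine hP.lead_qRatio (Lead.trans ⟨hA.isInt, ?_⟩ hA) hy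
  have hv' : IsInt 2 (1 - scal v : FreeTop G) := by
    have := hv.isInt_sub_one (G := G).neg
    rwa [map_sub, map_one, neg_sub] at this
  have hD := hQ.isInt_qRatio_sub hv' (IsInt.smul hwN.isInt hx) (X_dvd_smul w hX)
  set D := qRatio Q (scal v) (w • x)
  have hD₀ : IsInt 0 D := by
    have := (hQ.isInt_qRatio_sub_one hv' (IsInt.smul hwN.isInt hx) (X_dvd_smul w hX))
    have := (this.mono (show (0 : ℤ) ≤ 1 by norm_num)).add .one
    rwa [sub_add_cancel] at this
  have e : 1 - m * D - -((w - 1) • x) = -((m - 1) * D) - (D - (1 + (1 - scal v) * w • x)) := by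
    have e₁ : (1 - scal v) * w • x = (w - 1) • x := by
      rw [sub_mul, one_mul, scal_mul, smul_smul, hvw, scalar_sub_smul]
    rw [e₁, sub_mul, one_mul]
    abel
  rw [e]
  exact ((hm.mul_right hD₀).neg).sub hD

end NearOne

/-! ### Congruences modulo `s t` -/

section Congruence

variable {G : Type} {S : Set (FreeTop G)}

theorem constantCoeff_formalSum {R : Type*} [Semiring R] (f : ℕ → PowerSeries R) :
    PowerSeries.constantCoeff (formalSum f) = PowerSeries.constantCoeff (f 0) := by
  rw [← PowerSeries.coeff_zero_eq_constantCoeff_apply, formalSum, PowerSeries.coeff_mk]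
  simp

theorem constantCoeff_qExp (Q : PowerSeries Laur) (x : FreeTop G) :
    PowerSeries.constantCoeff (qExp Q x) = 1 := by
  rw [qExp_eq, constantCoeff_formalSum, qCoeff_zero, one_smul, pow_zero, map_one]

theorem constantCoeff_qRatio (Q : PowerSeries Laur) (M x : FreeTop G) :
    PowerSeries.constantCoeff (qRatio Q M x) = 1 := by
  rw [qRatio, constantCoeff_formalSum, qCoeff_zero, one_smul, pow_zero, qPoch, one_mul, map_one]

theorem constantCoeff_formalSum_mul (A y : FreeTop G) :
    PowerSeries.constantCoeff (formalSum fun n => qCoeff 1 n • (A ^ n * y ^ n)) = 1 := by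
  rw [constantCoeff_formalSum, qCoeff_zero, one_smul, pow_zero, pow_zero, one_mul, map_one]

/-- If `A` and `y` commute modulo the relations, then `∑ₙ Aⁿ yⁿ / n!` is `exp (A y)`. -/
theorem cls_formalSum_eq_qExp {A y x : FreeTop G} (hy : PowerSeries.X ∣ y)
    (hx : PowerSeries.X ∣ x) (h : Commute (cls S A) (cls S y))
    (e : cls S A * cls S y = cls S x) :
    cls S (formalSum fun n => qCoeff 1 n • (A ^ n * y ^ n)) = cls S (qExp 1 x) := by
  rw [qExp_eq]
  refine cls_formalSum_congr
    (fun n => X_pow_dvd_smul _ (X_pow_dvd_mul_left _ (X_pow_dvd_pow hy n)))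
    (fun n => X_pow_dvd_qExp_term hx n) fun n => ?_
  rw [cls_smul, cls_smul, map_mul, map_pow, map_pow, map_pow, ← h.mul_pow, e]

/-- A congruence modulo `s` between elements of the integral form that are `1` modulo `t` is one
modulo `s t`. -/
theorem HopfPresentation.congrModST_of_lead (U : HopfPresentation G)
    {F F' E E' : FreeTop (Fin 2 × G)} (hF : cls (U.tensorRel 2) F = cls (U.tensorRel 2) F')
    (hE : cls (U.tensorRel 2) E = cls (U.tensorRel 2) E') (h : Lead 0 F' E')
    (h₁ : PowerSeries.constantCoeff F' = 1) (h₂ : PowerSeries.constantCoeff E' = 1) :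
    U.CongrModST F E := by
  obtain ⟨Z, hZ⟩ := IsInt.exists_scal_mul_inclInt (f := F' - E') (by simpa using h.2)
    (by rw [PowerSeries.X_dvd_iff, map_sub, h₁, h₂, sub_self])
  exact ⟨Z, by rw [← hZ, map_sub, map_sub, hF, hE]⟩

theorem NearOne.isInt_one_sub_qPow {q : PowerSeries Laur} (hq : NearOne q) {h : FreeTop G}
    (hh : IsInt 0 h) : IsInt 2 (1 - qPow q h) := by
  have := (hq.isInt_qPow_sub_one hh).neg
  rwa [neg_sub] at this

theorem NearOne.lead_qPow {q : PowerSeries Laur} (hq : NearOne q) {h : FreeTop G}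
    (hh : IsInt 0 h) : Lead 0 (qPow q h) 1 :=
  ⟨.one, (hq.isInt_qPow_sub_one hh).mono (by norm_num)⟩

theorem IsInt.lead_one {m : ℤ} {f : FreeTop G} (h : IsInt m (f - 1)) (hm : 1 ≤ m) : Lead 0 f 1 :=
  ⟨.one, h.mono (by omega)⟩

theorem Lead.qExp_one {x x' : FreeTop G} (h : Lead 0 x x') : Lead 0 (qExp 1 x) (qExp 1 x') :=
  .formalSum fun n => by
    have := Lead.smul ((NearOne.one.isInt_qCoeff n).lead_self) (h.pow n)
    rwa [mul_zero, add_zero] at this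

theorem sVar_mul_sInv : sVar * sInv = 1 := by
  rw [sVar, sInv, ← map_mul, ← LaurentPolynomial.T_add]
  simp

theorem isInt_scal_sInv_mul_tVar : IsInt (-1) (scal (sInv * tVar) : FreeTop G) := by
  rw [map_mul]; exact IsInt.scal_sInv.mul_right .scal_tVar

theorem IsDeformationParameter.lead_sub_one {q : PowerSeries Laur}
    (hq : IsDeformationParameter q) :
    Lead 2 (scal (q - 1) : FreeTop G) (scal (sVar ^ 2 * tVar)) := by
  obtain ⟨g, rfl⟩ := hq
  refine ⟨?_, ?_⟩
  · rw [map_mul, map_pow]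
    exact (IsInt.scal_sVar.pow 2).mul_right .scal_tVar
  · rw [← map_sub, show (1 + sVar ^ 2 * tVar +
      sVar ^ 3 * tVar * PowerSeries.map Polynomial.toLaurent g - 1 - sVar ^ 2 * tVar) =
      sVar ^ 3 * (tVar * intScal g) by rw [intScal]; ring, map_mul, map_mul, map_pow]
    exact (IsInt.scal_sVar.pow 3).mul_right (IsInt.scal_tVar.mul_left (.scal_intScal _))

theorem IsDeformationParameter.lead_sq_sub_one {q : PowerSeries Laur}
    (hq : IsDeformationParameter q) :
    Lead 2 (scal (q ^ 2 - 1) : FreeTop G) (scal (2 * (sVar ^ 2 * tVar))) := by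
  have h := hq.nearOne.lead (G := G).add IsInt.one.lead_self
  rw [one_add_one_eq_two] at h
  have e : q ^ 2 - 1 = (q + 1) * (q - 1) := by ring
  rw [e, map_mul, map_mul, map_add, map_one, map_ofNat]
  exact h.mul hq.lead_sub_one

theorem leg_qPow {q : PowerSeries Laur} (hq : NearOne q) (k : Fin 2) (x : FreeTop G) :
    leg k (qPow q x) = qPow q (leg k x) := (isTopHom_leg k).map_qPow hq.constantCoeff x

theorem isInt_leg_gen (k : Fin 2) (x : G) : IsInt 0 (leg k (gen x)) := by
  rw [leg_gen]; exact .gen _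

end Congruence

namespace GenA

variable {q : PowerSeries Laur} {c : ℂ}

theorem isInt_leg_E13 (hq : NearOne q) (k : Fin 2) : IsInt 0 (leg k (E13 q)) := by
  rw [E13_eq, map_sub, (isTopHom_leg k).map_smul, map_mul, map_mul]
  exact ((isInt_leg_gen k _).mul_left (isInt_leg_gen k _)).sub
    (IsInt.smul hq.inverse.isInt ((isInt_leg_gen k _).mul_left (isInt_leg_gen k _)))

theorem isInt_leg_expY (hq : NearOne q) (k : Fin 2) : IsInt (-1) (leg k (expY q)) := by
  rw [expY_eq, (isTopHom_leg k).map_smul]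
  exact IsInt.smul isInt_scal_sInv_mul_tVar (isInt_leg_E13 hq k)

theorem lead_leg_expX (hq : NearOne q) (k : Fin 2) : Lead (-1) (leg k (expX q c))
    ((cscal c * (sInv * tVar)) • leg k E12) := by
  rw [expX_eq, (isTopHom_leg k).map_smul, map_mul, leg_qPow hq]
  have h : Lead 0 (qPow q (leg k (-H12)) * leg k E12) (1 * leg k E12) :=
    (hq.lead_qPow (by rw [map_neg]; exact (isInt_leg_gen k _).neg)).mul
      (isInt_leg_gen k _).lead_self
  rw [one_mul] at h
  refine Lead.smul (m := -1) (IsInt.lead_self ?_) h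
  rw [map_mul]
  exact (IsInt.scal_cscal c).mul_left isInt_scal_sInv_mul_tVar

/-- The leading term of `1 - m'`, where `m'` is the conjugate of `q^(-h₁₃) ⊗ 1` by the
exponential of `c s⁻¹ t q^(-h₁₂) e₁₂ ⊗ 1`. -/
noncomputable def leadA (c : ℂ) : FreeTop (Fin 2 × GenA) :=
  -((sVar ^ 2 * tVar) • (cscal c * (sInv * tVar)) • leg 0 E12)

/-- The exponential `exp (-c t³ e₁₂ ⊗ e₁₃)`, with the powers of the tensor factors separated. -/
noncomputable def limit01 (q : PowerSeries Laur) (c : ℂ) : FreeTop (Fin 2 × GenA) :=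
  formalSum fun n => qCoeff 1 n • (leadA c ^ n * leg 1 (expY q) ^ n)

/-- Only the `q`-Pochhammer series in `s⁻¹ t ⊗ e₁₃` contributes modulo `s`. -/
theorem lead_ratio01 (hq : IsDeformationParameter q) :
    Lead 0 (ratio01 q c * R₁ q) (limit01 q c) := by
  have hn := hq.nearOne
  have hx := lead_leg_expX (c := c) hn 0
  have hX := (isTopHom_leg (n := 2) 0).X_dvd (X_dvd_expX (q := q) (c := c))
  have h₁ := lead_qRatio_mul_qRatio (hn.pow 2) (hn.pow 2) hn.inverse
    (Ring.inverse_mul_cancel q hq.isUnit) (m := leg 0 (qPow q (-H13)))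
    (x := leg 0 (expX q c)) (y := leg 1 (expY q)) (A := leadA c)
    (by
      rw [leg_qPow hn]
      refine hn.isInt_qPow_sub_one ?_
      rw [map_neg, H13, map_add]
      exact ((isInt_leg_gen (0 : Fin 2) _).add (isInt_leg_gen (0 : Fin 2) _)).neg)
    hx.isInt hX (isInt_leg_expY hn (1 : Fin 2))
    (Lead.neg (Lead.smul (m := 2) (n := -1) hq.lead_sub_one hx))
  have h₂ : Lead 0 (qRatio (q ^ 2) (leg 1 (qPow q (-H12))) (leg 0 (expX q c)) :
      FreeTop (Fin 2 × GenA)) 1 := by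
    refine IsInt.lead_one ((hn.pow 2).isInt_qRatio_sub_one ?_ hx.isInt hX) le_rfl
    rw [leg_qPow hn]
    refine hn.isInt_one_sub_qPow ?_
    rw [map_neg]
    exact (isInt_leg_gen (1 : Fin 2) _).neg
  have h₃ : Lead 0 (R₁ q) 1 := by
    refine IsInt.lead_one ((hn.pow 2).isInt_qExp_sub_one (m := 2) (by norm_num) (x := expR₁ q) ?_
      (X_dvd_expR₁ hq.constantCoeff)) (by norm_num)
    have e : q - Ring.inverse q = (q - 1) - (Ring.inverse q - 1) := by ring
    rw [expR₁, e, map_sub, tmul]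
    exact ((hn.isInt_sub_one.sub hn.inverse.isInt_sub_one).mul_right
      ((isInt_leg_gen (0 : Fin 2) _).mul_left (isInt_leg_gen (1 : Fin 2) _))).neg
  have := (h₁.mul h₂).mul h₃
  rwa [mul_one, mul_one] at this

theorem leadA_mul_expY :
    leadA c * leg 1 (expY q) = -(c • (scal (tVar ^ 3) * tmul E12 (E13 q))) := by
  rw [leadA, expY_eq, (isTopHom_leg 1).map_smul, smul_smul, csmul_eq, scal_mul, smul_smul, tmul]
  have e : ∀ a b : FreeTop (Fin 2 × GenA), -a * b = -(a * b) := fun a b => neg_mul a b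
  rw [e, smul_mul_smul_comm]
  refine congrArg (fun r => -(r • _)) ?_
  linear_combination cscal c * tVar ^ 3 * (sVar * sInv + 1) * sVar_mul_sInv

theorem X_dvd_limitExponent :
    PowerSeries.X ∣ -(c • (scal (tVar ^ 3) * tmul E12 (E13 q))) := by
  rw [← leadA_mul_expY]
  exact X_dvd_mul_left _ ((isTopHom_leg 1).X_dvd X_dvd_expY)

theorem F01_congrModST (hq : IsDeformationParameter q) : (UqSL3 q).CongrModST (F01 q c)
    (texp (-(c • (scal (tVar ^ 3) * tmul E12 (E13 q))))) := by
  refine (UqSL3 q).congrModST_of_lead (cls_F01 hq.constantCoeff) ?_ (lead_ratio01 hq) ?_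
    (constantCoeff_formalSum_mul _ _)
  · rw [texp_eq_qExp, limit01]
    refine (cls_formalSum_eq_qExp ((isTopHom_leg 1).X_dvd X_dvd_expY) X_dvd_limitExponent ?_
      (by rw [← map_mul, leadA_mul_expY])).symm
    rw [leadA, map_neg, cls_smul, cls_smul]
    exact ((((UqSL3 q).leg_commute zero_ne_one _ _).smul_left _).smul_left _).neg_left
  · rw [ratio01, map_mul, map_mul, constantCoeff_qRatio, constantCoeff_qRatio, R₁_eq,
      constantCoeff_qExp, one_mul, one_mul]

end GenA

namespace GenB

variable {q : PowerSeries Laur}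

theorem isInt_leg_expE (k : Fin 2) : IsInt (-1) (leg k expE) := by
  rw [expE_eq, (isTopHom_leg k).map_smul]
  exact IsInt.smul isInt_scal_sInv_mul_tVar (isInt_leg_gen k _)

theorem isInt_leg_expF (k : Fin 2) : IsInt (-1) (leg k expF) := by
  rw [expF_eq, (isTopHom_leg k).map_smul]
  exact IsInt.smul isInt_scal_sInv_mul_tVar (isInt_leg_gen k _)

theorem isInt_leg_halfH (k : Fin 2) : IsInt 0 (leg k halfH) := by
  rw [halfH, (isTopHom_leg k).map_csmul, csmul_eq]
  exact IsInt.smul (.scal_cscal _) (isInt_leg_gen k _)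

/-- The leading term of `1 - m'`, where `m'` is the conjugate of `1 ⊗ q^(-h_α)` by the
exponential of `s⁻¹ t ⊗ e_α`. -/
noncomputable def leadB : FreeTop (Fin 2 × GenB) :=
  -((2 * (sVar ^ 2 * tVar)) • leg 1 expE)

/-- The exponential `exp (-2 t³ e_{-δ+2α} ⊗ e_α)`, with the powers of the tensor factors
separated. -/
noncomputable def limit11 : FreeTop (Fin 2 × GenB) :=
  formalSum fun n => qCoeff 1 n • (leadB ^ n * leg 0 expF ^ n)

/-- Only the `q`-Pochhammer series in `s⁻¹ t e_{-δ+2α} ⊗ 1` contributes modulo `s`. -/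
theorem lead_ratio11 (hq : IsDeformationParameter q) : Lead 0 (ratio11 q) limit11 := by
  have hn := hq.nearOne
  have hX := (isTopHom_leg (n := 2) 1).X_dvd X_dvd_expE
  have h₁ := lead_qRatio_mul_qRatio hn (hn.pow 4) (hn.inverse.pow 2) (w := q ^ 2)
    (by rw [← mul_pow, Ring.inverse_mul_cancel q hq.isUnit, one_pow])
    (m := leg 1 (qPow q (-Hα))) (x := leg 1 expE) (y := leg 0 expF) (A := leadB)
    (by
      rw [leg_qPow hn]
      refine hn.isInt_qPow_sub_one ?_
      rw [map_neg]
      exact (isInt_leg_gen (1 : Fin 2) _).neg)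
    (isInt_leg_expE (1 : Fin 2)) hX (isInt_leg_expF (0 : Fin 2))
    (Lead.neg (Lead.smul (m := 2) (n := -1) hq.lead_sq_sub_one
      (isInt_leg_expE (1 : Fin 2)).lead_self))
  have h₂ : Lead 0 (qRatio q (leg 0 (qPow q (-halfH))) (leg 1 expE) :
      FreeTop (Fin 2 × GenB)) 1 := by
    refine IsInt.lead_one (hn.isInt_qRatio_sub_one ?_ (isInt_leg_expE (1 : Fin 2)) hX) le_rfl
    rw [leg_qPow hn]
    refine hn.isInt_one_sub_qPow ?_
    rw [map_neg]
    exact (isInt_leg_halfH (0 : Fin 2)).neg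
  have := h₁.mul h₂
  rwa [mul_one] at this

theorem cls_neg_two_mul {G : Type} {S : Set (FreeTop G)} (x : FreeTop G) :
    cls S (-2 * x) = -((2 : PowerSeries Laur) • cls S x) := by
  have : -2 * x = -((2 : PowerSeries Laur) • x) := by
    rw [← scal_mul, map_ofNat]
    exact neg_mul 2 x
  rw [this, map_neg, cls_smul]

theorem leadB_mul_expF : cls ((UqA22 q).tensorRel 2) leadB *
    cls ((UqA22 q).tensorRel 2) (leg 0 expF) =
    cls ((UqA22 q).tensorRel 2) (-2 * (scal (tVar ^ 3) * tmul Fδ Eα)) := by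
  rw [cls_neg_two_mul, leadB, expE_eq, expF_eq, (isTopHom_leg 0).map_smul,
    (isTopHom_leg 1).map_smul, map_neg, cls_smul, cls_smul, cls_smul, scal_mul, cls_smul, tmul,
    map_mul, neg_mul, smul_smul, smul_mul_smul_comm,
    ((UqA22 q).leg_commute zero_ne_one _ _).eq, smul_smul]
  refine congrArg (fun r => -(r • _)) ?_
  linear_combination 2 * tVar ^ 3 * (sVar * sInv + 1) * sVar_mul_sInv

theorem X_dvd_mul_scal_tVar {G : Type} (x y : FreeTop G) :
    PowerSeries.X ∣ y * (scal (tVar ^ 3) * x) :=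
  X_dvd_mul_left _ (X_dvd_smul' (dvd_pow_self _ three_ne_zero) _)

theorem cls_limit11 : cls ((UqA22 q).tensorRel 2) limit11 =
    cls ((UqA22 q).tensorRel 2) (qExp 1 (-2 * (scal (tVar ^ 3) * tmul Fδ Eα))) := by
  refine cls_formalSum_eq_qExp ((isTopHom_leg 0).X_dvd X_dvd_expF) (X_dvd_mul_scal_tVar _ _) ?_
    leadB_mul_expF
  rw [leadB, map_neg, cls_smul]
  exact (((UqA22 q).leg_commute zero_ne_one _ _).symm.smul_left _).neg_left

theorem constantCoeff_ratio11 : PowerSeries.constantCoeff (ratio11 q) = 1 := by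
  rw [ratio11, map_mul, constantCoeff_qRatio, constantCoeff_qRatio, one_mul]

theorem coboundary_W11_congrModST (hq : IsDeformationParameter q) :
    (UqA22 q).CongrModST (coboundary q (W11 q))
      (texp (-2 * (scal (tVar ^ 3) * tmul Fδ Eα))) := by
  refine (UqA22 q).congrModST_of_lead (cls_coboundary_W11 hq.constantCoeff) ?_ (lead_ratio11 hq)
    constantCoeff_ratio11 (constantCoeff_formalSum_mul _ _)
  rw [texp_eq_qExp, cls_limit11]

end GenB

/-! ### The twist of `W'` modulo `s t` -/

namespace GenB

variable {q : PowerSeries Laur}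

theorem neg_two_mul_scal {G : Type} (x : FreeTop G) :
    -2 * (scal (tVar ^ 3) * x) = (-2 * tVar ^ 3) • x := by
  rw [← scal_mul, map_mul, map_neg, map_ofNat, mul_assoc]

theorem two_mul_scal {G : Type} (x : FreeTop G) :
    2 * (scal (tVar ^ 3) * x) = (2 * tVar ^ 3) • x := by
  rw [← scal_mul, map_mul, map_ofNat, mul_assoc]

theorem expV_eq : expV = (-2 * tVar ^ 3) • (Eα * Fδ) := neg_two_mul_scal _

/-- The limit of `Δ(-2 t³ e_α e_{-δ+2α})`. -/
noncomputable def limitΔV : FreeTop (Fin 2 × GenB) :=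
  (-2 * tVar ^ 3) • ((leg 1 Eα + leg 0 Eα) * (leg 0 Fδ + leg 1 Fδ))

theorem isInt_scal_neg_two_mul {G : Type} : IsInt 0 (scal (-2 * tVar ^ 3) : FreeTop G) := by
  have : -2 * tVar ^ 3 = intScal (-2 * PowerSeries.X ^ 3) := by
    rw [map_mul, map_pow, intScal_X, map_neg, map_ofNat]
  rw [this]
  exact .scal_intScal _

theorem lead_Δ_expV (hn : NearOne q) : Lead 0 ((UqA22 q).Δ expV) limitΔV := by
  rw [expV_eq, (UqA22 q).isTopHom_Δ.map_smul, map_mul, Δ_Eα, Δ_Fδ, leg_qPow hn, leg_qPow hn]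
  refine Lead.smul (m := 0) (n := 0) isInt_scal_neg_two_mul.lead_self
    (Lead.mul (m := 0) (n := 0) (.add ?_ ?_) (.add ?_ ?_))
  · have := (hn.lead_qPow (h := leg 0 (-halfH))
      (by rw [map_neg]; exact (isInt_leg_halfH (0 : Fin 2)).neg)).mul
      (isInt_leg_gen (1 : Fin 2) GenB.e).lead_self
    rwa [one_mul] at this
  · exact (isInt_leg_gen (0 : Fin 2) GenB.e).lead_self
  · have := (isInt_leg_gen (0 : Fin 2) GenB.f₀).lead_self.mul
      (hn.lead_qPow (h := leg 1 (-Hα))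
      (by rw [map_neg]; exact (isInt_leg_gen (1 : Fin 2) _).neg))
    rwa [mul_one] at this
  · exact (isInt_leg_gen (1 : Fin 2) GenB.f₀).lead_self

/-- The limit of `F_q'`, as a product of four exponentials. -/
noncomputable def limit11' : FreeTop (Fin 2 × GenB) :=
  qExp 1 (leg 0 expV) * qExp 1 (leg 1 expV) * limit11 * qExp 1 (-limitΔV)

theorem lead_coboundary_W11' (hq : IsDeformationParameter q) :
    Lead 0 (qExp 1 (leg 0 expV) * qExp 1 (leg 1 expV) * ratio11 q * qExp 1 (-(UqA22 q).Δ expV))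
      limit11' := by
  have hV : ∀ k : Fin 2, Lead 0 (qExp 1 (leg k expV)) (qExp 1 (leg k expV)) := fun k => by
    refine Lead.qExp_one (IsInt.lead_self ?_)
    rw [expV_eq, (isTopHom_leg k).map_smul, map_mul]
    exact IsInt.smul (m := 0) (n := 0) isInt_scal_neg_two_mul
      ((isInt_leg_gen k _).mul_left (isInt_leg_gen k _))
  exact (((hV 0).mul (hV 1)).mul (lead_ratio11 hq)).mul
    (Lead.qExp_one (lead_Δ_expV hq.nearOne).neg)

/-- The exponents in `limit11'` commute, and their sum is `2 t³ e_α ⊗ e_{-δ+2α}`. -/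
theorem cls_limit11' : cls ((UqA22 q).tensorRel 2) limit11' =
    cls ((UqA22 q).tensorRel 2) (qExp 1 (2 * (scal (tVar ^ 3) * tmul Eα Fδ))) := by
  set r : PowerSeries Laur := -2 * tVar ^ 3 with hr
  have hrX : PowerSeries.X ∣ r := (dvd_pow_self _ three_ne_zero).mul_left _
  set a := cls ((UqA22 q).tensorRel 2) (leg 0 Eα)
  set b := cls ((UqA22 q).tensorRel 2) (leg 0 Fδ)
  set c := cls ((UqA22 q).tensorRel 2) (leg 1 Eα)
  set d := cls ((UqA22 q).tensorRel 2) (leg 1 Fδ)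
  have hEF : ∀ k : Fin 2, Commute (cls ((UqA22 q).tensorRel 2) (leg k Eα))
      (cls ((UqA22 q).tensorRel 2) (leg k Fδ)) := fun k => by
    rw [← HopfPresentation.legHom_cls, ← HopfPresentation.legHom_cls]
    exact Eα_commute_Fδ.map _
  have hab : Commute a b := hEF 0
  have hcd : Commute c d := hEF 1
  have hac : Commute a c := (UqA22 q).leg_commute zero_ne_one _ _
  have had : Commute a d := (UqA22 q).leg_commute zero_ne_one _ _
  have hbc : Commute b c := (UqA22 q).leg_commute zero_ne_one _ _
  have hbd : Commute b d := (UqA22 q).leg_commute zero_ne_one _ _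
  have e₁ : cls ((UqA22 q).tensorRel 2) (leg 0 expV) = r • (a * b) := by
    rw [expV_eq, (isTopHom_leg 0).map_smul, map_mul, cls_smul, map_mul]
  have e₂ : cls ((UqA22 q).tensorRel 2) (leg 1 expV) = r • (c * d) := by
    rw [expV_eq, (isTopHom_leg 1).map_smul, map_mul, cls_smul, map_mul]
  have e₃ : cls ((UqA22 q).tensorRel 2) (-2 * (scal (tVar ^ 3) * tmul Fδ Eα)) = r • (b * c) := by
    rw [neg_two_mul_scal, cls_smul, tmul, map_mul]
  have e₄ : cls ((UqA22 q).tensorRel 2) (-limitΔV) = -(r • ((c + a) * (b + d))) := by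
    rw [map_neg, limitΔV, cls_smul, map_mul, map_add, map_add]
  have X₁ : PowerSeries.X ∣ leg (n := 2) 0 expV := (isTopHom_leg 0).X_dvd X_dvd_expV
  have X₂ : PowerSeries.X ∣ leg (n := 2) 1 expV := (isTopHom_leg 1).X_dvd X_dvd_expV
  have X₃ := X_dvd_mul_scal_tVar (tmul Fδ Eα) (-2)
  have X₄ : PowerSeries.X ∣ -limitΔV := dvd_neg.2 (X_dvd_smul' hrX _)
  have key : ∀ z, Commute z a → Commute z b → Commute z c → Commute z d →
      Commute z (r • (a * b)) ∧ Commute z (r • (c * d)) ∧ Commute z (r • (b * c)) ∧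
        Commute z (-(r • ((c + a) * (b + d)))) := fun z za zb zc zd =>
    ⟨(za.mul_right zb).smul_right _, (zc.mul_right zd).smul_right _,
      (zb.mul_right zc).smul_right _,
      (((zc.add_right za).mul_right (zb.add_right zd)).smul_right _).neg_right⟩
  obtain ⟨a₁, a₂, a₃, -⟩ := key a (Commute.refl _) hab hac had
  obtain ⟨b₁, b₂, b₃, -⟩ := key b hab.symm (Commute.refl _) hbc hbd
  obtain ⟨c₁, c₂, c₃, -⟩ := key c hac.symm hbc.symm (Commute.refl _) hcd
  obtain ⟨d₁, d₂, d₃, -⟩ := key d had.symm hbd.symm hcd.symm (Commute.refl _)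
  obtain ⟨-, k₁₂, k₁₃, k₁₄⟩ := key _ a₁.symm b₁.symm c₁.symm d₁.symm
  obtain ⟨-, -, k₂₃, k₂₄⟩ := key _ a₂.symm b₂.symm c₂.symm d₂.symm
  obtain ⟨-, -, -, k₃₄⟩ := key _ a₃.symm b₃.symm c₃.symm d₃.symm
  rw [← e₁] at k₁₂ k₁₃ k₁₄
  rw [← e₂] at k₁₂ k₂₃ k₂₄
  rw [← e₃] at k₁₃ k₂₃ k₃₄
  rw [← e₄] at k₁₄ k₂₄ k₃₄
  have h₁ : PowerSeries.constantCoeff (1 : PowerSeries Laur) = 1 := map_one _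
  rw [limit11', map_mul, map_mul, map_mul, cls_limit11,
    ← cls_qExp_add h₁ X₁ X₂ (by rw [one_smul, k₁₂.eq]),
    ← cls_qExp_add h₁ (dvd_add X₁ X₂) X₃
      (by rw [one_smul, map_add, (k₁₃.add_left k₂₃).eq]),
    ← cls_qExp_add h₁ (dvd_add (dvd_add X₁ X₂) X₃) X₄
      (by rw [one_smul, map_add, map_add, ((k₁₄.add_left k₂₄).add_left k₃₄).eq])]
  refine cls_qExp_congr (dvd_add (dvd_add (dvd_add X₁ X₂) X₃) X₄) (X_dvd_mul_scal_tVar _ _) ?_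
  have e₅ : cls ((UqA22 q).tensorRel 2) (2 * (scal (tVar ^ 3) * tmul Eα Fδ)) = -(r • (a * d)) := by
    rw [two_mul_scal, cls_smul, tmul, map_mul, ← neg_smul, hr, neg_mul, neg_neg]
  rw [map_add, map_add, map_add, e₁, e₂, e₃, e₄, e₅, add_mul, mul_add, mul_add, ← hbc.eq, smul_add,
    smul_add, smul_add]
  abel

theorem coboundary_W11'_congrModST (hq : IsDeformationParameter q) :
    (UqA22 q).CongrModST (coboundary q (W11' q)) (texp (2 * (scal (tVar ^ 3) * tmul Eα Fδ))) := by
  refine (UqA22 q).congrModST_of_lead (cls_coboundary_W11' hq.constantCoeff) ?_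
    (lead_coboundary_W11' hq) ?_ ?_
  · rw [texp_eq_qExp, cls_limit11']
  · rw [map_mul, map_mul, map_mul, constantCoeff_ratio11, constantCoeff_qExp, constantCoeff_qExp,
      constantCoeff_qExp, one_mul, one_mul, one_mul]
  · rw [limit11', map_mul, map_mul, map_mul, limit11, constantCoeff_formalSum_mul,
      constantCoeff_qExp, constantCoeff_qExp, constantCoeff_qExp, one_mul, one_mul, one_mul]

end GenB

/-! ### Classical limits -/

section Limit

theorem map_texp {R T : Type*} [Ring R] [Algebra ℂ R] [Ring T] [Algebra ℂ T] (φ : R →+* T)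
    (hφ : ∀ c : ℂ, φ (algebraMap ℂ R c) = algebraMap ℂ T c) (x : PowerSeries R) :
    PowerSeries.map φ (texp x) = texp (PowerSeries.map φ x) := by
  have h : ∀ (c : ℂ) (r : R), φ (c • r) = c • φ r := fun c r => by
    rw [Algebra.smul_def, map_mul, hφ, ← Algebra.smul_def]
  ext n
  simp only [texp, formalSum, PowerSeries.coeff_map, PowerSeries.coeff_mk, map_sum,
    PowerSeries.coeff_smul, h, ← map_pow]

variable {G : Type}

/-- The structure map `ℂ[s]⟦t⟧ → ℂ[s]⟨G⟩⟦t⟧` of the integral form. -/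
noncomputable def scalInt (G : Type) : PowerSeries ℂ[X] →+* FreeInt G :=
  PowerSeries.map (algebraMap ℂ[X] (FreeAlgebra ℂ[X] G))

/-- A generator of the integral form. -/
noncomputable def genInt (x : G) : FreeInt G := PowerSeries.C (FreeAlgebra.ι ℂ[X] x)

theorem inclInt_genInt (x : G) : inclInt G (genInt x) = gen x := by
  rw [inclInt, genInt, PowerSeries.map_C, gen]
  simp

theorem inclInt_scalInt (a : PowerSeries ℂ[X]) : inclInt G (scalInt G a) = scal (intScal a) := by
  ext n
  rw [inclInt, scalInt, scal, intScal, PowerSeries.coeff_map, PowerSeries.coeff_map,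
    PowerSeries.coeff_map, PowerSeries.coeff_map, ← LaurentPolynomial.algebraMap_eq_toLaurent,
    ← IsScalarTower.algebraMap_apply]
  exact AlgHom.commutes _ _

theorem inclInt_texp (x : FreeInt G) : inclInt G (texp x) = texp (inclInt G x) := by
  refine map_texp _ (fun c => ?_) x
  rw [IsScalarTower.algebraMap_apply ℂ ℂ[X] (FreeAlgebra ℂ[X] G)]
  refine (AlgHom.commutes _ _).trans ?_
  rw [IsScalarTower.algebraMap_apply ℂ[X] Laur (FreeAlgebra Laur G),
    LaurentPolynomial.algebraMap_eq_toLaurent, Polynomial.algebraMap_apply,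
    Algebra.algebraMap_self_apply, Polynomial.toLaurent_C,
    IsScalarTower.algebraMap_apply ℂ Laur (FreeAlgebra Laur G)]
  rfl

/-- The complex numbers in the ground ring `ℂ[s]⟦t⟧`. -/
noncomputable def cInt (c : ℂ) : PowerSeries ℂ[X] := PowerSeries.C (Polynomial.C c)

theorem intScal_cInt (c : ℂ) : intScal (cInt c) = cscal c := by
  simp [cscal, intScal, cInt]

variable (ev : G → USL3)

/-- The value at `s = 0` of an element of `ℂ[s]⟦t⟧`. -/
noncomputable def atZero : PowerSeries ℂ[X] →+* PowerSeries ℂ :=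
  PowerSeries.map Polynomial.constantCoeff

theorem specialize_scalInt (a : PowerSeries ℂ[X]) : specialize ev (scalInt _ a) =
    PowerSeries.map (algebraMap ℂ (USL3 ⊗[ℂ] USL3)) (atZero a) := by
  let _ : Algebra ℂ[X] (USL3 ⊗[ℂ] USL3) :=
    Algebra.compHom _ (Polynomial.constantCoeff : ℂ[X] →+* ℂ)
  ext n
  rw [specialize, scalInt, atZero, PowerSeries.coeff_map, PowerSeries.coeff_map,
    PowerSeries.coeff_map, PowerSeries.coeff_map]
  exact AlgHom.commutes _ _

theorem specialize_genInt_zero (x : G) :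
    specialize ev (genInt (0, x)) = PowerSeries.C (ev x ⊗ₜ[ℂ] (1 : USL3)) := by
  rw [specialize, genInt, PowerSeries.map_C]
  simp

theorem specialize_genInt_one (x : G) :
    specialize ev (genInt (1, x)) = PowerSeries.C ((1 : USL3) ⊗ₜ[ℂ] ev x) := by
  rw [specialize, genInt, PowerSeries.map_C]
  simp

theorem specialize_texp (x : FreeInt (Fin 2 × G)) :
    specialize ev (texp x) = texp (specialize ev x) := by
  let _ : Algebra ℂ[X] (USL3 ⊗[ℂ] USL3) :=
    Algebra.compHom _ (Polynomial.constantCoeff : ℂ[X] →+* ℂ)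
  refine map_texp _ (fun c => ?_) x
  rw [IsScalarTower.algebraMap_apply ℂ ℂ[X] (FreeAlgebra ℂ[X] (Fin 2 × G))]
  refine (AlgHom.commutes _ _).trans ?_
  change algebraMap ℂ _ (Polynomial.constantCoeff (algebraMap ℂ ℂ[X] c)) = _
  simp

/-- The specialization at `s = 0` annihilates multiples of `s`, so the limit of `F` can be read
off from a congruence modulo `s t`. -/
theorem HopfPresentation.CongrModST.hasLimit {U : HopfPresentation G}
    {F E : FreeTop (Fin 2 × G)} (h : U.CongrModST F (texp E)) {x : FreeInt (Fin 2 × G)}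
    (hx : inclInt _ x = E) {Φ : PowerSeries (USL3 ⊗[ℂ] USL3)} (hΦ : texp (specialize ev x) = Φ) :
    U.HasLimit ev F Φ := by
  obtain ⟨Z, hZ⟩ := h
  refine ⟨texp x + scalInt _ (sInt * PowerSeries.X) * Z, ?_, ?_⟩
  · rw [HopfPresentation.Eq₂, map_add, map_mul, inclInt_texp, hx, inclInt_scalInt, map_mul,
      intScal_sInt, intScal_X, map_add, ← hZ, map_sub, add_sub_cancel]
  · have : atZero (sInt * PowerSeries.X) = 0 := by simp [atZero, sInt]
    rw [map_add, map_mul, specialize_texp, hΦ, specialize_scalInt, this, map_zero, zero_mul,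
      add_zero]

end Limit

/-- `[E₁₂, E₂₃] = E₁₃` in `U(sl₃)`. -/
theorem cE_mul_sub : cE 0 1 (by decide) * cE 1 2 (by decide) -
    cE 1 2 (by decide) * cE 0 1 (by decide) = cE 0 2 (by decide) := by
  let _ : LieRing USL3 := LieRing.ofAssociativeRing
  rw [cE, cE, cE, ← LieRing.of_associative_ring_bracket, ← LieHom.map_lie]
  congr 1
  refine Subtype.ext ?_
  rw [LieAlgebra.SpecialLinear.sl_bracket]
  simp only [LieAlgebra.SpecialLinear.val_single]
  rw [Matrix.single_mul_single_same, Matrix.single_mul_single_of_ne _ _ _ _ (by decide), sub_zero,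
    mul_one]

theorem GenA.F01_hasLimit {q : PowerSeries Laur} (hq : IsDeformationParameter q) (c : ℂ) :
    (UqSL3 q).HasLimit classical (F01 q c) (abelianTwist (-(c • PowerSeries.X ^ 3)) 0) := by
  -- The coefficient `q⁻¹` in `e₁₃` has the lift `p` to `ℂ[s]⟦t⟧`, whose value at `s = 0` is `1`.
  obtain ⟨a, ha⟩ := hq.nearOne.inverse
  set p := 1 + sInt ^ 2 * PowerSeries.X * a with hp
  have hp₀ : atZero p = 1 := by simp [atZero, hp, sInt]
  refine (F01_congrModST hq).hasLimit classical
    (x := scalInt _ (-(cInt c * PowerSeries.X ^ 3)) * (genInt (0, e12) *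
      (genInt (1, e12) * genInt (1, e23) - scalInt _ p * (genInt (1, e23) * genInt (1, e12)))))
    ?_ ?_
  · have h : leg (n := 2) 1 (E13 q) = gen (1, e12) * gen (1, e23) -
        scal (Ring.inverse q) * (gen (1, e23) * gen (1, e12)) := by
      rw [E13, map_sub, map_mul, map_mul, isTopHom_leg, map_mul, E12, E23, leg_gen, leg_gen]
    rw [map_mul, map_mul, map_sub, map_mul, map_mul, map_mul, inclInt_scalInt, inclInt_scalInt,
      inclInt_genInt, inclInt_genInt, inclInt_genInt, ← ha, ← h, map_neg, map_mul, map_pow,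
      intScal_cInt, intScal_X, csmul_eq, ← scal_mul, ← mul_assoc (scal (cscal c)),
      ← map_mul scal, tmul, E12, leg_gen, map_neg]
    have e : ∀ a b : FreeTop (Fin 2 × GenA), -a * b = -(a * b) := fun a b => neg_mul a b
    rw [e]
  · rw [map_mul, map_mul, map_sub, map_mul, map_mul, map_mul, specialize_scalInt,
      specialize_scalInt, specialize_genInt_zero, specialize_genInt_one, specialize_genInt_one, hp₀,
      map_one, one_mul, ← map_mul, ← map_mul, ← map_sub, ← map_mul, abelianTwist]
    congr 2
    · simp [atZero, cInt, PowerSeries.smul_eq_C_mul]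
    · congr 1
      rw [Algebra.TensorProduct.tmul_mul_tmul, Algebra.TensorProduct.tmul_mul_tmul, one_mul,
        ← TensorProduct.tmul_sub, Algebra.TensorProduct.tmul_mul_tmul, one_mul, mul_one, zero_smul,
        add_zero, ← cE_mul_sub]
      rfl

theorem GenB.coboundary_W11'_hasLimit {q : PowerSeries Laur} (hq : IsDeformationParameter q)
    (u : ℂ) : (UqA22 q).HasLimit (evaluation u) (coboundary q (W11' q))
      (abelianTwist ((2 * (Real.sqrt 2 : ℂ) * u⁻¹) • PowerSeries.X ^ 3) 1) := by
  refine (coboundary_W11'_congrModST hq).hasLimit (evaluation u)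
    (x := scalInt _ (2 * PowerSeries.X ^ 3) * (genInt (0, GenB.e) * genInt (1, GenB.f₀))) ?_ ?_
  · rw [map_mul, map_mul (inclInt _) (genInt _), inclInt_scalInt, inclInt_genInt, inclInt_genInt,
      map_mul, map_pow, intScal_X, map_ofNat, two_mul_scal, ← scal_mul, tmul, Eα, Fδ, leg_gen,
      leg_gen]
  · rw [map_mul, map_mul (specialize _) (genInt _), specialize_scalInt,
      specialize_genInt_zero, specialize_genInt_one, ← map_mul, abelianTwist]
    congr 1
    rw [Algebra.TensorProduct.tmul_mul_tmul, one_mul, mul_one, one_smul, evaluation, evaluation,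
      TensorProduct.tmul_smul]
    have e : ∀ (k : ℂ) (T : USL3 ⊗[ℂ] USL3), PowerSeries.C (k • T) =
        PowerSeries.map (algebraMap ℂ (USL3 ⊗[ℂ] USL3)) (PowerSeries.C k) * PowerSeries.C T :=
      fun k T => by rw [PowerSeries.map_C, ← map_mul, Algebra.smul_def]
    rw [e, ← mul_assoc, ← map_mul]
    congr 2
    rw [PowerSeries.smul_eq_C_mul, map_mul, map_mul, map_mul, map_mul, map_pow,
      map_ofNat, map_ofNat, atZero, PowerSeries.map_X]
    ring

end QTwist

theorem mainTheorem7 (q : PowerSeries Laur) (hq : IsDeformationParameter q) :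
    -- the coalgebra of `U_q(h^(0,1))` after the twist by `R₁`
    ((UqSL3 q).IsTwist (R₁ q) ∧
      (UqSL3 q).Eq₂
        (R₁ q * (UqSL3 q).Δ GenA.E12)
        ((tmul (qPow q GenA.H12) GenA.E12 +
          tmul GenA.E12 1) * R₁ q) ∧
      (UqSL3 q).Eq₂
        (R₁ q * (UqSL3 q).Δ (GenA.E13 q))
        ((tmul (qPow q (-GenA.H13)) (GenA.E13 q) +
          tmul (GenA.E13 q) 1) * R₁ q)) ∧
    -- the `q`-twists for `h^(0,1)`; the case `μ = 0`
    (∀ c : ℂ,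
      (UqSL3 q).IsTwist (F01 q c) ∧
      (UqSL3 q).CongrModST (F01 q c)
        (texp (-(c • (scal (tVar ^ 3) *
          tmul GenA.E12 (GenA.E13 q))))) ∧
      (UqSL3 q).HasLimit GenA.classical (F01 q c)
        (abelianTwist (-(c • PowerSeries.X ^ 3)) 0)) ∧
    -- the coboundary `q`-twist of `W` for `h^(1,1)`
    ((UqA22 q).IsTwist (coboundary q (W11 q)) ∧
      (UqA22 q).CongrModST (coboundary q (W11 q))
        (texp (-2 * (scal (tVar ^ 3) *
          tmul GenB.Fδ GenB.Eα)))) ∧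
    -- the coboundary `q`-twist of `W' = exp(-2 t³ e_α e_{-δ+2α}) W`; the case `μ = 1`
    ((UqA22 q).IsTwist (coboundary q (W11' q)) ∧
      (UqA22 q).CongrModST (coboundary q (W11' q))
        (texp (2 * (scal (tVar ^ 3) *
          tmul GenB.Eα GenB.Fδ))) ∧
      ∀ u : ℂ, u ≠ 0 →
        (UqA22 q).HasLimit (GenB.evaluation u)
          (coboundary q (W11' q))
          (abelianTwist
            ((2 * (Real.sqrt 2 : ℂ) * u⁻¹) • PowerSeries.X ^ 3) 1)) := by
  have hc := hq.constantCoeff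
  exact ⟨⟨GenA.R₁_isTwist hc, GenA.R₁_mul_Δ_E12 hc, GenA.R₁_mul_Δ_E13 hc⟩,
    fun c => ⟨GenA.F01_isTwist hc, GenA.F01_congrModST hq, GenA.F01_hasLimit hq c⟩,
    ⟨GenB.coboundary_W11_isTwist hc, GenB.coboundary_W11_congrModST hq⟩,
    GenB.coboundary_W11'_isTwist hc, GenB.coboundary_W11'_congrModST hq,
    fun u _ => GenB.coboundary_W11'_hasLimit hq u⟩
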